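/- Let $\mathscr X$ be a countably infinite alphabet whose elements are called variables, and let the free monoid $\mathscr X^\ast$ be the set of words. A monoid variety is a class of monoids closed under homomorphic images, submonoids and arbitrary direct products. A monoid $M$ satisfies an identity $\mathbf u\approx\mathbf v$ (where $\mathbf u,\mathbf v\in\mathscr X^\ast$) if $\varphi(\mathbf u)=\varphi(\mathbf v)$ for every substitution $\varphi\colon\mathscr X\to M$. For a variety $\mathbb V$ and a set $\Sigma$ of identities, $\mathbb V\Sigma$ is the subvariety of all monoids in $\mathbb V$ that satisfy every identity in $\Sigma$, and $\mathfrak L(\mathbb V)$ is the lattice of subvarieties of $\mathbb V$, ordered by inclusion. For a set $\mathscr W$ of words, the factor monoid $M(\mathscr W)$ consists of all factors of words in $\mathscr W$ (including the empty word, which is its identity element) and a zero element $0$; the product of two factors $\mathbf u,\mathbf v$ is $\mathbf u\mathbf v$ if this is a factor of a word in $\mathscr W$, and $0$ otherwise. Let $\mathbb M(\mathscr W)$ be the variety generated by $M(\mathscr W)$. Let $n\ge2$, and let $a,b,t,a_i,b_i,z_i,z_i',z_i'',t_i,t_i',t_i'',x_1^{(i)},x_2^{(i)}$ $(1\le i\le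 n)$ and $s_i,y_i$ $(0\le i\le n)$ be distinct variables. For $\xi=(\xi_1,\dots,\xi_n)\in S_2^n$, where $S_2$ is the symmetric group on $\{1,2\}$ and $k\xi_i$ denotes the image of $k$ under $\xi_i$, put $$\mathbf w_\xi:=\mathbf p\Bigl(\prod_{i=1}^n a_i\Bigr)a\Bigl(\prod_{i=1}^n x^{(i)}_{1\xi_i}x^{(i)}_{2\xi_i}\Bigr)b\Bigl(\prod_{i=1}^n b_i\Bigr)\mathbf q\,\mathbf r,$$ where $$\mathbf p:=\Bigl(\prod_{i=1}^n z_it_i\Bigr)\Bigl(\prod_{i=1}^n z_i't_i'\Bigr)\Bigl(\prod_{i=1}^n z_i''t_i''\Bigr),\qquad \mathbf q:=\Bigl(\prod_{i=0}^n s_iy_i\Bigr)t,\qquad \mathbf r:=by_0\Bigl(\prod_{i=1}^n x_1^{(i)}z_ia_iz_i'b_iz_i''x_2^{(i)}y_i\Bigr)a,$$ all products being taken in increasing order of $i$. Let $\mathscr W_n:=\{\mathbf w_\xi\mid\xi\in S_2^n\}$. Let $\mathfrak{Eq}(\mathscr W_n)$ be the lattice of equivalence relations on $\mathscr W_n$,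 let $\upsilon$ be the universal relation on $\mathscr W_n$, and for $\pi\in\mathfrak{Eq}(\mathscr W_n)$ put $\mathsf{Id}(\pi):=\{\mathbf u\approx\mathbf v\mid(\mathbf u,\mathbf v)\in\pi\}$. Then, for each $n\ge2$, the lattice $\mathfrak{Eq}(\mathscr W_n)$ is anti-isomorphic to the interval $[\mathbb M(\mathscr W_n)\,\mathsf{Id}(\upsilon),\ \mathbb M(\mathscr W_n)]$ of the lattice $\mathfrak L(\mathbb M(\mathscr W_n))$, and the map $\pi\mapsto\mathbb M(\mathscr W_n)\,\mathsf{Id}(\pi)$ is an anti-isomorphism. -/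

import Mathlib

universe u

/-! ### Words and identities -/

/-- A concrete countably infinite alphabet of variables. It contains, under the name they have in
the words below, the pairwise distinct variables `a, b, t, aᵢ, bᵢ, sᵢ, yᵢ, zᵢ, zᵢ′, zᵢ″, tᵢ, tᵢ′,
tᵢ″` and `x₁⁽ⁱ⁾, x₂⁽ⁱ⁾` (here `x 0 i` and `x 1 i`). For each `n`, only finitely many of them are
used in the words with parameter `n`. -/
inductive Letter : Type
  | a | b | t
  | aI (i : ℕ) | bI (i : ℕ)
  | s (i : ℕ) | y (i : ℕ)
  | z (i : ℕ) | zP (i : ℕ) | zPP (i : ℕ)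
  | tI (i : ℕ) | tP (i : ℕ) | tPP (i : ℕ)
  | x (j : Fin 2) (i : ℕ)
  deriving DecidableEq

/-- Words: the elements of the free monoid over the alphabet, the empty word `1` included. -/
abbrev Word : Type := FreeMonoid Letter

/-- `u` is a factor of `w`: a contiguous subword. -/
def Word.IsFactor (u w : Word) : Prop := ∃ p q : Word, w = p * u * q

/-- An identity `u ≈ v`, encoded as the pair `(u, v)`. -/
abbrev Identity : Type := Word × Word

/-- The monoid `M` satisfies `e.1 ≈ e.2`: every substitution of elements of `M` for the variables
gives both sides the same value. -/
def Satisfies (M : Type u) [Monoid M] (e : Identity) : Prop :=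
  ∀ φ : Letter → M, FreeMonoid.lift φ e.1 = FreeMonoid.lift φ e.2

/-! ### Varieties of monoids -/

/-- A variety of monoids: a class of monoids closed under homomorphic images, submonoids and
arbitrary direct products. (It is nonempty, by the empty product, and closed under isomorphism,
by the first closure property.) -/
@[ext]
structure MonoidVariety : Type (u + 1) where
  Mem : ∀ (M : Type u) [Monoid M], Prop
  mem_of_surjective : ∀ {M N : Type u} [Monoid M] [Monoid N] (f : M →* N),
    Function.Surjective f → Mem M → Mem N
  mem_submonoid : ∀ {M : Type u} [Monoid M] (S : Submonoid M), Mem M → Mem S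
  mem_pi : ∀ {ι : Type u} (M : ι → Type u) [∀ i, Monoid (M i)],
    (∀ i, Mem (M i)) → Mem (∀ i, M i)

namespace MonoidVariety

/-- Varieties are ordered by inclusion. -/
instance : PartialOrder MonoidVariety.{u} where
  le V V' := ∀ (M : Type u) [Monoid M], V.Mem M → V'.Mem M
  le_refl _ _ _ h := h
  le_trans _ _ _ h₁ h₂ M _ h := h₂ M (h₁ M h)
  le_antisymm V V' h₁ h₂ := by
    ext M inst
    exact ⟨h₁ M, h₂ M⟩

/-- The infimum of a family of varieties is its intersection. -/
instance : InfSet MonoidVariety.{u} where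
  sInf C :=
    { Mem := fun M _ => ∀ V ∈ C, V.Mem M
      mem_of_surjective := fun f hf h V hV => V.mem_of_surjective f hf (h V hV)
      mem_submonoid := fun S h V hV => V.mem_submonoid S (h V hV)
      mem_pi := fun M _ h V hV => V.mem_pi M fun i => h i V hV }

/-- The lattice of all varieties of monoids. -/
instance : CompleteLattice MonoidVariety.{u} :=
  completeLatticeOfInf _ fun _ =>
    ⟨fun V hV _ _ h => h V hV, fun _ h M _ hM _ hV => h hV M hM⟩

/-- The variety generated by a monoid: the least variety that contains it. -/
def generatedBy (M : Type u) [Monoid M] : MonoidVariety.{u} :=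
  sInf {V | V.Mem M}

/-- The subvariety of `V` defined within `V` by a set `E` of identities. -/
def definedBy (V : MonoidVariety.{u}) (E : Set Identity) : MonoidVariety.{u} where
  Mem M _ := V.Mem M ∧ ∀ e ∈ E, Satisfies M e
  mem_of_surjective {M N} _ _ f hf h := by
    refine ⟨V.mem_of_surjective f hf h.1, fun e he φ => ?_⟩
    choose g hg using hf
    have key : ∀ w : Word, FreeMonoid.lift φ w = f (FreeMonoid.lift (fun l => g (φ l)) w) := by
      intro w
      rw [← MonoidHom.comp_apply]
      congr 1
      ext l
      simp [hg]
    rw [key, key, h.2 e he]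
  mem_submonoid {M} _ S h := by
    refine ⟨V.mem_submonoid S h.1, fun e he φ => S.subtype_injective ?_⟩
    have key : ∀ w : Word,
        S.subtype (FreeMonoid.lift φ w) = FreeMonoid.lift (fun l => (φ l : M)) w := by
      intro w
      rw [← MonoidHom.comp_apply]
      congr 1
      ext l
      simp
    rw [key, key, h.2 e he]
  mem_pi {ι} M _ h := by
    refine ⟨V.mem_pi M fun i => (h i).1, fun e he φ => funext fun i => ?_⟩
    have key : ∀ w : Word,
        FreeMonoid.lift φ w i = FreeMonoid.lift (fun l => φ l i) w := by
      intro w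
      change Pi.evalMonoidHom M i (FreeMonoid.lift φ w) = _
      rw [← MonoidHom.comp_apply]
      congr 1
      ext l
      simp
    rw [key, key, (h i).2 e he]

theorem definedBy_le (V : MonoidVariety.{u}) (E : Set Identity) : V.definedBy E ≤ V :=
  fun _ _ h => h.1

/-- The lattice of subvarieties of `V`. -/
abbrev Subvarieties (V : MonoidVariety.{u}) : Type (u + 1) := Set.Iic V

/-- The subvariety of `V` defined by `E`, as an element of the lattice of subvarieties of `V`. -/
def subvarietyOf (V : MonoidVariety.{u}) (E : Set Identity) : V.Subvarieties :=
  ⟨V.definedBy E, V.definedBy_le E⟩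

end MonoidVariety

/-! ### Factor monoids -/

/-- `u` is a nonzero element of the factor monoid of `W`: a factor of some word in `W`, or the
empty word (which is such a factor as soon as `W` is nonempty). -/
def IsFactorOfSet (W : Set Word) (u : Word) : Prop := u = 1 ∨ ∃ w ∈ W, u.IsFactor w

theorem IsFactorOfSet.left {W : Set Word} {u v : Word} (h : IsFactorOfSet W (u * v)) :
    IsFactorOfSet W u := by
  rcases h with h | ⟨w, hw, p, q, h⟩
  · exact Or.inl (List.append_eq_nil_iff.1 h).1
  · exact Or.inr ⟨w, hw, p, v * q, by simp only [h, mul_assoc]⟩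

theorem IsFactorOfSet.right {W : Set Word} {u v : Word} (h : IsFactorOfSet W (u * v)) :
    IsFactorOfSet W v := by
  rcases h with h | ⟨w, hw, p, q, h⟩
  · exact Or.inl (List.append_eq_nil_iff.1 h).2
  · exact Or.inr ⟨w, hw, p * u, q, by simp only [h, mul_assoc]⟩

/-- The factor monoid of `W`: all factors of words in `W`, together with a zero element. -/
inductive FactorMonoid (W : Set Word) : Type
  | zero : FactorMonoid W
  | factor (u : Word) (hu : IsFactorOfSet W u) : FactorMonoid W

namespace FactorMonoid

variable {W : Set Word}

open Classical in
/-- The product of two factors is their concatenation if that is a factor again, and zero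
otherwise. -/
noncomputable def mul : FactorMonoid W → FactorMonoid W → FactorMonoid W
  | factor u _, factor v _ => if h : IsFactorOfSet W (u * v) then factor (u * v) h else zero
  | _, _ => zero

noncomputable instance : Monoid (FactorMonoid W) where
  mul := mul
  one := factor 1 (Or.inl rfl)
  one_mul m := by
    change mul (factor 1 _) m = m
    cases m with
    | zero => rfl
    | factor u hu => simp [mul, hu]
  mul_one m := by
    change mul m (factor 1 _) = m
    cases m with
    | zero => rfl
    | factor u hu => simp [mul, hu]
  mul_assoc k l m := by
    change mul (mul k l) m = mul k (mul l m)
    cases k with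
    | zero => rfl
    | factor u hu =>
      cases l with
      | zero => rfl
      | factor v hv =>
        cases m with
        | zero => by_cases h : IsFactorOfSet W (u * v) <;> simp [mul, h]
        | factor w hw =>
          by_cases h : IsFactorOfSet W (u * v * w)
          · have h₁ : IsFactorOfSet W (u * v) := h.left
            have h' : IsFactorOfSet W (u * (v * w)) := by rwa [← mul_assoc]
            have h₂ : IsFactorOfSet W (v * w) := h'.right
            simp [mul, h₁, h₂, h', mul_assoc]
          · have h' : ¬ IsFactorOfSet W (u * (v * w)) := by rwa [← mul_assoc]
            by_cases h₁ : IsFactorOfSet W (u * v) <;> by_cases h₂ : IsFactorOfSet W (v * w) <;>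
              simp [mul, h₁, h₂, h', mul_assoc]

end FactorMonoid

/-- The variety generated by the factor monoid of `W` (lifted to the universe of the monoids
under consideration). -/
noncomputable def factorVariety (W : Set Word) : MonoidVariety.{u} :=
  MonoidVariety.generatedBy (ULift.{u} (FactorMonoid W))

/-! ### The words -/

/-- The one-letter word. -/
abbrev Letter.w (l : Letter) : Word := FreeMonoid.of l

/-- The product `∏_{i=1}^n f i` in increasing order of the indices. -/
def wordProd (n : ℕ) (f : Fin n → Word) : Word := (List.ofFn f).prod

open Letter in
/-- `(∏ zᵢtᵢ)(∏ zᵢ′tᵢ′)(∏ zᵢ″tᵢ″)`, each product over `i = 1, …, n`; the element `i` of `Fin n`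
stands for the index `i + 1`, here and below. -/
def wordP (n : ℕ) : Word :=
  wordProd n (fun i => (z (i + 1)).w * (tI (i + 1)).w) *
  wordProd n (fun i => (zP (i + 1)).w * (tP (i + 1)).w) *
  wordProd n (fun i => (zPP (i + 1)).w * (tPP (i + 1)).w)

open Letter in
/-- `(∏_{i=0}^n sᵢyᵢ) t`. -/
def wordQ (n : ℕ) : Word :=
  wordProd (n + 1) (fun i => (s i).w * (y i).w) * t.w

open Letter in
/-- `b y₀ (∏_{i=1}^n x₁⁽ⁱ⁾ zᵢ aᵢ zᵢ′ bᵢ zᵢ″ x₂⁽ⁱ⁾ yᵢ) a`. -/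
def wordR (n : ℕ) : Word :=
  b.w * (y 0).w *
  wordProd n (fun i => (x 0 (i + 1)).w * (z (i + 1)).w * (aI (i + 1)).w * (zP (i + 1)).w *
    (bI (i + 1)).w * (zPP (i + 1)).w * (x 1 (i + 1)).w * (y (i + 1)).w) *
  a.w

open Letter in
/-- The word `w_ξ`, for `ξ` in the direct power `S₂ⁿ` of the symmetric group on two symbols:
`p (∏ aᵢ) a (∏ x⁽ⁱ⁾_{1ξᵢ} x⁽ⁱ⁾_{2ξᵢ}) b (∏ bᵢ) q r`, each product over `i = 1, …, n`. -/
def wordW {n : ℕ} (ξ : Fin n → Equiv.Perm (Fin 2)) : Word :=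
  wordP n * wordProd n (fun i => (aI (i + 1)).w) * a.w *
  wordProd n (fun i => (x (ξ i 0) (i + 1)).w * (x (ξ i 1) (i + 1)).w) *
  b.w * wordProd n (fun i => (bI (i + 1)).w) * wordQ n * wordR n

/-- The set `W_n` of all words `w_ξ` with `ξ ∈ S₂ⁿ`. -/
def wordSet (n : ℕ) : Set Word :=
  Set.range fun ξ : Fin n → Equiv.Perm (Fin 2) => wordW ξ

/-- The set `Id(π)` of the identities `u ≈ v` with `(u, v) ∈ π`, for an equivalence relation `π`
on a set of words. -/
def identitiesOf {W : Set Word} (π : Setoid W) : Set Identity :=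
  {e | ∃ u v : W, π u v ∧ e = ((u : Word), (v : Word))}

/-!
# Equivalence relations on `W_n` and subvarieties of `𝕄(W_n)`

By Birkhoff's theorem (`mem_of_satisfies`) subvarieties are determined by their identities, and
the identities of the variety defined within `𝕄(W_n)` by `Id(π)` are those `u ≈ v` for which `u`
can be transformed into `v` by identities of the factor monoid and by replacements of `pφ(w_ξ)q`
by `pφ(w_η)q` with `(w_ξ, w_η) ∈ π` (`satisfies_of_der`, `der_of_satisfies`). Two facts about such
derivations are needed.

*Derivations do not identify too much.* The words `w_ξ` are so tight that a substitution `χ`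
sending `pφ(w_ξ)q` to a factor of a word in `W_n` either does not see the permutations `ξ`,
because it erases one of `x₁⁽ⁱ⁾`, `x₂⁽ⁱ⁾` for every `i`, or is *rigid*: it erases `p` and `q`, and
`χ(φ(c)) = c` for every letter `c` (`rigidity`, `Fac.rigid_or_collapse`). Consequently a
derivation changes a nonzero value of a substitution only from some `w_ξ` to a word related to it
by `π` (`Der.value`), so that `π` can be recovered from its variety.

*Every variety in the interval arises.* A variety `V` in the interval induces a relation `π` on
`W_n`. If `u ≈ v` holds in `V`, it is derivable from all identities `w_ξ ≈ w_η`, and one has to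
derive it from those in `π` (`DerT.der`). Along the given derivation, finitely many words `f =
pφ(w_ξ)q` account for all changes of values. They are treated one at a time:

* All substitutions rigid for `f` take the same value on `u`, and the same on `v`
  (`DerT.rigid_value_eq`). Two of them are compared through a hybrid that agrees with the first
  one on `x₁⁽¹⁾, x₂⁽¹⁾` and with the second one on `x₁⁽²⁾, x₂⁽²⁾`; this uses `n ≥ 2`.
* If some substitution is rigid for `f`, then `u` is equal in the factor monoid to a word
  `p'φ'(w_ζ)q'` for which it is rigid as well (`DerT.exists_form`). Hence the value can be
  corrected by a single replacement of `w_ζ` by `w_η`, where `(w_ζ, w_η) ∈ π` because these are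
  the values of a substitution on `u` and `v`.

For the second point, one first reduces to the case that `φ` sends each letter occurring twice in
`w_ξ` to a single letter. Then `u` contains a copy of some `w_ζ` as a subword, and the foreign
letters standing inside the blocks `a₁ … a … b … bₙ` and `b y₀ … yₙ a` of this copy have to be
moved out of them. Derivations preserve certain patterns of occurrences, namely those that can be
encoded in a proper factor of a word `w_ξ` (`DerT.sublist`). Comparing `u` with `pφ(w_ξ)q`, whose
blocks contain no foreign letters, one finds that a foreign letter inside a block is erased by
every substitution with a nonzero value that keeps letters of the block, up to exceptions next to
`b` and `a` in the second block (`Reduced.not_split_of_left`, `Reduced.unseparated_of_right`). So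
the foreign letters can be moved without leaving the equational theory of the factor monoid
(`Blocks.eq1_rearranged`).
-/

set_option linter.unusedSimpArgs false
set_option linter.unnecessarySeqFocus false

/-! ### The words as lists, with the position of every letter -/

namespace FactorLattice

/-- The two letters `x₁⁽ᵏ⁾, x₂⁽ᵏ⁾` in the order prescribed by a bit. -/
def xPair (e : Bool) (k : ℕ) : List Letter :=
  if e then [.x 1 k, .x 0 k] else [.x 0 k, .x 1 k]

/-- The prefix `p` of the words. -/
def listP (n : ℕ) : List Letter :=
  ((List.range n).flatMap fun i => [.z (i + 1), .tI (i + 1)]) ++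
  (((List.range n).flatMap fun i => [.zP (i + 1), .tP (i + 1)]) ++
  ((List.range n).flatMap fun i => [.zPP (i + 1), .tPP (i + 1)]))

/-- The block `(∏ aᵢ) a (∏ x⁽ⁱ⁾x⁽ⁱ⁾) b (∏ bᵢ)`, the order of `x₁⁽ⁱ⁾` and `x₂⁽ⁱ⁾` being given by
`ε i`. -/
def listA (n : ℕ) (ε : ℕ → Bool) : List Letter :=
  ((List.range n).flatMap fun i => [.aI (i + 1)]) ++ (.a ::
  (((List.range n).flatMap fun i => xPair (ε (i + 1)) (i + 1)) ++ (.b ::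
  ((List.range n).flatMap fun i => [.bI (i + 1)]))))

/-- The block `q` of the words. -/
def listQ (n : ℕ) : List Letter :=
  ((List.range (n + 1)).flatMap fun i => [.s i, .y i]) ++ [.t]

/-- The suffix `r` of the words. -/
def listR (n : ℕ) : List Letter :=
  [.b, .y 0] ++ (((List.range n).flatMap fun i =>
    [.x 0 (i + 1), .z (i + 1), .aI (i + 1), .zP (i + 1), .bI (i + 1), .zPP (i + 1), .x 1 (i + 1),
      .y (i + 1)]) ++ [.a])

/-- The word `w_ξ`, as a list; `ε` encodes `ξ` by `ε i = true` iff `ξᵢ` is the transposition. -/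
def wl (n : ℕ) (ε : ℕ → Bool) : List Letter :=
  listP n ++ (listA n ε ++ (listQ n ++ listR n))

theorem getElem?_flatMap_range {α : Type*} {m : ℕ} (hm : 0 < m) (f : ℕ → List α)
    (hf : ∀ i, (f i).length = m) (n k : ℕ) :
    ((List.range n).flatMap f)[k]? = if k < m * n then (f (k / m))[k % m]? else none := by
  have hlen : ∀ n, ((List.range n).flatMap f).length = m * n := by
    intro n; simp [List.length_flatMap, hf, mul_comm]
  induction n with
  | zero => simp
  | succ n ih =>
    rw [List.range_succ, List.flatMap_append, List.getElem?_append, hlen, ih]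
    by_cases h : k < m * n
    · have : k < m * (n + 1) := by nlinarith
      simp [h, this]
    · simp only [h, if_false, List.flatMap_cons, List.flatMap_nil, List.append_nil]
      by_cases h2 : k < m * (n + 1)
      · have hk : k = (k - m * n) + m * n := by omega
        have hlt : k - m * n < m := by rw [mul_add] at h2; omega
        have hd : k / m = n := by
          rw [hk, Nat.add_mul_div_left _ _ hm, Nat.div_eq_of_lt hlt, zero_add]
        have hmod : k % m = k - m * n := by
          conv_lhs => rw [hk]
          rw [Nat.add_mul_mod_self_left, Nat.mod_eq_of_lt hlt]
        rw [if_pos h2, hd, hmod]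
      · rw [if_neg h2]
        rw [List.getElem?_eq_none]
        rw [hf, mul_add] at *; omega

theorem length_flatMap_range {α : Type*} {m : ℕ} (f : ℕ → List α)
    (hf : ∀ i, (f i).length = m) (n : ℕ) : ((List.range n).flatMap f).length = m * n := by
  simp [List.length_flatMap, hf, mul_comm]

@[simp] theorem length_xPair (e : Bool) (k : ℕ) : (xPair e k).length = 2 := by
  unfold xPair; split <;> rfl

theorem length_listP (n : ℕ) : (listP n).length = 6 * n := by
  unfold listP
  simp only [List.length_append]
  rw [length_flatMap_range (m := 2) _ (by simp), length_flatMap_range (m := 2) _ (by simp),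
    length_flatMap_range (m := 2) _ (by simp)]
  omega

theorem length_listA (n : ℕ) (ε) : (listA n ε).length = 4 * n + 2 := by
  unfold listA
  simp only [List.length_append, List.length_cons]
  rw [length_flatMap_range (m := 1) _ (by simp), length_flatMap_range (m := 2) _ (by simp),
    length_flatMap_range (m := 1) _ (by simp)]
  omega

theorem length_listQ (n : ℕ) : (listQ n).length = 2 * n + 3 := by
  unfold listQ
  simp only [List.length_append, List.length_cons]
  rw [length_flatMap_range (m := 2) _ (by simp)]
  simp; omega

theorem length_listR (n : ℕ) : (listR n).length = 8 * n + 3 := by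
  unfold listR
  simp only [List.length_append, List.length_cons]
  rw [length_flatMap_range (m := 8) _ (by simp)]
  simp; omega

theorem length_wl (n : ℕ) (ε) : (wl n ε).length = 20 * n + 8 := by
  simp only [wl, List.length_append, length_listP, length_listA, length_listQ, length_listR]
  omega

/-- `Occ n ε c p`: the letter `c` stands at position `p` of the word `wl n ε`. -/
def Occ (n : ℕ) (ε : ℕ → Bool) : Letter → ℕ → Prop
  | .a, p => p = 7 * n ∨ p = 20 * n + 7
  | .b, p => p = 9 * n + 1 ∨ p = 12 * n + 5
  | .t, p => p = 12 * n + 4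
  | .aI k, p => 1 ≤ k ∧ k ≤ n ∧ (p + 1 = 6 * n + k ∨ p = 12 * n + 8 * k + 1)
  | .bI k, p => 1 ≤ k ∧ k ≤ n ∧ (p = 9 * n + 1 + k ∨ p = 12 * n + 8 * k + 3)
  | .s k, p => k ≤ n ∧ p = 10 * n + 2 + 2 * k
  | .y k, p => k ≤ n ∧ (p = 10 * n + 3 + 2 * k ∨ p = 12 * n + 8 * k + 6)
  | .z k, p => 1 ≤ k ∧ k ≤ n ∧ (p + 2 = 2 * k ∨ p = 12 * n + 8 * k)
  | .zP k, p => 1 ≤ k ∧ k ≤ n ∧ (p + 2 = 2 * n + 2 * k ∨ p = 12 * n + 8 * k + 2)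
  | .zPP k, p => 1 ≤ k ∧ k ≤ n ∧ (p + 2 = 4 * n + 2 * k ∨ p = 12 * n + 8 * k + 4)
  | .tI k, p => 1 ≤ k ∧ k ≤ n ∧ p + 1 = 2 * k
  | .tP k, p => 1 ≤ k ∧ k ≤ n ∧ p + 1 = 2 * n + 2 * k
  | .tPP k, p => 1 ≤ k ∧ k ≤ n ∧ p + 1 = 4 * n + 2 * k
  | .x 0 k, p => 1 ≤ k ∧ k ≤ n ∧ (p + 1 = 7 * n + 2 * k + (ε k).toNat ∨ p + 1 = 12 * n + 8 * k)
  | .x 1 k, p => 1 ≤ k ∧ k ≤ n ∧ (p + (ε k).toNat = 7 * n + 2 * k ∨ p = 12 * n + 8 * k + 5)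

theorem Occ.unique {n : ℕ} {ε : ℕ → Bool} {c d : Letter} {p : ℕ} (hc : Occ n ε c p)
    (hd : Occ n ε d p) : c = d := by
  have hε : ∀ k, (ε k).toNat ≤ 1 := fun k => Bool.toNat_le _
  rcases c with _ | _ | _ | k | k | k | k | k | k | k | k | k | k | ⟨j, k⟩ <;>
  rcases d with _ | _ | _ | l | l | l | l | l | l | l | l | l | l | ⟨j', l⟩ <;>
  (try fin_cases j) <;> (try fin_cases j') <;>
  simp only [Occ, Fin.mk_zero, Fin.mk_one, Fin.zero_eta, Fin.isValue, reduceCtorEq,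
    Letter.aI.injEq, Letter.bI.injEq, Letter.s.injEq, Letter.y.injEq, Letter.z.injEq,
    Letter.zP.injEq, Letter.zPP.injEq, Letter.tI.injEq, Letter.tP.injEq, Letter.tPP.injEq,
    Letter.x.injEq, true_and, false_and, zero_ne_one, one_ne_zero] at hc hd ⊢ <;>
  first
  | omega
  | (have h1 := hε k; omega)
  | (have h1 := hε l; omega)
  | (have h1 := hε k; have h2 := hε l; omega)
  | (have h1 := hε k; have h2 := hε l
     obtain rfl : k = l := by omega
     omega)

theorem exists_getElem?_wl_occ (n : ℕ) (ε : ℕ → Bool) (p : ℕ) (hp : p < 20 * n + 8) :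
    ∃ c, (wl n ε)[p]? = some c ∧ Occ n ε c p := by
  have e2 : ∀ k : ℕ, k % 2 = 0 ∨ k % 2 = 1 := by omega
  have e8 : ∀ k : ℕ, k % 8 = 0 ∨ k % 8 = 1 ∨ k % 8 = 2 ∨ k % 8 = 3 ∨ k % 8 = 4 ∨ k % 8 = 5 ∨
    k % 8 = 6 ∨ k % 8 = 7 := by omega
  simp only [wl, List.getElem?_append, length_listP, length_listA, length_listQ]
  by_cases h1 : p < 6 * n
  · rw [if_pos h1, listP, List.getElem?_append, List.getElem?_append,
      length_flatMap_range (m := 2) _ (by simp), length_flatMap_range (m := 2) _ (by simp),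
      getElem?_flatMap_range (m := 2) two_pos _ (by simp),
      getElem?_flatMap_range (m := 2) two_pos _ (by simp),
      getElem?_flatMap_range (m := 2) two_pos _ (by simp)]
    rcases e2 p with h | h
    · by_cases h2 : p < 2 * n
      · exact ⟨.z (p / 2 + 1), by simp [h2, h], by simp only [Occ]; omega⟩
      by_cases h3 : p - 2 * n < 2 * n
      · refine ⟨.zP ((p - 2 * n) / 2 + 1), ?_, by simp only [Occ]; omega⟩
        have : (p - 2 * n) % 2 = 0 := by omega
        simp [h2, h3, this]
      · refine ⟨.zPP ((p - 2 * n - 2 * n) / 2 + 1), ?_, by simp only [Occ]; omega⟩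
        have : (p - 2 * n - 2 * n) % 2 = 0 := by omega
        have h4 : p - 2 * n - 2 * n < 2 * n := by omega
        simp [h2, h3, h4, this]
    · by_cases h2 : p < 2 * n
      · exact ⟨.tI (p / 2 + 1), by simp [h2, h], by simp only [Occ]; omega⟩
      by_cases h3 : p - 2 * n < 2 * n
      · refine ⟨.tP ((p - 2 * n) / 2 + 1), ?_, by simp only [Occ]; omega⟩
        have : (p - 2 * n) % 2 = 1 := by omega
        simp [h2, h3, this]
      · refine ⟨.tPP ((p - 2 * n - 2 * n) / 2 + 1), ?_, by simp only [Occ]; omega⟩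
        have : (p - 2 * n - 2 * n) % 2 = 1 := by omega
        have h4 : p - 2 * n - 2 * n < 2 * n := by omega
        simp [h2, h3, h4, this]
  rw [if_neg h1]
  obtain ⟨q, rfl⟩ : ∃ q, p = 6 * n + q := ⟨p - 6 * n, by omega⟩
  rw [Nat.add_sub_cancel_left]
  by_cases h2 : q < 4 * n + 2
  · rw [if_pos h2, listA]
    by_cases h3 : q < n
    · refine ⟨.aI (q + 1), ?_, by simp only [Occ]; omega⟩
      rw [List.getElem?_append, length_flatMap_range (m := 1) _ (by simp),
        getElem?_flatMap_range (m := 1) one_pos _ (by simp)]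
      simp [h3, Nat.mod_one]
    rw [List.getElem?_append_right (by rw [length_flatMap_range (m := 1) _ (by simp)]; omega),
      length_flatMap_range (m := 1) _ (by simp)]
    obtain ⟨r, rfl⟩ : ∃ r, q = n + r := ⟨q - n, by omega⟩
    rw [one_mul, Nat.add_sub_cancel_left]
    rcases r with _ | r
    · exact ⟨.a, by simp, by simp only [Occ]; omega⟩
    rw [List.getElem?_cons_succ]
    by_cases h4 : r < 2 * n
    · rw [List.getElem?_append, length_flatMap_range (m := 2) _ (by simp),
        getElem?_flatMap_range (m := 2) two_pos _ (by simp), if_pos h4, if_pos h4]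
      rcases e2 r with h | h <;> rw [h] <;> cases hε : ε (r / 2 + 1)
      · refine ⟨.x 0 (r / 2 + 1), by simp [xPair], ?_⟩
        simp only [Occ, hε, Bool.toNat_false]; omega
      · refine ⟨.x 1 (r / 2 + 1), by simp [xPair], ?_⟩
        simp only [Occ, hε, Bool.toNat_true]; omega
      · refine ⟨.x 1 (r / 2 + 1), by simp [xPair], ?_⟩
        simp only [Occ, hε, Bool.toNat_false]; omega
      · refine ⟨.x 0 (r / 2 + 1), by simp [xPair], ?_⟩
        simp only [Occ, hε, Bool.toNat_true]; omega
    rw [List.getElem?_append_right (by rw [length_flatMap_range (m := 2) _ (by simp)]; omega),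
      length_flatMap_range (m := 2) _ (by simp)]
    obtain ⟨q, rfl⟩ : ∃ q, r = 2 * n + q := ⟨r - 2 * n, by omega⟩
    rw [Nat.add_sub_cancel_left]
    rcases q with _ | q
    · exact ⟨.b, by simp, by simp only [Occ]; omega⟩
    rw [List.getElem?_cons_succ, getElem?_flatMap_range (m := 1) one_pos _ (by simp)]
    have h5 : q < n := by omega
    exact ⟨.bI (q + 1), by simp [h5, Nat.mod_one], by simp only [Occ]; omega⟩
  rw [if_neg h2]
  obtain ⟨r, rfl⟩ : ∃ r, q = 4 * n + 2 + r := ⟨q - (4 * n + 2), by omega⟩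
  rw [Nat.add_sub_cancel_left]
  by_cases h3 : r < 2 * n + 3
  · rw [if_pos h3, listQ, List.getElem?_append, length_flatMap_range (m := 2) _ (by simp),
        getElem?_flatMap_range (m := 2) two_pos _ (by simp)]
    by_cases h4 : r < 2 * (n + 1)
    · rw [if_pos h4, if_pos h4]
      rcases e2 r with h | h <;> rw [h]
      · exact ⟨.s (r / 2), by simp, by simp only [Occ]; omega⟩
      · exact ⟨.y (r / 2), by simp, by simp only [Occ]; omega⟩
    · rw [if_neg h4]
      have : r - 2 * (n + 1) = 0 := by omega
      exact ⟨.t, by simp [this], by simp only [Occ]; omega⟩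
  rw [if_neg h3, listR]
  obtain ⟨q, rfl⟩ : ∃ q, r = 2 * n + 3 + q := ⟨r - (2 * n + 3), by omega⟩
  rw [Nat.add_sub_cancel_left]
  rcases q with _ | _ | q
  · exact ⟨.b, by simp, by simp only [Occ]; omega⟩
  · exact ⟨.y 0, by simp, by simp only [Occ]; omega⟩
  rw [List.getElem?_append_right (by simp)]
  simp only [List.length_cons, List.length_nil, zero_add, Nat.reduceAdd]
  rw [show q + 1 + 1 - 2 = q by omega, List.getElem?_append,
    length_flatMap_range (m := 8) _ (by simp),
    getElem?_flatMap_range (m := 8) (by norm_num) _ (by simp)]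
  by_cases h4 : q < 8 * n
  · rw [if_pos h4, if_pos h4]
    rcases e8 q with h | h | h | h | h | h | h | h <;> rw [h]
    · exact ⟨.x 0 (q / 8 + 1), by simp, by simp only [Occ]; omega⟩
    · exact ⟨.z (q / 8 + 1), by simp, by simp only [Occ]; omega⟩
    · exact ⟨.aI (q / 8 + 1), by simp, by simp only [Occ]; omega⟩
    · exact ⟨.zP (q / 8 + 1), by simp, by simp only [Occ]; omega⟩
    · exact ⟨.bI (q / 8 + 1), by simp, by simp only [Occ]; omega⟩
    · exact ⟨.zPP (q / 8 + 1), by simp, by simp only [Occ]; omega⟩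
    · exact ⟨.x 1 (q / 8 + 1), by simp, by simp only [Occ]; omega⟩
    · exact ⟨.y (q / 8 + 1), by simp, by simp only [Occ]; omega⟩
  · rw [if_neg h4]
    have : q - 8 * n = 0 := by omega
    exact ⟨.a, by simp [this], by simp only [Occ]; omega⟩

theorem Occ.lt {n : ℕ} {ε : ℕ → Bool} {c : Letter} {p : ℕ} (hc : Occ n ε c p) :
    p < 20 * n + 8 := by
  have hε : ∀ k, (ε k).toNat ≤ 1 := fun k => Bool.toNat_le _
  rcases c with _ | _ | _ | k | k | k | k | k | k | k | k | k | k | ⟨j, k⟩ <;>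
  (try fin_cases j) <;> simp only [Occ, Fin.mk_zero, Fin.mk_one, Fin.zero_eta] at hc <;>
  first
  | omega
  | (have h1 := hε k; omega)

theorem getElem?_wl {n : ℕ} {ε : ℕ → Bool} {p : ℕ} {c : Letter} :
    (wl n ε)[p]? = some c ↔ Occ n ε c p := by
  constructor
  · intro h
    have hp : p < 20 * n + 8 := by
      rw [← length_wl n ε]; exact (List.getElem?_eq_some_iff.1 h).1
    obtain ⟨d, hd, ho⟩ := exists_getElem?_wl_occ n ε p hp
    rw [h] at hd
    rwa [Option.some.inj hd]
  · intro h
    obtain ⟨d, hd, ho⟩ := exists_getElem?_wl_occ n ε p h.lt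
    rwa [h.unique ho]

/-! ### Substitutions whose value is a factor of a word -/

/-- The image of a list of letters under a substitution. -/
def sub (χ : Letter → List Letter) (u : List Letter) : List Letter := u.flatMap χ

@[simp] theorem sub_nil (χ) : sub χ [] = [] := rfl
@[simp] theorem sub_cons (χ e u) : sub χ (e :: u) = χ e ++ sub χ u := by simp [sub]
@[simp] theorem sub_append (χ u v) : sub χ (u ++ v) = sub χ u ++ sub χ v := by simp [sub]

theorem sub_sub (χ φ u) : sub χ (sub φ u) = sub (fun l => sub χ (φ l)) u := by
  simp [sub, List.flatMap_assoc]

theorem sub_congr {χ ψ : Letter → List Letter} {u : List Letter} (h : ∀ e ∈ u, χ e = ψ e) :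
    sub χ u = sub ψ u := List.flatMap_congr h

theorem sub_eq_nil {χ : Letter → List Letter} {u : List Letter} :
    sub χ u = [] ↔ ∀ e ∈ u, χ e = [] := by simp [sub, List.flatMap_eq_nil_iff]

theorem sub_singleton (u : List Letter) : sub (fun l => [l]) u = u := by
  induction u <;> simp_all

/-- `u` is a factor of one of the words `w_ξ`. -/
def Fac (n : ℕ) (u : List Letter) : Prop := ∃ ε g h, wl n ε = g ++ u ++ h

/-- The letters that occur twice in the words `w_ξ`. -/
def Dbl : Letter → Prop
  | .t | .s _ | .tI _ | .tP _ | .tPP _ => False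
  | _ => True

theorem Occ.bounds {n : ℕ} {ε : ℕ → Bool} {c : Letter} {p q : ℕ} (hp : Occ n ε c p)
    (hq : Occ n ε c q) (hpq : p < q) : p < 12 * n + 4 ∧ 12 * n + 4 < q ∧ Dbl c := by
  have hε : ∀ k, (ε k).toNat ≤ 1 := fun k => Bool.toNat_le _
  rcases c with _ | _ | _ | k | k | k | k | k | k | k | k | k | k | ⟨j, k⟩ <;>
  (try fin_cases j) <;>
  simp only [Occ, Fin.mk_zero, Fin.mk_one, Fin.zero_eta, Fin.isValue, Dbl, and_true] at hp hq ⊢ <;>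
  first
  | omega
  | (have h1 := hε k; omega)

theorem Occ.eq_of_lt {n : ℕ} {ε : ℕ → Bool} {c : Letter} {p q : ℕ} (hp : Occ n ε c p)
    (hq : Occ n ε c q) (h1 : p ≤ 12 * n + 4) (h2 : q ≤ 12 * n + 4) : p = q := by
  rcases lt_trichotomy p q with h | h | h
  · have := hp.bounds hq h; omega
  · exact h
  · have := hq.bounds hp h; omega

theorem Occ.eq_of_gt {n : ℕ} {ε : ℕ → Bool} {c : Letter} {p q : ℕ} (hp : Occ n ε c p)
    (hq : Occ n ε c q) (h1 : 12 * n + 4 ≤ p) (h2 : 12 * n + 4 ≤ q) : p = q := by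
  rcases lt_trichotomy p q with h | h | h
  · have := hp.bounds hq h; omega
  · exact h
  · have := hq.bounds hp h; omega

/-- No word of length two occurs twice in `w_ξ`. -/
theorem Occ.not_repeated {n : ℕ} {ε : ℕ → Bool} {c d : Letter} {p q : ℕ} (hc : Occ n ε c p)
    (hc' : Occ n ε c q) (hpq : p < q) (hd : Occ n ε d (p + 1)) (hd' : Occ n ε d (q + 1)) :
    False := by
  have hε : ∀ k, (ε k).toNat ≤ 1 := fun k => Bool.toNat_le _
  have hb := hc.bounds hc' hpq
  have hb' := hd.bounds hd' (by omega)
  rcases c with _ | _ | _ | k | k | k | k | k | k | k | k | k | k | ⟨j, k⟩ <;>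
  rcases d with _ | _ | _ | l | l | l | l | l | l | l | l | l | l | ⟨j', l⟩ <;>
  first
  | exact hb.2.2
  | exact hb'.2.2
  | skip
  all_goals
    (try fin_cases j) <;> (try fin_cases j') <;>
    simp only [Occ, Fin.mk_zero, Fin.mk_one, Fin.zero_eta, Fin.isValue] at hc hd hc' hd' <;>
    first
    | (have h1 := hε k; omega)
    | (have h1 := hε l; omega)
    | omega

theorem t_occ {n : ℕ} {ε : ℕ → Bool} {p : ℕ} : Occ n ε .t p ↔ p = 12 * n + 4 := Iff.rfl

section Matching

variable {n : ℕ} {ε : ℕ → Bool} {χ : Letter → List Letter} {g h u : List Letter}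

theorem occ_of_match (H : wl n ε = g ++ sub χ u ++ h) {a b : List Letter} {e c : Letter} {j : ℕ}
    (hu : u = a ++ e :: b) (hj : (χ e)[j]? = some c) :
    Occ n ε c (g.length + (sub χ a).length + j) := by
  have hlt : j < (χ e).length := (List.getElem?_eq_some_iff.1 hj).1
  rw [← getElem?_wl, H, hu]
  simp only [sub_append, sub_cons, List.append_assoc]
  rw [List.getElem?_append_right (by omega), List.getElem?_append_right (by omega),
    List.getElem?_append_left (by omega)]
  convert hj using 2
  omega

theorem exists_of_lt_length_sub {p : ℕ} (hp : p < (sub χ u).length) :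
    ∃ a e b j, u = a ++ e :: b ∧ j < (χ e).length ∧ p = (sub χ a).length + j := by
  induction u generalizing p with
  | nil => simp at hp
  | cons e u ih =>
    by_cases h : p < (χ e).length
    · exact ⟨[], e, u, p, rfl, h, by simp⟩
    · simp only [sub_cons, List.length_append] at hp
      obtain ⟨a, f, b, j, rfl, hj, hp'⟩ := ih (p := p - (χ e).length) (by omega)
      exact ⟨e :: a, f, b, j, rfl, hj, by simp; omega⟩

/-- A letter of `u` that occurs at least twice and is not erased is sent to a single letter, and its
first and last occurrences are sent to the two sides of the letter `t`. -/
theorem match_double (H : wl n ε = g ++ sub χ u ++ h) {a b d : List Letter} {e : Letter}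
    (hu : u = a ++ e :: (b ++ e :: d)) (he : χ e ≠ []) :
    ∃ c, χ e = [c] ∧ Dbl c ∧ Occ n ε c (g.length + (sub χ a).length) ∧
      Occ n ε c (g.length + (sub χ (a ++ e :: b)).length) ∧
      g.length + (sub χ a).length < 12 * n + 4 ∧
      12 * n + 4 < g.length + (sub χ (a ++ e :: b)).length := by
  have hu' : u = (a ++ e :: b) ++ e :: d := by simp [hu]
  obtain ⟨c, l, hl⟩ := List.exists_cons_of_ne_nil he
  have h1 := occ_of_match H hu (j := 0) (c := c) (by simp [hl])
  have h2 := occ_of_match H hu' (j := 0) (c := c) (by simp [hl])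
  have hlt : g.length + (sub χ a).length + 0 < g.length + (sub χ (a ++ e :: b)).length + 0 := by
    simp [hl]
  have hb := h1.bounds h2 hlt
  refine ⟨c, ?_, hb.2.2, h1, h2, hb.1, hb.2.1⟩
  cases l with
  | nil => exact hl
  | cons d' l' =>
    exact (h1.not_repeated h2 hlt (occ_of_match H hu (j := 1) (c := d') (by simp [hl]))
      (occ_of_match H hu' (j := 1) (c := d') (by simp [hl]))).elim

end Matching

theorem two_le_count_iff {e : Letter} {u : List Letter} :
    2 ≤ u.count e ↔ ∃ a b d, u = a ++ e :: (b ++ e :: d) := by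
  constructor
  · intro h
    obtain ⟨a, b, rfl⟩ := List.append_of_mem (List.count_pos_iff.1 (by omega : 0 < u.count e))
    by_cases h' : e ∈ b
    · obtain ⟨c, d, rfl⟩ := List.append_of_mem h'
      exact ⟨a, c, d, rfl⟩
    · have : e ∈ a := by
        by_contra h''
        simp [List.count_eq_zero_of_not_mem h', List.count_eq_zero_of_not_mem h''] at h
      obtain ⟨c, d, rfl⟩ := List.append_of_mem this
      exact ⟨c, d, b, by simp⟩
  · rintro ⟨a, b, d, rfl⟩
    simp; omega

/-- When `χ` sends `u` to a factor of some `w_ξ`, either all letters that occur twice or more in `u`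
are erased, or there is a letter `l` occurring once in `u` (the one whose image contains `t`) such
that the letters with several occurrences that survive have one occurrence on either side of `l`. -/
theorem Fac.split {n : ℕ} {χ : Letter → List Letter} {u : List Letter} (H : Fac n (sub χ u)) :
    (∀ e, 2 ≤ u.count e → χ e = []) ∨ ∃ a l b, u = a ++ l :: b ∧ u.count l = 1 ∧
      ∀ e, 2 ≤ u.count e → χ e ≠ [] → a.count e = 1 ∧ b.count e = 1 := by
  obtain ⟨ε, g, h, H⟩ := H
  by_cases h0 : ∀ e, 2 ≤ u.count e → χ e = []
  · exact Or.inl h0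
  right
  push Not at h0
  obtain ⟨e, he, hne⟩ := h0
  obtain ⟨a, b, d, hu⟩ := two_le_count_iff.1 he
  obtain ⟨c, hc, -, -, -, h1, h2⟩ := match_double H hu hne
  -- the letter of `u` covering the position of `t`
  obtain ⟨b1, l, b2, j, hb, hj, hp⟩ := exists_of_lt_length_sub (χ := χ) (u := b)
    (p := 12 * n + 4 - (g.length + (sub χ a).length + 1)) (by
      simp only [sub_append, sub_cons, hc, List.length_append, List.length_singleton] at h2
      omega)
  set A := a ++ e :: b1 with hA
  set B := b2 ++ e :: d with hB
  have huA : u = A ++ l :: B := by simp [hu, hb, hA, hB]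
  have hlen : g.length + (sub χ A).length + j = 12 * n + 4 := by
    simp only [hA, sub_append, sub_cons, hc, List.length_append, List.length_singleton]
    omega
  have hlt : (χ l)[j]? = some .t := by
    obtain ⟨q, hq⟩ : ∃ q, (χ l)[j]? = some q := ⟨_, List.getElem?_eq_getElem hj⟩
    rw [hq]
    have := occ_of_match H huA hq
    rw [hlen] at this
    rw [this.unique (t_occ.2 rfl)]
  have hl1 : ¬ 2 ≤ u.count l := by
    intro h2l
    obtain ⟨a', b', d', hu'⟩ := two_le_count_iff.1 h2l
    have hl : χ l ≠ [] := by rintro h'; simp [h'] at hj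
    have o1 := occ_of_match H hu' hlt
    have o2 := occ_of_match H (u := u) (a := a' ++ l :: b') (b := d') (by simp [hu']) hlt
    rw [t_occ] at o1 o2
    have : 0 < (χ l).length := List.length_pos_iff.2 hl
    simp only [sub_append, sub_cons, List.length_append] at o2
    omega
  have hl0 : 1 ≤ u.count l := by rw [huA]; simp; omega
  refine ⟨A, l, B, huA, by omega, fun f hf hfne => ?_⟩
  have hfl : f ≠ l := by rintro rfl; omega
  have hcount : u.count f = A.count f + B.count f := by
    rw [huA, List.count_append, List.count_cons_of_ne (Ne.symm hfl)]
  -- two occurrences on the same side are impossible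
  have hAle : ¬ 2 ≤ A.count f := by
    intro h2
    obtain ⟨a', b', d', hA'⟩ := two_le_count_iff.1 h2
    obtain ⟨_, hc', -, -, -, -, h4⟩ := match_double H (u := u) (a := a') (b := b')
      (d := d' ++ l :: B) (by rw [huA, hA']; simp) hfne
    rw [hA'] at hlen
    simp only [sub_append, sub_cons, List.length_append] at hlen h4
    omega
  have hBle : ¬ 2 ≤ B.count f := by
    intro h2
    obtain ⟨a', b', d', hB'⟩ := two_le_count_iff.1 h2
    obtain ⟨_, hc', -, -, -, h3, -⟩ := match_double H (u := u) (a := A ++ l :: a') (b := b')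
      (d := d') (by rw [huA, hB']; simp) hfne
    simp only [sub_append, sub_cons, List.length_append] at h3
    omega
  omega

theorem Fac.length_le_one {n : ℕ} {χ : Letter → List Letter} {u : List Letter}
    (H : Fac n (sub χ u)) {e : Letter} (he : 2 ≤ u.count e) : (χ e).length ≤ 1 := by
  obtain ⟨ε, g, h, H⟩ := H
  by_cases hne : χ e = []
  · simp [hne]
  obtain ⟨a, b, d, hu⟩ := two_le_count_iff.1 he
  obtain ⟨c, hc, -⟩ := match_double H hu hne
  simp [hc]

/-! ### Endomorphic images of `w_ξ` that are factors of `w_ζ` -/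

/-- The letter `c` is used in the words with parameter `n`. -/
def InW (n : ℕ) (c : Letter) : Prop := c ∈ wl n fun _ => false

theorem mem_wl {n : ℕ} {ε : ℕ → Bool} {c : Letter} : c ∈ wl n ε ↔ InW n c := by
  have hx : ∀ e k, c ∈ xPair e k ↔ c ∈ xPair false k := by
    intro e k; cases e <;> simp [xPair, or_comm]
  simp only [InW, wl, listA, List.mem_append, List.mem_cons, List.mem_flatMap]
  simp only [hx (ε _)]

theorem inW_iff_occ {n : ℕ} {c : Letter} (ε : ℕ → Bool) : InW n c ↔ ∃ p, Occ n ε c p := by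
  rw [← mem_wl (ε := ε), List.mem_iff_getElem?]
  simp only [getElem?_wl]

/-- If one of `x₁⁽ⁱ⁾`, `x₂⁽ⁱ⁾` is erased for every `i`, then the image of `w_ξ` does not depend on
`ξ`. -/
theorem sub_wl_eq_of_collapse {n : ℕ} {θ : Letter → List Letter}
    (h : ∀ i, 1 ≤ i → i ≤ n → θ (.x 0 i) = [] ∨ θ (.x 1 i) = []) (ε η : ℕ → Bool) :
    sub θ (wl n ε) = sub θ (wl n η) := by
  have key : ∀ ε : ℕ → Bool, sub θ ((List.range n).flatMap fun i => xPair (ε (i + 1)) (i + 1)) =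
      (List.range n).flatMap fun i => θ (.x 0 (i + 1)) ++ θ (.x 1 (i + 1)) := by
    intro ε
    rw [sub, List.flatMap_assoc]
    refine List.flatMap_congr fun i hi => ?_
    have hi' := List.mem_range.1 hi
    rcases h (i + 1) (by omega) (by omega) with h' | h' <;> cases ε (i + 1) <;> simp [xPair, h']
  simp only [wl, listA, sub_append, sub_cons, key]

section Rigidity

variable {n : ℕ} {ε ζ : ℕ → Bool} {θ : Letter → List Letter} {g h : List Letter}

/-- The position, in the target, at which the image of the letter at position `k` starts. -/
def startPos (n : ℕ) (ε : ℕ → Bool) (θ : Letter → List Letter) (g : List Letter) (k : ℕ) : ℕ :=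
  g.length + (sub θ ((wl n ε).take k)).length

theorem startPos_succ {c : Letter} {k : ℕ} (hc : Occ n ε c k) :
    startPos n ε θ g (k + 1) = startPos n ε θ g k + (θ c).length := by
  rw [startPos, List.take_add_one, getElem?_wl.2 hc]
  simp [startPos, add_assoc]

theorem startPos_mono : Monotone (startPos n ε θ g) := by
  refine monotone_nat_of_le_succ fun k => ?_
  by_cases hk : k < 20 * n + 8
  · obtain ⟨c, -, hc⟩ := exists_getElem?_wl_occ n ε k hk
    rw [startPos_succ hc]; omega
  · rw [startPos, startPos, List.take_of_length_le, List.take_of_length_le] <;>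
      rw [length_wl] <;> omega

variable (H : wl n ζ = g ++ sub θ (wl n ε) ++ h)
include H

theorem occ_startPos {c d : Letter} {k j : ℕ} (hc : Occ n ε c k) (hd : (θ c)[j]? = some d) :
    Occ n ζ d (startPos n ε θ g k + j) := by
  have hk := hc.lt
  have hu : wl n ε = (wl n ε).take k ++ c :: (wl n ε).drop (k + 1) := by
    have h1 : k < (wl n ε).length := by rw [length_wl]; exact hk
    have h2 : (wl n ε)[k] = c := by
      have := getElem?_wl.2 hc
      rw [List.getElem?_eq_getElem h1] at this
      exact Option.some.inj this
    conv_lhs => rw [← List.take_append_drop k (wl n ε), List.drop_eq_getElem_cons h1, h2]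
  exact occ_of_match H hu hd

/-- A letter of `w_ξ` that occurs twice and is not erased is sent to a single letter, since no word
of length two is repeated in `w_ζ`; its two occurrences are sent to those of its image. -/
theorem startPos_double {c : Letter} {k k' : ℕ} (hc : Occ n ε c k) (hc' : Occ n ε c k')
    (hk : k < k') (hne : θ c ≠ []) :
    ∃ d, θ c = [d] ∧ Dbl d ∧ Occ n ζ d (startPos n ε θ g k) ∧
      Occ n ζ d (startPos n ε θ g k') ∧ startPos n ε θ g k < 12 * n + 4 ∧
      12 * n + 4 < startPos n ε θ g k' := by
  obtain ⟨d, l, hl⟩ := List.exists_cons_of_ne_nil hne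
  have h1 := occ_startPos H hc (j := 0) (d := d) (by simp [hl])
  have h2 := occ_startPos H hc' (j := 0) (d := d) (by simp [hl])
  rw [add_zero] at h1 h2
  have hlt : startPos n ε θ g k < startPos n ε θ g k' := by
    have := startPos_mono (n := n) (ε := ε) (θ := θ) (g := g) (Nat.succ_le_of_lt hk)
    rw [Nat.succ_eq_add_one, startPos_succ hc] at this
    simp [hl] at this; omega
  have hb := h1.bounds h2 hlt
  refine ⟨d, ?_, hb.2.2, h1, h2, hb.1, hb.2.1⟩
  cases l with
  | nil => exact hl
  | cons d' l' =>
    exact (h1.not_repeated h2 hlt (occ_startPos H hc (j := 1) (d := d') (by simp [hl]))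
      (occ_startPos H hc' (j := 1) (d := d') (by simp [hl]))).elim

omit H in
theorem Occ.exists_pair {c : Letter} {k : ℕ} (hc : Occ n ε c k) (hd : Dbl c) :
    ∃ p q, p < q ∧ Occ n ε c p ∧ Occ n ε c q ∧ (k = p ∨ k = q) := by
  have hε : ∀ k, (ε k).toNat ≤ 1 := fun k => Bool.toNat_le _
  rcases c with _ | _ | _ | i | i | i | i | i | i | i | i | i | i | ⟨j, i⟩
  · exact ⟨7 * n, 20 * n + 7, by
      refine ⟨?_, ?_, ?_, ?_⟩ <;> simp only [Occ, true_or, or_true, and_true] at hc ⊢ <;> omega⟩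
  · exact ⟨9 * n + 1, 12 * n + 5, by
      refine ⟨?_, ?_, ?_, ?_⟩ <;> simp only [Occ, true_or, or_true, and_true] at hc ⊢ <;> omega⟩
  · exact hd.elim
  · exact ⟨6 * n + i - 1, 12 * n + 8 * i + 1, by
      refine ⟨?_, ?_, ?_, ?_⟩ <;> simp only [Occ, true_or, or_true, and_true] at hc ⊢ <;> omega⟩
  · exact ⟨9 * n + 1 + i, 12 * n + 8 * i + 3, by
      refine ⟨?_, ?_, ?_, ?_⟩ <;> simp only [Occ, true_or, or_true, and_true] at hc ⊢ <;> omega⟩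
  · exact hd.elim
  · exact ⟨10 * n + 3 + 2 * i, 12 * n + 8 * i + 6, by
      refine ⟨?_, ?_, ?_, ?_⟩ <;> simp only [Occ, true_or, or_true, and_true] at hc ⊢ <;> omega⟩
  · exact ⟨2 * i - 2, 12 * n + 8 * i, by
      refine ⟨?_, ?_, ?_, ?_⟩ <;> simp only [Occ, true_or, or_true, and_true] at hc ⊢ <;> omega⟩
  · exact ⟨2 * n + 2 * i - 2, 12 * n + 8 * i + 2, by
      refine ⟨?_, ?_, ?_, ?_⟩ <;> simp only [Occ, true_or, or_true, and_true] at hc ⊢ <;> omega⟩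
  · exact ⟨4 * n + 2 * i - 2, 12 * n + 8 * i + 4, by
      refine ⟨?_, ?_, ?_, ?_⟩ <;> simp only [Occ, true_or, or_true, and_true] at hc ⊢ <;> omega⟩
  · exact hd.elim
  · exact hd.elim
  · exact hd.elim
  · have := hε i
    fin_cases j
    · exact ⟨7 * n + 2 * i + (ε i).toNat - 1, 12 * n + 8 * i - 1, by
        refine ⟨?_, ?_, ?_, ?_⟩ <;>
        simp only [Occ, Fin.mk_zero, Fin.mk_one, Fin.zero_eta, Fin.isValue, true_or,
          or_true, and_true] at hc ⊢ <;> omega⟩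
    · exact ⟨7 * n + 2 * i - (ε i).toNat, 12 * n + 8 * i + 5, by
        refine ⟨?_, ?_, ?_, ?_⟩ <;>
        simp only [Occ, Fin.mk_zero, Fin.mk_one, Fin.zero_eta, Fin.isValue, true_or,
          or_true, and_true] at hc ⊢ <;> omega⟩

omit H in
theorem Occ.dbl {c : Letter} {k : ℕ} (hc : Occ n ε c k)
    (hk : (6 * n ≤ k ∧ k < 10 * n + 2) ∨ 12 * n + 5 ≤ k) : Dbl c := by
  rcases c with _ | _ | _ | i | i | i | i | i | i | i | i | i | i | ⟨j, i⟩ <;>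
  first
  | exact trivial
  | (simp only [Occ] at hc; omega)

theorem startPos_le_succ {k : ℕ} (hk : (6 * n ≤ k ∧ k < 10 * n + 2) ∨ 12 * n + 5 ≤ k) :
    startPos n ε θ g (k + 1) ≤ startPos n ε θ g k + 1 := by
  by_cases hk' : k < 20 * n + 8
  · obtain ⟨c, -, hc⟩ := exists_getElem?_wl_occ n ε k hk'
    obtain ⟨p, q, hpq, hp, hq, -⟩ := hc.exists_pair (hc.dbl hk)
    rw [startPos_succ hc]
    by_cases hne : θ c = []
    · simp [hne]
    · obtain ⟨d, hd, -⟩ := startPos_double H hp hq hpq hne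
      simp [hd]
  · rw [startPos, startPos, List.take_of_length_le, List.take_of_length_le] <;>
      try rw [length_wl] <;> omega
    omega

theorem startPos_le_add {k m : ℕ} (hk : (6 * n ≤ k ∧ k + m ≤ 10 * n + 2) ∨ 12 * n + 5 ≤ k) :
    startPos n ε θ g (k + m) ≤ startPos n ε θ g k + m := by
  induction m with
  | zero => simp
  | succ m ih =>
    have := startPos_le_succ H (k := k + m) (by omega)
    have := ih (by omega)
    rw [← add_assoc]; omega

/-- A position covered by the image of a stretch of letters that occur twice comes from one of
them. -/
theorem exists_startPos_eq {k m p : ℕ}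
    (hk : (6 * n ≤ k ∧ k + m ≤ 10 * n + 2) ∨ (12 * n + 5 ≤ k ∧ k + m ≤ 20 * n + 8))
    (h1 : startPos n ε θ g k ≤ p) (h2 : p < startPos n ε θ g (k + m)) :
    ∃ l c d, k ≤ l ∧ l < k + m ∧ Occ n ε c l ∧ θ c = [d] ∧ startPos n ε θ g l = p := by
  induction m with
  | zero => simp at h2; omega
  | succ m ih =>
    by_cases h3 : p < startPos n ε θ g (k + m)
    · obtain ⟨l, c, d, h⟩ := ih (by omega) h3
      exact ⟨l, c, d, h.1, by omega, h.2.2⟩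
    · obtain ⟨c, -, hc⟩ := exists_getElem?_wl_occ n ε (k + m) (by omega)
      have h4 := startPos_succ (θ := θ) (g := g) hc
      rw [← add_assoc] at h2
      have h5 := startPos_le_succ H (k := k + m) (by omega)
      obtain ⟨d, hd⟩ := List.length_eq_one_iff.1 (by omega : (θ c).length = 1)
      exact ⟨k + m, c, d, by omega, by omega, hc, hd, by omega⟩

end Rigidity
theorem Occ.adjacent_dbl {n : ℕ} {ε : ℕ → Bool} {c d : Letter} {p : ℕ} (hc : Occ n ε c p)
    (hd : Occ n ε d (p + 1)) (h1 : Dbl c) (h2 : Dbl d) (hp : p + 1 < 12 * n + 4) :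
    6 * n ≤ p ∧ p + 1 < 10 * n + 2 := by
  have hε : ∀ k, (ε k).toNat ≤ 1 := fun k => Bool.toNat_le _
  rcases c with _ | _ | _ | k | k | k | k | k | k | k | k | k | k | ⟨j, k⟩ <;>
  rcases d with _ | _ | _ | l | l | l | l | l | l | l | l | l | l | ⟨j', l⟩ <;>
  first
  | exact h1.elim
  | exact h2.elim
  | skip
  all_goals
    (try fin_cases j) <;> (try fin_cases j') <;>
    simp only [Occ, Fin.mk_zero, Fin.mk_one, Fin.zero_eta, Fin.isValue] at hc hd <;>
    first
    | (have h1 := hε k; have h2 := hε l; omega)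
    | (have h1 := hε k; omega)
    | (have h1 := hε l; omega)
    | omega

/-- Two letters that are adjacent in the first half of `w_ζ` and at distance at most six, with no
`yₖ` in between, in the second half, are `x₁⁽ʲ⁾` and `x₂⁽ʲ⁾`. -/
theorem Occ.eq_x_of_close {n : ℕ} {ζ : ℕ → Bool} {c d : Letter} {p p' q q' : ℕ}
    (hn : 1 ≤ n) (hc : Occ n ζ c p) (hd : Occ n ζ d p') (hc' : Occ n ζ c q) (hd' : Occ n ζ d q')
    (hpp : p' = p + 1 ∨ p = p' + 1) (hp : 6 * n ≤ p ∧ p < 10 * n + 2)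
    (hp' : 6 * n ≤ p' ∧ p' < 10 * n + 2) (hq : 12 * n + 4 < q) (hqq : q < q' ∧ q' ≤ q + 6)
    (noY : ∀ k, k ≤ n → ¬ (q < 12 * n + 8 * k + 6 ∧ 12 * n + 8 * k + 6 < q')) :
    ∃ j, 1 ≤ j ∧ j ≤ n ∧ c = .x 0 j ∧ d = .x 1 j := by
  have hε : ∀ k, (ζ k).toNat ≤ 1 := fun k => Bool.toNat_le _
  have y0 := noY 0 (by omega)
  have yn := noY n le_rfl
  rcases c with _ | _ | _ | k | k | k | k | k | k | k | k | k | k | ⟨j, k⟩ <;>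
  rcases d with _ | _ | _ | l | l | l | l | l | l | l | l | l | l | ⟨j', l⟩ <;>
  (try fin_cases j) <;> (try fin_cases j') <;>
  simp only [Occ, Fin.mk_zero, Fin.mk_one, Fin.zero_eta, Fin.isValue, reduceCtorEq, false_and,
    and_false, exists_false, Letter.x.injEq, true_and, zero_ne_one, one_ne_zero]
    at hc hd hc' hd' ⊢ <;>
  first
  | omega
  | (have h1 := hε k; have y1 := noY k (by omega); omega)
  | (have h1 := hε l; have y1 := noY l (by omega); omega)
  | (have h1 := hε k; have h2 := hε l; have y1 := noY k (by omega)
     have y2 := noY l (by omega); omega)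
  | exact ⟨k, by omega, by omega, rfl, by omega⟩

section Rigidity

variable {n : ℕ} {ε ζ : ℕ → Bool} {θ : Letter → List Letter} {g h : List Letter}
variable (H : wl n ζ = g ++ sub θ (wl n ε) ++ h)
include H

/-- If neither `x₁⁽ⁱ⁾` nor `x₂⁽ⁱ⁾` is erased, they are sent to some `x₁⁽ʲ⁾` and `x₂⁽ʲ⁾`. -/
theorem startPos_x_pair {i : ℕ} (hi : 1 ≤ i) (hin : i ≤ n) (h0 : θ (.x 0 i) ≠ [])
    (h1 : θ (.x 1 i) ≠ []) :
    ∃ j, 1 ≤ j ∧ j ≤ n ∧ startPos n ε θ g (12 * n + 8 * i - 1) = 12 * n + 8 * j - 1 ∧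
      startPos n ε θ g (12 * n + 8 * i + 5) = 12 * n + 8 * j + 5 ∧
      startPos n ε θ g (7 * n + 2 * i - 1) = 7 * n + 2 * j - 1 ∧ ε i = ζ j := by
  set N := startPos n ε θ g with hN
  have mono : Monotone N := startPos_mono
  have bε : (ε i).toNat ≤ 1 := Bool.toNat_le _
  have o0 : Occ n ε (.x 0 i) (7 * n + 2 * i + (ε i).toNat - 1) := by
    simp only [Occ, true_or, or_true, and_true] <;> omega
  have o0' : Occ n ε (.x 0 i) (12 * n + 8 * i - 1) := by
    simp only [Occ, true_or, or_true, and_true] <;> omega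
  have o1 : Occ n ε (.x 1 i) (7 * n + 2 * i - (ε i).toNat) := by
    simp only [Occ, true_or, or_true, and_true] <;> omega
  have o1' : Occ n ε (.x 1 i) (12 * n + 8 * i + 5) := by
    simp only [Occ, true_or, or_true, and_true] <;> omega
  obtain ⟨c, hc, dc, oc, oc', ltc, ltc'⟩ := startPos_double H o0 o0' (by omega) h0
  obtain ⟨d, hd, dd, od, od', ltd, ltd'⟩ := startPos_double H o1 o1' (by omega) h1
  rw [← hN] at oc oc' ltc ltc' od od' ltd ltd'
  have s0 : N (12 * n + 8 * i) = N (12 * n + 8 * i - 1) + 1 := by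
    have := startPos_succ (θ := θ) (g := g) o0'
    rw [hc, show 12 * n + 8 * i - 1 + 1 = 12 * n + 8 * i by omega] at this
    simpa using this
  have s1 : N (12 * n + 8 * i + 5) ≤ N (12 * n + 8 * i) + 5 :=
    startPos_le_add H (k := 12 * n + 8 * i) (by omega)
  have s2 : N (12 * n + 8 * i) ≤ N (12 * n + 8 * i + 5) := mono (by omega)
  -- `P` is the position of the image of the first of the two adjacent letters
  obtain ⟨P, hP, hP0, hP1⟩ : ∃ P, N (7 * n + 2 * i - 1) = P ∧
      N (7 * n + 2 * i + (ε i).toNat - 1) = P + (ε i).toNat ∧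
      N (7 * n + 2 * i - (ε i).toNat) + (ε i).toNat = P + 1 := by
    refine ⟨_, rfl, ?_⟩
    cases hε : ε i
    · have := startPos_succ (θ := θ) (g := g) o0
      simp only [hε, Bool.toNat_false, hc, List.length_singleton] at this ⊢
      rw [show 7 * n + 2 * i + 0 - 1 + 1 = 7 * n + 2 * i - 0 by omega] at this
      exact ⟨rfl, this⟩
    · have := startPos_succ (θ := θ) (g := g) o1
      simp only [hε, Bool.toNat_true, hd, List.length_singleton] at this ⊢
      rw [show 7 * n + 2 * i - 1 + 1 = 7 * n + 2 * i + 1 - 1 by omega] at this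
      exact ⟨this, trivial⟩
  rw [hP0] at oc ltc
  have hadj : 6 * n ≤ P ∧ P + 1 < 10 * n + 2 := by
    cases hε : ε i <;> simp only [hε, Bool.toNat_false, Bool.toNat_true, add_zero] at hP1 oc ltc
    · rw [hε, Bool.toNat_false, hP1] at od ltd
      exact oc.adjacent_dbl od dc dd ltd
    · rw [hε, Bool.toNat_true, show N (7 * n + 2 * i - 1) = P by omega] at od ltd
      exact od.adjacent_dbl oc dd dc ltc
  have noY : ∀ k, k ≤ n → ¬ (N (12 * n + 8 * i - 1) < 12 * n + 8 * k + 6 ∧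
      12 * n + 8 * k + 6 < N (12 * n + 8 * i + 5)) := by
    rintro k hk ⟨hk1, hk2⟩
    obtain ⟨l, e, f, hl1, hl2, oe, hf, hlN⟩ := exists_startPos_eq H (k := 12 * n + 8 * i) (m := 5)
      (p := 12 * n + 8 * k + 6) (by omega) (by rw [← hN]; omega) hk2
    have of := occ_startPos H oe (j := 0) (d := f) (by simp [hf])
    rw [add_zero, hlN] at of
    obtain rfl : f = .y k := of.unique (by simp only [Occ, true_or, or_true, and_true] <;> omega)
    -- in the source, the first occurrence of this letter comes before that of `bᵢ`
    have key : ∀ k_e, Occ n ε e k_e → k_e < l → N k_e = 10 * n + 3 + 2 * k := by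
      intro k_e hk_e hlt
      obtain ⟨_, hf', -, o', -, h3, -⟩ := startPos_double H hk_e oe hlt (by simp [hf])
      rw [hf] at hf'
      obtain rfl := (List.cons.inj hf').1
      rw [← hN] at o' h3
      exact o'.eq_of_lt (by simp only [Occ, true_or, or_true, and_true] <;> omega) h3.le (by omega)
    have early : ∀ k_e, Occ n ε e k_e → k_e < l → k_e ≤ 7 * n + 2 * i - 1 → False := by
      intro k_e h1 h2 h3
      have := mono h3
      rw [key k_e h1 h2, hP] at this
      omega
    have cases5 : l = 12 * n + 8 * i ∨ l = 12 * n + 8 * i + 1 ∨ l = 12 * n + 8 * i + 2 ∨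
      l = 12 * n + 8 * i + 3 ∨ l = 12 * n + 8 * i + 4 := by omega
    rcases cases5 with rfl | rfl | rfl | rfl | rfl
    · obtain rfl : e = .z i := oe.unique (by simp only [Occ, true_or, or_true, and_true] <;> omega)
      exact early (2 * i - 2)
        (by simp only [Occ, true_or, or_true, and_true] <;> omega) (by omega) (by omega)
    · obtain rfl : e = .aI i := oe.unique (by simp only [Occ, true_or, or_true, and_true] <;> omega)
      exact early (6 * n + i - 1)
        (by simp only [Occ, true_or, or_true, and_true] <;> omega) (by omega) (by omega)
    · obtain rfl : e = .zP i := oe.unique (by simp only [Occ, true_or, or_true, and_true] <;> omega)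
      exact early (2 * n + 2 * i - 2)
        (by simp only [Occ, true_or, or_true, and_true] <;> omega) (by omega) (by omega)
    · obtain rfl : e = .bI i := oe.unique (by simp only [Occ, true_or, or_true, and_true] <;> omega)
      have hb := key (9 * n + 1 + i)
        (by simp only [Occ, true_or, or_true, and_true] <;> omega) (by omega)
      obtain ⟨l, e', f, hl1, hl2, oe', hf', hlN⟩ := exists_startPos_eq H (k := 7 * n + 2 * i - 1)
        (m := 9 * n + 1 + i - (7 * n + 2 * i - 1)) (p := 10 * n + 2) (by omega)
        (by rw [← hN]; omega)
        (by rw [← hN, show 7 * n + 2 * i - 1 + (9 * n + 1 + i - (7 * n + 2 * i - 1)) =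
          9 * n + 1 + i by omega]; omega)
      have of' := occ_startPos H oe' (j := 0) (d := f) (by simp [hf'])
      rw [add_zero, hlN] at of'
      obtain rfl : f = .s 0 := of'.unique (by simp only [Occ, true_or, or_true, and_true] <;> omega)
      obtain ⟨p, q, hpq, hp, hq, -⟩ := oe'.exists_pair (oe'.dbl (by omega))
      obtain ⟨_, hf'', hd'', -⟩ := startPos_double H hp hq hpq (by simp [hf'])
      rw [hf'] at hf''
      obtain rfl := (List.cons.inj hf'').1
      exact hd''
    · obtain rfl : e = .zPP i := oe.unique
        (by simp only [Occ, true_or, or_true, and_true] <;> omega)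
      exact early (4 * n + 2 * i - 2)
        (by simp only [Occ, true_or, or_true, and_true] <;> omega) (by omega) (by omega)
  obtain ⟨j, hj1, hjn, rfl, rfl⟩ := Occ.eq_x_of_close (by omega) oc od oc' od' (by omega)
    (by omega) (by omega) ltc' (by omega) noY
  refine ⟨j, hj1, hjn, ?_, ?_, ?_⟩
  · exact oc'.eq_of_gt
      (by simp only [Occ, true_or, or_true, and_true] <;> omega) (by omega) (by omega)
  · exact od'.eq_of_gt
      (by simp only [Occ, true_or, or_true, and_true] <;> omega) (by omega) (by omega)
  · have bζ : (ζ j).toNat ≤ 1 := Bool.toNat_le _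
    simp only [Occ] at oc od
    have : (ε i).toNat = (ζ j).toNat := by omega
    refine ⟨by omega, ?_⟩
    cases h : ε i <;> cases h' : ζ j <;> simp [h, h'] at this ⊢

end Rigidity
theorem wl_congr {n : ℕ} {ε ζ : ℕ → Bool} (h : ∀ i, 1 ≤ i → i ≤ n → ε i = ζ i) :
    wl n ε = wl n ζ := by
  have : ((List.range n).flatMap fun i => xPair (ε (i + 1)) (i + 1)) =
      (List.range n).flatMap fun i => xPair (ζ (i + 1)) (i + 1) :=
    List.flatMap_congr fun i hi => by
      rw [h (i + 1) (by omega) (by have := List.mem_range.1 hi; omega)]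
  simp only [wl, listA, this]

/-- A letter of `w_ξ` that occurs only once is preceded by a letter occurring twice. -/
theorem Occ.exists_pred {n : ℕ} {ε : ℕ → Bool} {c : Letter} {k : ℕ} (hc : Occ n ε c k)
    (hd : ¬ Dbl c) : ∃ d l, k = l + 1 ∧ Dbl d ∧ Occ n ε d l ∧ l < 12 * n + 4 := by
  rcases c with _ | _ | _ | k | k | k | k | k | k | k | k | k | k | ⟨j, k⟩ <;>
  first
  | exact (hd trivial).elim
  | skip
  all_goals simp only [Occ] at hc
  · exact ⟨.y n, 12 * n + 3, by omega, trivial,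
      by simp only [Occ, le_refl, true_or, or_true, and_true, true_and] <;> omega, by omega⟩
  · rcases Nat.eq_zero_or_pos k with rfl | hk
    · rcases Nat.eq_zero_or_pos n with rfl | hn
      · exact ⟨.b, 1, by omega, trivial,
          by simp only [Occ, le_refl, true_or, or_true, and_true, true_and], by omega⟩
      · exact ⟨.bI n, 10 * n + 1, by omega, trivial,
          by simp only [Occ, le_refl, true_or, or_true, and_true, true_and] <;> omega, by omega⟩
    · exact ⟨.y (k - 1), 10 * n + 3 + 2 * (k - 1), by omega, trivial,
        by simp only [Occ, true_or, and_true]; omega, by omega⟩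
  · exact ⟨.z k, 2 * k - 2, by omega, trivial,
      by simp only [Occ, le_refl, true_or, or_true, and_true, true_and] <;> omega, by omega⟩
  · exact ⟨.zP k, 2 * n + 2 * k - 2, by omega, trivial,
      by simp only [Occ, le_refl, true_or, or_true, and_true, true_and] <;> omega, by omega⟩
  · exact ⟨.zPP k, 4 * n + 2 * k - 2, by omega, trivial,
      by simp only [Occ, le_refl, true_or, or_true, and_true, true_and] <;> omega, by omega⟩

section Rigidity

variable {n : ℕ} {ε ζ : ℕ → Bool} {θ : Letter → List Letter} {g h : List Letter}
variable (H : wl n ζ = g ++ sub θ (wl n ε) ++ h)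
include H

/-- `startPos` grows by at most one on stretches of letters occurring twice, so that it is a
translation between two positions that are at the same distance as their images. -/
theorem startPos_translate {k m : ℕ} (hk : (6 * n ≤ k ∧ k + m ≤ 10 * n + 2) ∨ 12 * n + 5 ≤ k)
    (hm : startPos n ε θ g (k + m) = startPos n ε θ g k + m) {l : ℕ} (hl : l ≤ m) :
    startPos n ε θ g (k + l) = startPos n ε θ g k + l := by
  have h1 := startPos_le_add H (k := k) (m := l) (by omega)
  have h2 := startPos_le_add H (k := k + l) (m := m - l) (by omega)
  rw [show k + l + (m - l) = k + m by omega] at h2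
  omega

theorem sub_eq_singleton {c d : Letter} {k p : ℕ} (hc : Occ n ε c k)
    (h1 : startPos n ε θ g k = p) (h2 : startPos n ε θ g (k + 1) = p + 1) (hd : Occ n ζ d p) :
    θ c = [d] := by
  have h3 := startPos_succ (θ := θ) (g := g) hc
  obtain ⟨d', hd'⟩ := List.length_eq_one_iff.1 (by omega : (θ c).length = 1)
  have := occ_startPos H hc (j := 0) (d := d') (by simp [hd'])
  rw [add_zero, h1] at this
  rw [hd', this.unique hd]

/-- If neither `x₁⁽ⁱ⁾` nor `x₂⁽ⁱ⁾` is erased, all letters from `aᵢ` to `bᵢ` are fixed. -/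
theorem startPos_block {i : ℕ} (hi : 1 ≤ i) (hin : i ≤ n) (h0 : θ (.x 0 i) ≠ [])
    (h1 : θ (.x 1 i) ≠ []) :
    startPos n ε θ g (12 * n + 8 * i - 1) = 12 * n + 8 * i - 1 ∧
      startPos n ε θ g (12 * n + 8 * i + 5) = 12 * n + 8 * i + 5 ∧
      (∀ k, 6 * n + i - 1 ≤ k → k ≤ 9 * n + 1 + i → startPos n ε θ g k = k) ∧ ε i = ζ i := by
  obtain ⟨j, hj1, hjn, e1, e2, e3, e4⟩ := startPos_x_pair H hi hin h0 h1
  have tr : ∀ l, l ≤ 6 → startPos n ε θ g (12 * n + 8 * i - 1 + l) = 12 * n + 8 * j - 1 + l := by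
    intro l hl
    rw [startPos_translate H (k := 12 * n + 8 * i - 1) (m := 6) (by omega) ?_ hl, e1]
    rw [show 12 * n + 8 * i - 1 + 6 = 12 * n + 8 * i + 5 by omega]; omega
  have oa' : Occ n ε (.aI i) (12 * n + 8 * i + 1) := by
    simp only [Occ, true_or, or_true, and_true] <;> omega
  have ob' : Occ n ε (.bI i) (12 * n + 8 * i + 3) := by
    simp only [Occ, true_or, or_true, and_true] <;> omega
  have oa : Occ n ε (.aI i) (6 * n + i - 1) := by
    simp only [Occ, true_or, or_true, and_true] <;> omega
  have ob : Occ n ε (.bI i) (9 * n + 1 + i) := by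
    simp only [Occ, true_or, or_true, and_true] <;> omega
  have ha : θ (.aI i) = [.aI j] := by
    refine sub_eq_singleton H (p := 12 * n + 8 * j + 1) oa' ?_ ?_ ?_
    · have := tr 2 (by omega); convert this using 1 <;> [congr 1; skip] <;> omega
    · have := tr 3 (by omega); convert this using 1 <;> [congr 1; skip] <;> omega
    · simp only [Occ, true_or, or_true, and_true] <;> omega
  have hb : θ (.bI i) = [.bI j] := by
    refine sub_eq_singleton H (p := 12 * n + 8 * j + 3) ob' ?_ ?_ ?_
    · have := tr 4 (by omega); convert this using 1 <;> [congr 1; skip] <;> omega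
    · have := tr 5 (by omega); convert this using 1 <;> [congr 1; skip] <;> omega
    · simp only [Occ, true_or, or_true, and_true] <;> omega
  have na : startPos n ε θ g (6 * n + i - 1) = 6 * n + j - 1 := by
    obtain ⟨d, hd, -, o, -, hlt, -⟩ := startPos_double H oa oa' (by omega) (by simp [ha])
    obtain rfl : d = .aI j := by simpa [ha] using hd.symm
    exact o.eq_of_lt (by simp only [Occ, true_or, or_true, and_true] <;> omega) hlt.le (by omega)
  have nb : startPos n ε θ g (9 * n + 1 + i) = 9 * n + 1 + j := by
    obtain ⟨d, hd, -, o, -, hlt, -⟩ := startPos_double H ob ob' (by omega) (by simp [hb])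
    obtain rfl : d = .bI j := by simpa [hb] using hd.symm
    exact o.eq_of_lt (by simp only [Occ, true_or, or_true, and_true] <;> omega) hlt.le (by omega)
  have tr2 : ∀ l, l ≤ 3 * n + 2 → startPos n ε θ g (6 * n + i - 1 + l) = 6 * n + j - 1 + l := by
    intro l hl
    rw [startPos_translate H (k := 6 * n + i - 1) (m := 3 * n + 2) (by omega) ?_ hl, na]
    rw [show 6 * n + i - 1 + (3 * n + 2) = 9 * n + 1 + i by omega]; omega
  obtain rfl : i = j := by
    have := tr2 (n + i) (by omega)
    rw [show 6 * n + i - 1 + (n + i) = 7 * n + 2 * i - 1 by omega] at this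
    omega
  refine ⟨e1, e2, fun k hk1 hk2 => ?_, e4⟩
  have := tr2 (k - (6 * n + i - 1)) (by omega)
  rw [show 6 * n + i - 1 + (k - (6 * n + i - 1)) = k by omega] at this
  exact this

/-- Rigidity: if for some `i` neither `x₁⁽ⁱ⁾` nor `x₂⁽ⁱ⁾` is erased, then `θ` fixes every letter. -/
theorem rigidity {i : ℕ} (hi : 1 ≤ i) (hin : i ≤ n) (h0 : θ (.x 0 i) ≠ [])
    (h1 : θ (.x 1 i) ≠ []) :
    g = [] ∧ h = [] ∧ (∀ c, InW n c → θ c = [c]) ∧ wl n ε = wl n ζ := by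
  have hx : ∀ k, 1 ≤ k → k ≤ n → θ (.x 0 k) ≠ [] ∧ θ (.x 1 k) ≠ [] := by
    intro k hk1 hkn
    obtain ⟨-, -, hm, -⟩ := startPos_block H hi hin h0 h1
    have bε : (ε k).toNat ≤ 1 := Bool.toNat_le _
    have o0 : Occ n ε (.x 0 k) (7 * n + 2 * k + (ε k).toNat - 1) := by
      simp only [Occ, true_or, or_true, and_true] <;> omega
    have o1 : Occ n ε (.x 1 k) (7 * n + 2 * k - (ε k).toNat) := by
      simp only [Occ, true_or, or_true, and_true] <;> omega
    constructor <;> intro h2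
    · have h3 := startPos_succ (θ := θ) (g := g) o0
      rw [hm _ (by omega) (by omega), hm _ (by omega) (by omega), h2] at h3
      simp at h3
    · have h3 := startPos_succ (θ := θ) (g := g) o1
      rw [hm _ (by omega) (by omega), hm _ (by omega) (by omega), h2] at h3
      simp at h3
  have blk := fun k (hk1 : 1 ≤ k) (hkn : k ≤ n) =>
    startPos_block H hk1 hkn (hx k hk1 hkn).1 (hx k hk1 hkn).2
  have hεζ : ∀ k, 1 ≤ k → k ≤ n → ε k = ζ k := fun k hk1 hkn => (blk k hk1 hkn).2.2.2
  have hwl : wl n ε = wl n ζ := wl_congr hεζ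
  have hocc : ∀ c p, Occ n ε c p ↔ Occ n ζ c p := fun c p => by
    rw [← getElem?_wl, ← getElem?_wl, hwl]
  have hmid := (blk i hi hin).2.2.1
  have ha : θ .a = [.a] := by
    refine sub_eq_singleton H (k := 7 * n) (p := 7 * n) ?_ (hmid _ (by omega) (by omega))
      (hmid _ (by omega) (by omega)) ?_ <;> simp only [Occ, true_or]
  have hb : θ .b = [.b] := by
    refine sub_eq_singleton H (k := 9 * n + 1) (p := 9 * n + 1) ?_ (hmid _ (by omega) (by omega))
      (hmid _ (by omega) (by omega)) ?_ <;> simp only [Occ, true_or]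
  -- the second occurrences of `b` and `a` are the two ends of `r`
  have nb : startPos n ε θ g (12 * n + 5) = 12 * n + 5 := by
    obtain ⟨d, hd, -, -, o, -, hlt⟩ := startPos_double H (c := .b) (k := 9 * n + 1)
      (k' := 12 * n + 5) (by simp only [Occ, true_or]) (by simp only [Occ, or_true]) (by omega)
      (by simp [hb])
    obtain rfl : d = .b := by simpa [hb] using hd.symm
    exact o.eq_of_gt (by simp only [Occ, or_true]) hlt.le (by omega)
  have na : startPos n ε θ g (20 * n + 7) = 20 * n + 7 := by
    obtain ⟨d, hd, -, -, o, -, hlt⟩ := startPos_double H (c := .a) (k := 7 * n)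
      (k' := 20 * n + 7) (by simp only [Occ, true_or]) (by simp only [Occ, or_true]) (by omega)
      (by simp [ha])
    obtain rfl : d = .a := by simpa [ha] using hd.symm
    exact o.eq_of_gt (by simp only [Occ, or_true]) hlt.le (by omega)
  have n8 : startPos n ε θ g (20 * n + 8) = 20 * n + 8 := by
    have := startPos_succ (n := n) (ε := ε) (θ := θ) (g := g) (c := .a) (k := 20 * n + 7)
      (by simp only [Occ, or_true])
    rw [na, ha] at this
    exact this
  have hR : ∀ k, 12 * n + 5 ≤ k → k ≤ 20 * n + 8 → startPos n ε θ g k = k := by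
    intro k hk1 hk2
    have := startPos_translate H (k := 12 * n + 5) (m := 8 * n + 3) (by omega)
      (by rw [show 12 * n + 5 + (8 * n + 3) = 20 * n + 8 by omega]; omega)
      (l := k - (12 * n + 5)) (by omega)
    rw [show 12 * n + 5 + (k - (12 * n + 5)) = k by omega] at this
    omega
  have dfix : ∀ c k, Occ n ε c k → Dbl c → θ c = [c] ∧ startPos n ε θ g k = k := by
    intro c k hc hd
    obtain ⟨p, q, hpq, hp, hq, hk⟩ := hc.exists_pair hd
    have hb := hp.bounds hq hpq
    have := hq.lt
    have hθ : θ c = [c] := sub_eq_singleton H hq (hR _ (by omega) (by omega))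
      (hR _ (by omega) (by omega)) ((hocc _ _).1 hq)
    refine ⟨hθ, ?_⟩
    rcases hk with rfl | rfl
    · obtain ⟨d, hd, -, o, -, hlt, -⟩ := startPos_double H hp hq hpq (by simp [hθ])
      obtain rfl : d = c := by simpa [hθ] using hd.symm
      exact o.eq_of_lt ((hocc _ _).1 hp) hlt.le (by omega)
    · exact hR _ (by omega) (by omega)
  have hall : ∀ k, k < 20 * n + 8 → startPos n ε θ g k = k := by
    intro k hk
    obtain ⟨c, -, hc⟩ := exists_getElem?_wl_occ n ε k hk
    by_cases hd : Dbl c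
    · exact (dfix c k hc hd).2
    · obtain ⟨d, l, rfl, hd', ho, -⟩ := hc.exists_pred hd
      rw [startPos_succ ho, (dfix d l ho hd').1, (dfix d l ho hd').2]
      rfl
  have hall' : ∀ k, k ≤ 20 * n + 8 → startPos n ε θ g k = k := by
    intro k hk
    rcases hk.lt_or_eq with h | rfl
    · exact hall k h
    · exact n8
  have hg : g = [] := by
    have := hall 0 (by omega)
    simpa [startPos] using this
  refine ⟨hg, ?_, ?_, hwl⟩
  · have h1 := congrArg List.length H
    simp only [startPos] at n8
    rw [List.take_of_length_le (by rw [length_wl])] at n8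
    simp only [List.length_append, length_wl] at h1
    exact List.length_eq_zero_iff.1 (by omega)
  · intro c hc
    obtain ⟨p, hp⟩ := (inW_iff_occ ε).1 hc
    have := hp.lt
    exact sub_eq_singleton H hp (hall' _ (by omega)) (hall' _ (by omega)) ((hocc _ _).1 hp)

end Rigidity

/-- All letters of `w_ξ` are fixed by `χ ∘ φ`, and the context `p, q` is erased by `χ`. -/
def Rigid (n : ℕ) (χ φ : Letter → List Letter) (p q : List Letter) : Prop :=
  sub χ p = [] ∧ sub χ q = [] ∧ ∀ c, InW n c → sub χ (φ c) = [c]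

theorem Rigid.sub_eq {n : ℕ} {χ φ : Letter → List Letter} {p q : List Letter}
    (h : Rigid n χ φ p q) (ε : ℕ → Bool) : sub χ (p ++ sub φ (wl n ε) ++ q) = wl n ε := by
  rw [sub_append, sub_append, h.1, h.2.1, sub_sub, List.nil_append, List.append_nil]
  conv_rhs => rw [← sub_singleton (wl n ε)]
  exact sub_congr fun c hc => h.2.2 c (mem_wl.1 hc)

/-- If `χ` maps `pφ(w_ξ)q` to a factor of some `w_ζ`, without being rigid, then the value does not
depend on `ξ`. -/
theorem Fac.rigid_or_collapse {n : ℕ} {χ φ : Letter → List Letter} {p q : List Letter}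
    {ε : ℕ → Bool} (H : Fac n (sub χ (p ++ sub φ (wl n ε) ++ q))) :
    Rigid n χ φ p q ∨ ∀ η, sub χ (p ++ sub φ (wl n η) ++ q) = sub χ (p ++ sub φ (wl n ε) ++ q) := by
  by_cases hx : ∀ i, 1 ≤ i → i ≤ n → sub χ (φ (.x 0 i)) = [] ∨ sub χ (φ (.x 1 i)) = []
  · right
    intro η
    simp only [sub_append, sub_sub]
    rw [sub_wl_eq_of_collapse hx η ε]
  · left
    push Not at hx
    obtain ⟨i, hi, hin, h0, h1⟩ := hx
    obtain ⟨ζ, g, h, H⟩ := H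
    simp only [sub_append, sub_sub] at H
    obtain ⟨hg, hh, hfix, -⟩ := rigidity (g := g ++ sub χ p) (h := sub χ q ++ h)
      (θ := fun l => sub χ (φ l)) (by simpa using H) hi hin h0 h1
    exact ⟨(List.append_eq_nil_iff.1 hg).2, (List.append_eq_nil_iff.1 hh).1, hfix⟩

/-! ### Derivations -/

/-- The identity `u ≈ v` holds in the factor monoid of `W_n`. -/
def Eq1 (n : ℕ) (u v : List Letter) : Prop :=
  ∀ χ : Letter → List Letter, Fac n (sub χ u) ∨ Fac n (sub χ v) → sub χ u = sub χ v

/-- One step of a derivation of an identity from the identities of the factor monoid and the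
identities `w_ξ ≈ w_η` with `R w_ξ w_η`. -/
def Step (n : ℕ) (R : List Letter → List Letter → Prop) (u v : List Letter) : Prop :=
  Eq1 n u v ∨ ∃ (p q : List Letter) (φ : Letter → List Letter) (ε η : ℕ → Bool),
    R (wl n ε) (wl n η) ∧ u = p ++ sub φ (wl n ε) ++ q ∧ v = p ++ sub φ (wl n η) ++ q

/-- Derivability of `u ≈ v` from the identities of the factor monoid and the identities
`w_ξ ≈ w_η` with `R w_ξ w_η`. -/
def Der (n : ℕ) (R : List Letter → List Letter → Prop) : List Letter → List Letter → Prop :=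
  Relation.ReflTransGen (Step n R)

/-- Derivability from the identities of the factor monoid and all identities `w_ξ ≈ w_η`. -/
abbrev DerT (n : ℕ) : List Letter → List Letter → Prop := Der n fun _ _ => True

section Basic

variable {n : ℕ} {R : List Letter → List Letter → Prop} {u v w : List Letter}

theorem Eq1.symm (h : Eq1 n u v) : Eq1 n v u := fun χ hχ => (h χ hχ.symm).symm

theorem Eq1.trans (h : Eq1 n u v) (h' : Eq1 n v w) : Eq1 n u w := by
  rintro χ (hχ | hχ)
  · have h1 := h χ (Or.inl hχ)
    rw [h1]; exact h' χ (Or.inl (h1 ▸ hχ))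
  · have h1 := h' χ (Or.inr hχ)
    rw [← h1]; exact h χ (Or.inr (h1 ▸ hχ))

theorem Eq1.sub (h : Eq1 n u v) (σ : Letter → List Letter) : Eq1 n (sub σ u) (sub σ v) := by
  intro χ hχ
  simp only [sub_sub] at hχ ⊢
  exact h _ hχ

theorem Fac.of_append (p q : List Letter) (h : Fac n (p ++ u ++ q)) : Fac n u := by
  obtain ⟨ε, g, k, h⟩ := h
  exact ⟨ε, g ++ p, q ++ k, by simp [h]⟩

theorem Eq1.context (h : Eq1 n u v) (p q : List Letter) : Eq1 n (p ++ u ++ q) (p ++ v ++ q) := by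
  intro χ hχ
  simp only [sub_append] at hχ ⊢
  rw [h χ (hχ.imp (Fac.of_append _ _) (Fac.of_append _ _))]

theorem fac_wl (n ε) : Fac n (wl n ε) := ⟨ε, [], [], by simp⟩

theorem Der.of_eq1 (h : Eq1 n u v) : Der n R u v := .single (Or.inl h)

theorem Der.of_form {ε η : ℕ → Bool} (h : R (wl n ε) (wl n η)) (p φ q) :
    Der n R (p ++ FactorLattice.sub φ (wl n ε) ++ q) (p ++ FactorLattice.sub φ (wl n η) ++ q) :=
  .single (Or.inr ⟨p, q, φ, ε, η, h, rfl, rfl⟩)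

theorem Der.mono {R' : List Letter → List Letter → Prop} (hR : ∀ a b, R a b → R' a b)
    (h : Der n R u v) : Der n R' u v := by
  refine Relation.ReflTransGen.mono (p := Step n R') (fun a b hab => ?_) u v h
  rcases hab with hab | ⟨p, q, φ, ε, η, hr, h1, h2⟩
  · exact Or.inl hab
  · exact Or.inr ⟨p, q, φ, ε, η, hR _ _ hr, h1, h2⟩

theorem Der.toT (h : Der n R u v) : DerT n u v := h.mono fun _ _ _ => trivial

theorem Der.symm (hR : ∀ a b, R a b → R b a) (h : Der n R u v) : Der n R v u := by
  have hs : Std.Symm (Step n R) := ⟨fun a b hab => ?_⟩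
  · exact Relation.ReflTransGen.stdSymm.symm _ _ h
  rcases hab with hab | ⟨p, q, φ, ε, η, hr, h1, h2⟩
  · exact Or.inl hab.symm
  · exact Or.inr ⟨p, q, φ, η, ε, hR _ _ hr, h2, h1⟩

theorem DerT.symm (h : DerT n u v) : DerT n v u := Der.symm (fun _ _ _ => trivial) h

theorem Der.trans (h : Der n R u v) (h' : Der n R v w) : Der n R u w :=
  Relation.ReflTransGen.trans h h'

theorem Der.sub (h : Der n R u v) (σ : Letter → List Letter) :
    Der n R (sub σ u) (sub σ v) := by
  refine Relation.ReflTransGen.lift (FactorLattice.sub σ) (fun a b hab => ?_) _ _ h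
  rcases hab with hab | ⟨p, q, φ, ε, η, hr, h1, h2⟩
  · exact Or.inl (hab.sub σ)
  · exact Or.inr ⟨FactorLattice.sub σ p, FactorLattice.sub σ q, fun l => FactorLattice.sub σ (φ l),
      ε, η, hr, by simp [h1, sub_sub], by simp [h2, sub_sub]⟩

theorem Der.context (h : Der n R u v) (p q : List Letter) :
    Der n R (p ++ u ++ q) (p ++ v ++ q) := by
  refine Relation.ReflTransGen.lift (fun a => p ++ a ++ q) (fun a b hab => ?_) _ _ h
  rcases hab with hab | ⟨p', q', φ, ε, η, hr, h1, h2⟩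
  · exact Or.inl (hab.context p q)
  · exact Or.inr ⟨p ++ p', q' ++ q, φ, ε, η, hr, by simp [h1], by simp [h2]⟩

/-- A derivation changes the value of a substitution only from one word `w_ξ` to another. -/
theorem Der.value (hR : Equivalence R) (h : Der n R u v) {χ : Letter → List Letter}
    (H : Fac n (FactorLattice.sub χ u)) : FactorLattice.sub χ v = FactorLattice.sub χ u ∨
      ∃ ε η, FactorLattice.sub χ u = wl n ε ∧ FactorLattice.sub χ v = wl n η ∧
        R (wl n ε) (wl n η) := by
  induction h with
  | refl => exact Or.inl rfl
  | @tail b c hb hc ih =>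
    have hFb : Fac n (FactorLattice.sub χ b) := by
      rcases ih with ih | ⟨ε, η, -, ih, -⟩ <;> rw [ih]
      · exact H
      · exact fac_wl _ _
    rcases hc with hc | ⟨p, q, φ, ε, η, hr, rfl, rfl⟩
    · rw [← hc χ (Or.inl hFb)]; exact ih
    · rcases hFb.rigid_or_collapse with hrig | hcol
      · rw [hrig.sub_eq] at ih ⊢
        right
        rcases ih with ih | ⟨ε', η', h1, h2, h3⟩
        · exact ⟨ε, η, ih.symm, rfl, hr⟩
        · exact ⟨ε', η, h1, rfl, hR.trans h3 (h2 ▸ hr)⟩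
      · rw [hcol η]; exact ih

theorem DerT.value (h : DerT n u v) {χ : Letter → List Letter}
    (H : Fac n (FactorLattice.sub χ u)) : FactorLattice.sub χ v = FactorLattice.sub χ u ∨
      ∃ ε η, FactorLattice.sub χ u = wl n ε ∧ FactorLattice.sub χ v = wl n η := by
  rcases Der.value ⟨fun _ => trivial, fun _ => trivial, fun _ _ => trivial⟩ h H with
    h | ⟨ε, η, h1, h2, -⟩
  · exact Or.inl h
  · exact Or.inr ⟨ε, η, h1, h2⟩

theorem DerT.fac (h : DerT n u v) {χ : Letter → List Letter}
    (H : Fac n (FactorLattice.sub χ u)) : Fac n (FactorLattice.sub χ v) := by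
  rcases h.value H with h | ⟨-, η, -, h⟩ <;> rw [h]
  · exact H
  · exact fac_wl _ _

theorem fac_nil (n) : Fac n [] := ⟨fun _ => false, [], wl n fun _ => false, by simp⟩

theorem length_le_of_fac (h : Fac n u) : u.length ≤ 20 * n + 8 := by
  obtain ⟨ε, g, k, h⟩ := h
  have := congrArg List.length h
  simp only [length_wl, List.length_append] at this
  omega

theorem DerT.value_of_length (h : DerT n u v) {χ : Letter → List Letter}
    (H : Fac n (FactorLattice.sub χ u)) (hl : (FactorLattice.sub χ u).length < 20 * n + 8) :
    FactorLattice.sub χ v = FactorLattice.sub χ u := by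
  rcases h.value H with h | ⟨ε, -, h, -⟩
  · exact h
  · rw [h, length_wl] at hl; omega

/-- The two sides of a derivable identity have the same letters. -/
theorem DerT.mem (h : DerT n u v) {e : Letter} (he : e ∈ v) : e ∈ u := by
  by_contra hu
  have h0 : FactorLattice.sub (fun l => if l = e then [e] else []) u = [] :=
    sub_eq_nil.2 fun l hl => if_neg fun h' : l = e => hu (h' ▸ hl)
  have := h.value_of_length (h0 ▸ fac_nil n) (by rw [h0]; simp)
  rw [h0, sub_eq_nil] at this
  simpa using this e he

end Basic

/-! ### Two substitutions that agree on a pair `x₁⁽ⁱ⁾, x₂⁽ⁱ⁾` -/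

section Hybrid

variable {n : ℕ} {u v : List Letter} {χ χ' : Letter → List Letter}

/-- A word with the value `x₁⁽ⁱ⁾` or `x₂⁽ⁱ⁾`. -/
def IsX (i : ℕ) (l : List Letter) : Prop := l = [.x 0 i] ∨ l = [.x 1 i]

theorem exists_mem_of_sub_eq_singleton {χ : Letter → List Letter} {l : List Letter} {c : Letter}
    (h : sub χ l = [c]) : ∃ e ∈ l, χ e = [c] := by
  induction l with
  | nil => simp at h
  | cons e l ih =>
    rw [sub_cons, List.append_eq_singleton_iff] at h
    rcases h with ⟨-, h⟩ | ⟨h, -⟩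
    · obtain ⟨f, hf, hc⟩ := ih h
      exact ⟨f, List.mem_cons_of_mem _ hf, hc⟩
    · exact ⟨e, List.mem_cons_self, h⟩

theorem eq_nil_or_of_sub_eq_singleton {χ : Letter → List Letter} {l : List Letter} {c e : Letter}
    (h : sub χ l = [c]) (he : e ∈ l) : χ e = [] ∨ χ e = [c] := by
  obtain ⟨a, b, rfl⟩ := List.append_of_mem he
  rw [sub_append, sub_cons] at h
  have h1 : (χ e).length ≤ 1 := by
    have := congrArg List.length h
    simp only [List.length_append, List.length_singleton] at this
    omega
  have h2 : ∀ d ∈ χ e, d = c := fun d hd => by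
    have : d ∈ sub χ a ++ (χ e ++ sub χ b) := by simp [hd]
    simpa [h] using this
  match χ e, h1, h2 with
  | [], _, _ => exact Or.inl rfl
  | [d], _, h2 => exact Or.inr (by rw [h2 d (by simp)])

theorem inW_x {n i : ℕ} {j : Fin 2} (hi : 1 ≤ i) (hin : i ≤ n) : InW n (.x j i) := by
  rw [inW_iff_occ fun _ => false]
  fin_cases j
  · exact ⟨12 * n + 8 * i - 1, by
      simp only [Occ, Fin.mk_zero, Fin.zero_eta, Fin.isValue]; exact ⟨hi, hin, Or.inr (by omega)⟩⟩
  · exact ⟨12 * n + 8 * i + 5, by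
      simp only [Occ, Fin.mk_one, Fin.isValue]; exact ⟨hi, hin, Or.inr trivial⟩⟩

theorem Rigid.of_agree {p q : List Letter} {φ : Letter → List Letter} {i : ℕ} {ε : ℕ → Bool}
    (hi : 1 ≤ i) (hin : i ≤ n) (h : Rigid n χ φ p q)
    (hF : Fac n (sub χ' (p ++ sub φ (wl n ε) ++ q)))
    (hχ : ∀ l ∈ p ++ sub φ (wl n ε) ++ q, IsX i (χ l) → χ l = χ' l) : Rigid n χ' φ p q := by
  have key : ∀ j : Fin 2, sub χ' (φ (.x j i)) ≠ [] := by
    intro j h0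
    have hW : InW n (.x j i) := inW_x hi hin
    obtain ⟨e, he, hc⟩ := exists_mem_of_sub_eq_singleton (h.2.2 _ hW)
    have := hχ e (by
      simp only [List.mem_append]
      exact Or.inl (Or.inr (List.mem_flatMap.2 ⟨_, mem_wl.2 hW, he⟩)))
      (by fin_cases j; exacts [Or.inl hc, Or.inr hc])
    rw [sub_eq_nil] at h0
    rw [hc, h0 e he] at this
    simp at this
  obtain ⟨ζ, g, h, H⟩ := hF
  simp only [sub_append, sub_sub] at H
  obtain ⟨hg, hh, hfix, -⟩ := rigidity (g := g ++ sub χ' p) (h := sub χ' q ++ h)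
    (θ := fun l => sub χ' (φ l)) (by simpa using H) hi hin (key 0) (key 1)
  exact ⟨(List.append_eq_nil_iff.1 hg).2, (List.append_eq_nil_iff.1 hh).1, hfix⟩

/-- Two substitutions that have the same value on a word and agree on the letters sent to
`x₁⁽ⁱ⁾` or `x₂⁽ⁱ⁾` have the same value on every word derivable from it. -/
theorem DerT.eq_of_agree {i : ℕ} (hi : 1 ≤ i) (hin : i ≤ n) (h : DerT n v u)
    (hχ : ∀ l ∈ v, IsX i (χ l) ∨ IsX i (χ' l) → χ l = χ' l) (hF : Fac n (sub χ v))
    (he : sub χ v = sub χ' v) : sub χ u = sub χ' u := by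
  induction h with
  | refl => exact he
  | @tail b c hb hc ih =>
    have hFb : Fac n (sub χ b) := DerT.fac hb hF
    rcases hc with hc | ⟨p, q, φ, ε, η, -, rfl, rfl⟩
    · rw [← hc χ (Or.inl hFb), ih, hc χ' (Or.inl (ih ▸ hFb))]
    · have hFb' : Fac n (sub χ' (p ++ sub φ (wl n ε) ++ q)) := ih ▸ hFb
      rcases hFb.rigid_or_collapse with hr | hcol
      · have hr' := hr.of_agree hi hin hFb' fun l hl hx =>
          hχ l (DerT.mem hb hl) (Or.inl hx)
        rw [hr.sub_eq, hr'.sub_eq]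
      · rcases hFb'.rigid_or_collapse with hr' | hcol'
        · have hr := hr'.of_agree hi hin hFb fun l hl hx =>
            (hχ l (DerT.mem hb hl) (Or.inr hx)).symm
          rw [hr.sub_eq, hr'.sub_eq]
        · rw [hcol, hcol', ih]

open Classical in
/-- The substitution that agrees with `χ` on the letters sent to `x₁⁽¹⁾` or `x₂⁽¹⁾` by `χ` or `χ'`,
and with `χ'` elsewhere. -/
noncomputable def hybrid (χ χ' : Letter → List Letter) (l : Letter) : List Letter :=
  if IsX 1 (χ l) ∨ IsX 1 (χ' l) then χ l else χ' l

/-- Two substitutions, each of which erases a letter or sends it where the other one does, have the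
same value on a word if they and their hybrid have the same value on a word derivable from it.
The hybrid agrees with the first one on `x₁⁽¹⁾, x₂⁽¹⁾` and with the second one on
`x₁⁽²⁾, x₂⁽²⁾`. -/
theorem DerT.eq_of_hybrid (hn : 2 ≤ n) (h : DerT n v u) (hF : Fac n (sub χ v))
    (hd : ∀ l ∈ v, χ l = χ' l ∨ ∃ d, (χ l = [] ∨ χ l = [d]) ∧ (χ' l = [] ∨ χ' l = [d]))
    (h1 : sub (hybrid χ χ') v = sub χ v) (h2 : sub χ' v = sub χ v) : sub χ u = sub χ' u := by
  trans sub (hybrid χ χ') u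
  · refine h.eq_of_agree le_rfl (by omega) (fun l _ hx => ?_) hF h1.symm
    by_cases hc : IsX 1 (χ l) ∨ IsX 1 (χ' l)
    · rw [hybrid, if_pos hc]
    · rw [hybrid, if_neg hc] at hx
      exact (hc hx).elim
  · refine h.eq_of_agree (i := 2) (by omega) hn (fun l hl hx => ?_) (h1 ▸ hF) (h1.trans h2.symm)
    by_cases hc : IsX 1 (χ l) ∨ IsX 1 (χ' l)
    · rw [hybrid, if_pos hc] at hx ⊢
      rcases hd l hl with hd | ⟨d, hd1, hd2⟩
      · exact hd
      · exfalso
        rcases hd1 with hd1 | hd1 <;> rcases hd2 with hd2 | hd2 <;>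
          simp only [hd1, hd2, IsX, List.nil_eq, reduceCtorEq, or_self, List.cons.injEq, and_true,
            or_false, false_or] at hc hx <;>
          rcases hc with hc | hc <;> rcases hx with hx | hx <;> simp_all
    · rw [hybrid, if_neg hc]

/-- All rigid substitutions for a form have the same value on a word derivable from it. -/
theorem DerT.rigid_value_eq (hn : 2 ≤ n) {p q : List Letter} {φ : Letter → List Letter}
    {ε : ℕ → Bool} (h : DerT n (p ++ sub φ (wl n ε) ++ q) u) (hr : Rigid n χ φ p q)
    (hr' : Rigid n χ' φ p q) : sub χ u = sub χ' u := by
  have hd : ∀ c, InW n c → ∀ l ∈ φ c,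
      (χ l = [] ∨ χ l = [c]) ∧ (χ' l = [] ∨ χ' l = [c]) := fun c hc l hl =>
    ⟨eq_nil_or_of_sub_eq_singleton (hr.2.2 c hc) hl,
      eq_nil_or_of_sub_eq_singleton (hr'.2.2 c hc) hl⟩
  have hh : Rigid n (hybrid χ χ') φ p q := by
    have h0 : ∀ r, sub χ r = [] → sub χ' r = [] → sub (hybrid χ χ') r = [] := by
      intro r h1 h2
      rw [sub_eq_nil] at h1 h2 ⊢
      intro e he
      rw [hybrid, h1 e he, h2 e he, ite_self]
    refine ⟨h0 _ hr.1 hr'.1, h0 _ hr.2.1 hr'.2.1, fun c hc => ?_⟩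
    by_cases hx : IsX 1 [c]
    · rw [← hr.2.2 c hc]
      refine sub_congr fun l hl => ?_
      obtain ⟨h1, h2⟩ := hd c hc l hl
      rw [hybrid]
      rcases h1 with h1 | h1 <;> rcases h2 with h2 | h2 <;> simp [h1, h2, hx]
    · rw [← hr'.2.2 c hc]
      refine sub_congr fun l hl => ?_
      obtain ⟨h1, h2⟩ := hd c hc l hl
      have hx' : ¬ IsX 1 [] := by simp [IsX]
      rw [hybrid]
      rcases h1 with h1 | h1 <;> rcases h2 with h2 | h2 <;> simp [h1, h2, hx, hx']
  refine h.eq_of_hybrid hn (by rw [hr.sub_eq]; exact fac_wl n ε) (fun l hl => ?_) ?_ ?_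
  · simp only [List.mem_append] at hl
    rcases hl with (hl | hl) | hl
    · left; rw [sub_eq_nil.1 hr.1 l hl, sub_eq_nil.1 hr'.1 l hl]
    · obtain ⟨c, hc, hl⟩ := List.mem_flatMap.1 hl
      exact Or.inr ⟨c, hd c (mem_wl.1 hc) l hl⟩
    · left; rw [sub_eq_nil.1 hr.2.1 l hl, sub_eq_nil.1 hr'.2.1 l hl]
  · rw [hr.sub_eq, hh.sub_eq]
  · rw [hr.sub_eq, hr'.sub_eq]

end Hybrid
/-! ### Subwords preserved by derivations -/

section Positions

/-- The position of the first occurrence of a letter. -/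
def fst (u : List Letter) (e : Letter) : ℕ := u.idxOf e

/-- The position of the last occurrence of a letter. -/
def lst (u : List Letter) (e : Letter) : ℕ := u.length - 1 - u.reverse.idxOf e

variable {u v : List Letter} {e f : Letter} {i j k : ℕ}

theorem getElem?_fst (h : e ∈ u) : u[fst u e]? = some e := by
  simp [fst, h]

theorem fst_le (h : u[i]? = some e) : fst u e ≤ i := by
  obtain ⟨hi, rfl⟩ := List.getElem?_eq_some_iff.1 h
  by_contra hlt
  have := List.not_of_lt_findIdx (not_le.1 hlt)
  simp at this

theorem le_lst (h : u[i]? = some e) : i ≤ lst u e := by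
  obtain ⟨hi, h'⟩ := List.getElem?_eq_some_iff.1 h
  have : u.reverse[u.length - 1 - i]? = some e := by
    rw [List.getElem?_reverse (by omega), ← h]; congr 1; omega
  have := fst_le this
  rw [fst] at this
  rw [lst]; omega

theorem getElem?_lst (h : e ∈ u) : u[lst u e]? = some e := by
  have h1 : u.reverse[u.reverse.idxOf e]? = some e := by simp [h]
  have h2 : u.reverse.idxOf e < u.length := by
    rw [← List.length_reverse]; exact List.idxOf_lt_length_of_mem (by simpa)
  rw [List.getElem?_reverse h2] at h1
  exact h1

theorem fst_lt_length (h : e ∈ u) : fst u e < u.length :=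
  (List.getElem?_eq_some_iff.1 (getElem?_fst h)).1

theorem mem_of_count {m : ℕ} (h : u.count e = m + 1) : e ∈ u :=
  List.count_pos_iff.1 (by omega)

theorem sublist_drop_cons {pat : List Letter} (hk : k ≤ i) (h : u[i]? = some e)
    (hp : List.Sublist pat (u.drop (i + 1))) : List.Sublist (e :: pat) (u.drop k) := by
  obtain ⟨hi, h'⟩ := List.getElem?_eq_some_iff.1 h
  have : u.drop k = (u.drop k).take (i - k) ++ e :: u.drop (i + 1) := by
    rw [← h', ← List.drop_eq_getElem_cons hi]
    conv_lhs => rw [← List.take_append_drop (i - k) (u.drop k), List.drop_drop]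
    congr 2; omega
  rw [this]
  exact (hp.cons_cons e).trans (List.sublist_append_right _ _)

theorem exists_of_sublist_drop_cons {pat : List Letter}
    (h : List.Sublist (e :: pat) (u.drop k)) :
    ∃ i, k ≤ i ∧ u[i]? = some e ∧ List.Sublist pat (u.drop (i + 1)) := by
  rw [List.cons_sublist_iff] at h
  obtain ⟨a, b, hab, ha, hb⟩ := h
  obtain ⟨a1, a2, rfl⟩ := List.append_of_mem ha
  have hk : u.drop k = a1 ++ e :: (a2 ++ b) := by simp [hab]
  refine ⟨k + a1.length, by omega, ?_, ?_⟩
  · rw [← List.getElem?_drop, hk]; simp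
  · rw [add_assoc, ← List.drop_drop, hk, List.drop_append]
    simp only [Nat.add_sub_cancel_left, List.drop_one, List.tail_cons]
    exact hb.trans ((List.sublist_append_right a2 b).trans (List.sublist_append_right _ _))

theorem sublist_drop_zero {pat : List Letter} : List.Sublist pat (u.drop 0) ↔ List.Sublist pat u :=
  Iff.rfl

theorem two_le_count (hij : i < j) (hi : u[i]? = some e) (hj : u[j]? = some e) :
    2 ≤ u.count e := by
  rw [← List.replicate_sublist_iff]
  exact sublist_drop_cons (k := 0) (by omega) hi
    (sublist_drop_cons hij hj (List.nil_sublist _))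

theorem three_le_count (hij : i < j) (hjk : j < k) (hi : u[i]? = some e) (hj : u[j]? = some e)
    (hk : u[k]? = some e) : 3 ≤ u.count e := by
  rw [← List.replicate_sublist_iff]
  exact sublist_drop_cons (k := 0) (by omega) hi
    (sublist_drop_cons hij hj (sublist_drop_cons hjk hk (List.nil_sublist _)))

theorem fst_lt_lst (h : 2 ≤ u.count e) : fst u e < lst u e := by
  rw [← List.replicate_sublist_iff, ← sublist_drop_zero] at h
  obtain ⟨i, -, hi, h⟩ := exists_of_sublist_drop_cons h
  obtain ⟨j, hij, hj, -⟩ := exists_of_sublist_drop_cons h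
  have := fst_le hi
  have := le_lst hj
  omega

theorem eq_of_count_one (h : u.count e = 1) (hi : u[i]? = some e) (hj : u[j]? = some e) :
    i = j := by
  rcases lt_trichotomy i j with h' | h' | h'
  · have := two_le_count h' hi hj; omega
  · exact h'
  · have := two_le_count h' hj hi; omega

theorem fst_eq_of_count_one (h : u.count e = 1) (hi : u[i]? = some e) : fst u e = i :=
  eq_of_count_one h (getElem?_fst (List.mem_of_getElem? hi)) hi

theorem eq_fst_or_lst (h : u.count e ≤ 2) (hi : u[i]? = some e) : i = fst u e ∨ i = lst u e := by
  have hm := List.mem_of_getElem? hi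
  have h1 := fst_le hi
  have h2 := le_lst hi
  by_contra! h3
  have := three_le_count (by omega) (by omega) (getElem?_fst hm) hi (getElem?_lst hm)
  omega

theorem fst_lst_eq (h : u.count e ≤ 2) (hij : i < j) (hi : u[i]? = some e)
    (hj : u[j]? = some e) : fst u e = i ∧ lst u e = j := by
  have h1 := eq_fst_or_lst h hi
  have h2 := eq_fst_or_lst h hj
  have := fst_le hi
  have := le_lst hj
  have := fst_le hj
  have := le_lst hi
  omega

theorem ne_of_fst (h : fst u e < fst u f) : e ≠ f := by rintro rfl; omega

end Positions

section Iso

variable {n : ℕ} {u v : List Letter} {χ : Letter → List Letter}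

/-- A word can be recovered from its image if the images of its letters begin with distinct
letters. -/
theorem eq_of_sub_eq_sub {a b : List Letter} (ha : ∀ e ∈ a, χ e ≠ []) (hb : ∀ e ∈ b, χ e ≠ [])
    (hab : ∀ e ∈ a, ∀ f ∈ b, (χ e).head? = (χ f).head? → e = f) (h : sub χ a = sub χ b) :
    a = b := by
  induction a generalizing b with
  | nil =>
    cases b with
    | nil => rfl
    | cons f b =>
      have := sub_eq_nil.1 h.symm f (by simp)
      exact (hb f (by simp) this).elim
  | cons e a ih =>
    cases b with
    | nil =>
      have := sub_eq_nil.1 h e (by simp)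
      exact (ha e (by simp) this).elim
    | cons f b =>
      obtain ⟨c, l, hl⟩ := List.exists_cons_of_ne_nil (ha e (by simp))
      obtain ⟨d, m, hm⟩ := List.exists_cons_of_ne_nil (hb f (by simp))
      simp only [sub_cons] at h
      have hef : e = f := by
        refine hab e (by simp) f (by simp) ?_
        rw [hl, hm] at h ⊢
        simp only [List.cons_append, List.cons.injEq] at h
        simp [h.1]
      subst hef
      rw [ih (fun x hx => ha x (by simp [hx])) (fun x hx => hb x (by simp [hx]))
        (fun x hx y hy => hab x (by simp [hx]) y (by simp [hy])) (List.append_cancel_left h)]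

theorem sub_filter (pat : List Letter) (h : ∀ e ∉ pat, χ e = []) :
    sub χ (u.filter (· ∈ pat)) = sub χ u := by
  induction u with
  | nil => rfl
  | cons e u ih =>
    by_cases he : e ∈ pat
    · simp [he, ih]
    · simp [he, ih, h e he]

/-- A proper factor of one of the words `w_ξ`. -/
def ProperFac (n : ℕ) (u : List Letter) : Prop := Fac n u ∧ u.length < 20 * n + 8

theorem ProperFac.of_append {p q : List Letter} (h : ProperFac n (p ++ u ++ q)) :
    ProperFac n u := by
  refine ⟨h.1.of_append _ _, ?_⟩
  have := h.2
  simp only [List.length_append] at this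
  omega

/-- Derivations preserve the subword formed by some letters, if this subword can be encoded in a
proper factor of a word `w_ξ`. -/
theorem DerT.sublist (h : DerT n u v) {pat : List Letter} (hu : List.Sublist pat u)
    (hc : ∀ e ∈ pat, u.count e = pat.count e) (h0 : ∀ e ∉ pat, χ e = [])
    (h1 : ∀ e ∈ pat, χ e ≠ [])
    (h2 : ∀ e ∈ pat, ∀ f ∈ pat, (χ e).head? = (χ f).head? → e = f)
    (hF : ProperFac n (sub χ pat)) :
    List.Sublist pat v ∧ ∀ e ∈ pat, v.count e = pat.count e := by
  have hfu : u.filter (· ∈ pat) = pat := by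
    have hs : List.Sublist pat (u.filter (· ∈ pat)) := by
      have := hu.filter (· ∈ pat)
      rwa [List.filter_eq_self.2 (by simp)] at this
    refine (hs.eq_of_length (List.Perm.length_eq ?_)).symm
    rw [List.perm_iff_count]
    intro e
    by_cases he : e ∈ pat
    · rw [List.count_filter (by simpa), hc e he]
    · rw [List.count_eq_zero_of_not_mem he, List.count_eq_zero_of_not_mem (by simp [he])]
  have hval : sub χ u = sub χ pat := by rw [← sub_filter pat h0, hfu]
  have hv : sub χ v = sub χ u := h.value_of_length (hval ▸ hF.1) (hval ▸ hF.2)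
  have hfv : v.filter (· ∈ pat) = pat := by
    refine eq_of_sub_eq_sub (χ := χ) (fun e he => h1 e (by simpa using (List.mem_filter.1 he).2)) h1
      (fun e he f hf => h2 e (by simpa using (List.mem_filter.1 he).2) f hf) ?_
    rw [sub_filter pat h0, hv, hval]
  refine ⟨hfv ▸ List.filter_sublist, fun e he => ?_⟩
  rw [← List.count_filter (p := (· ∈ pat)) (by simpa), hfv]

/-- The part of `w_ξ`, for trivial `ξ`, from `x₂⁽¹⁾` to the second occurrence of `x₁⁽²⁾`. -/
theorem exists_core_factor (hn : 2 ≤ n) : ∃ H1 H2 : List Letter,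
    H1.head? = some (.x 1 2) ∧ H2.head? = some (.s 2) ∧
    ProperFac n ([.x 1 1, .x 0 2] ++ H1 ++ [.y 1] ++ H2 ++ [.x 1 1, .y 1, .x 0 2]) := by
  set w := wl n fun _ => false with hw
  have hget : ∀ {c p}, Occ n (fun _ => false) c p → w.drop p = c :: w.drop (p + 1) := by
    intro c p hc
    obtain ⟨hp, h⟩ := List.getElem?_eq_some_iff.1 (getElem?_wl.2 hc)
    rw [hw, List.drop_eq_getElem_cons hp, h]
  have split : ∀ k m, w.drop k = (w.drop k).take m ++ w.drop (k + m) := by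
    intro k m
    rw [← List.drop_drop, List.take_append_drop]
  have e1 := hget (c := .x 1 1) (p := 7 * n + 2) (by simp [Occ]; omega)
  have e2 := hget (c := .x 0 2) (p := 7 * n + 3) (by simp [Occ]; omega)
  have e3 := hget (c := .x 1 2) (p := 7 * n + 4) (by simp [Occ]; omega)
  have e4 := hget (c := .y 1) (p := 10 * n + 5) (by simp [Occ]; omega)
  have e5 := hget (c := .s 2) (p := 10 * n + 6) (by simp [Occ]; omega)
  have e6 := hget (c := .x 1 1) (p := 12 * n + 13) (by simp [Occ]; omega)
  have e7 := hget (c := .y 1) (p := 12 * n + 14) (by simp [Occ]; omega)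
  have e8 := hget (c := .x 0 2) (p := 12 * n + 15) (by simp [Occ]; omega)
  have s1 := split (7 * n + 4) (3 * n + 1)
  have s2 := split (10 * n + 6) (2 * n + 7)
  rw [show 7 * n + 4 + (3 * n + 1) = 10 * n + 5 by omega, e4] at s1
  rw [show 10 * n + 6 + (2 * n + 7) = 12 * n + 13 by omega, e6, e7, e8] at s2
  have hwlen : w.length = 20 * n + 8 := length_wl n _
  refine ⟨(w.drop (7 * n + 4)).take (3 * n + 1), (w.drop (10 * n + 6)).take (2 * n + 7), ?_, ?_,
    ⟨fun _ => false, w.take (7 * n + 2), w.drop (12 * n + 16), ?_⟩, ?_⟩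
  · rw [e3]; simp
  · rw [e5]; simp
  · rw [← hw]
    conv_lhs => rw [← List.take_append_drop (7 * n + 2) w, e1, e2, s1, s2]
    simp
  · simp; omega

end Iso

section Patterns

variable {n : ℕ} {u v : List Letter} {x y τ S T Y : Letter}

theorem DerT.count_one (hn : 2 ≤ n) (h : DerT n u v) (hτ : u.count τ = 1) : v.count τ = 1 := by
  obtain ⟨H1, H2, h1, h2, hG⟩ := exists_core_factor hn
  have := h.sublist (χ := fun l => if l = τ then [.y 1] else []) (pat := [τ])
    (List.singleton_sublist.2 (mem_of_count hτ)) (by simp [hτ]) (by simp) (by simp) (by simp)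
    (by
      simp only [sub_cons, sub_nil, if_true, List.append_nil]
      exact ProperFac.of_append (p := [.x 1 1, .x 0 2] ++ H1)
        (q := H2 ++ [.x 1 1, .y 1, .x 0 2]) (by simpa using hG))
  simpa using this.2

/-- Derivations preserve the order of occurrences `x τ x`. -/
theorem DerT.split_pattern (hn : 2 ≤ n) (h : DerT n u v) (hx : u.count x = 2)
    (hτ : u.count τ = 1) (o1 : fst u x < fst u τ) (o2 : fst u τ < lst u x) :
    v.count x = 2 ∧ v.count τ = 1 ∧ fst v x < fst v τ ∧ fst v τ < lst v x := by
  obtain ⟨H1, H2, h1, h2, hG⟩ := exists_core_factor hn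
  have n1 : x ≠ τ := ne_of_fst o1
  have mx := mem_of_count hx
  have mτ := mem_of_count hτ
  obtain ⟨hs, hc⟩ := h.sublist (pat := [x, τ, x])
    (χ := fun l => if l = x then [.y 1] else if l = τ then H2 ++ [.x 1 1] else [])
    (sublist_drop_cons (k := 0) (by omega) (getElem?_fst mx)
      (sublist_drop_cons o1 (getElem?_fst mτ)
      (sublist_drop_cons o2 (getElem?_lst mx) (List.nil_sublist _))))
    (by simp [List.count_cons, n1, n1.symm, hx, hτ]) (fun e he => by
      simp only [List.mem_cons, List.not_mem_nil, or_false, not_or] at he; simp [he])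
    (by simp [n1, n1.symm]) (by simp [n1, n1.symm, h2])
    (by
      simp only [sub_cons, sub_nil, if_true, List.append_nil, n1, n1.symm, if_false]
      exact ProperFac.of_append (p := [.x 1 1, .x 0 2] ++ H1) (q := [.x 0 2]) (by simpa using hG))
  simp only [List.mem_cons, List.not_mem_nil, or_false, forall_eq_or_imp, forall_eq,
    List.count_cons, List.count_nil, beq_iff_eq, n1, n1.symm, if_true, if_false] at hc
  obtain ⟨hvx, hvτ, -⟩ := hc
  rw [← sublist_drop_zero] at hs
  obtain ⟨p1, q1, g1, hs⟩ := exists_of_sublist_drop_cons hs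
  obtain ⟨p2, q2, g2, hs⟩ := exists_of_sublist_drop_cons hs
  obtain ⟨p3, q3, g3, -⟩ := exists_of_sublist_drop_cons hs
  have := fst_lst_eq (by omega) (by omega) g1 g3
  have := fst_eq_of_count_one (by omega) g2
  omega

/-- Derivations preserve the order of occurrences `x y τ x S y`. The letters `x`, `y` are encoded as
`x₂⁽¹⁾`, `x₁⁽²⁾`, and `S` as `y₁`. -/
theorem DerT.pattern_xyτxSy (hn : 2 ≤ n) (h : DerT n u v) (hx : u.count x = 2)
    (hy : u.count y = 2) (hτ : u.count τ = 1) (hS : u.count S = 1) (o1 : fst u x < fst u y)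
    (o2 : fst u y < fst u τ) (o3 : fst u τ < lst u x) (o4 : lst u x < fst u S)
    (o5 : fst u S < lst u y) : fst v x < fst v y ∧ fst v y < fst v τ ∧ fst v τ < lst v x ∧
      lst v x < fst v S ∧ fst v S < lst v y := by
  obtain ⟨H1, H2, h1, h2, hG⟩ := exists_core_factor hn
  have n1 : x ≠ y := ne_of_fst o1
  have n2 : x ≠ τ := ne_of_fst (o1.trans o2)
  have n3 : x ≠ S := ne_of_fst (by omega : fst u x < fst u S)
  have n4 : y ≠ τ := ne_of_fst o2
  have n5 : y ≠ S := ne_of_fst (by omega : fst u y < fst u S)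
  have n6 : τ ≠ S := ne_of_fst (by omega : fst u τ < fst u S)
  have mx := mem_of_count hx
  have my := mem_of_count hy
  have mτ := mem_of_count hτ
  have mS := mem_of_count hS
  have hH1 : H1 ≠ [] := by rintro rfl; simp at h1
  obtain ⟨hs, hc⟩ := h.sublist (pat := [x, y, τ, x, S, y])
    (χ := fun l => if l = x then [.x 1 1] else if l = y then [.x 0 2] else if l = τ then
      H1 ++ [.y 1] ++ H2 else if l = S then [.y 1] else [])
    (sublist_drop_cons (k := 0) (by omega) (getElem?_fst mx)
      (sublist_drop_cons o1 (getElem?_fst my) (sublist_drop_cons o2 (getElem?_fst mτ)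
      (sublist_drop_cons o3 (getElem?_lst mx) (sublist_drop_cons o4 (getElem?_fst mS)
      (sublist_drop_cons o5 (getElem?_lst my) (List.nil_sublist _)))))))
    (by simp [List.count_cons, n1, n1.symm, n2, n2.symm, n3, n3.symm, n4, n4.symm, n5, n5.symm,
      n6, n6.symm, hx, hτ, hy, hS]) (fun e he => by
      simp only [List.mem_cons, List.not_mem_nil, or_false, not_or] at he; simp [he])
    (by simp [n1, n1.symm, n2, n2.symm, n3, n3.symm, n4, n4.symm, n5, n5.symm, n6, n6.symm])
    (by simp [n1, n1.symm, n2, n2.symm, n3, n3.symm, n4, n4.symm, n5, n5.symm, n6, n6.symm, h1])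
    (by
      simp only [sub_cons, sub_nil, if_true, List.append_nil, n1, n1.symm, n2, n2.symm, n3,
        n3.symm, n4, n4.symm, n5, n5.symm, n6, n6.symm, if_false]
      exact ProperFac.of_append (p := []) (q := []) (by simpa using hG))
  simp only [List.mem_cons, List.not_mem_nil, or_false, forall_eq_or_imp, forall_eq,
    List.count_cons, List.count_nil, beq_iff_eq, n1, n1.symm, n2, n2.symm, n3, n3.symm, n4,
    n4.symm, n5, n5.symm, n6, n6.symm, if_true, if_false] at hc
  obtain ⟨hvx, hvy, hvτ, -, hvS, -⟩ := hc
  rw [← sublist_drop_zero] at hs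
  obtain ⟨p1, q1, g1, hs⟩ := exists_of_sublist_drop_cons hs
  obtain ⟨p2, q2, g2, hs⟩ := exists_of_sublist_drop_cons hs
  obtain ⟨p3, q3, g3, hs⟩ := exists_of_sublist_drop_cons hs
  obtain ⟨p4, q4, g4, hs⟩ := exists_of_sublist_drop_cons hs
  obtain ⟨p5, q5, g5, hs⟩ := exists_of_sublist_drop_cons hs
  obtain ⟨p6, q6, g6, -⟩ := exists_of_sublist_drop_cons hs
  have := fst_lst_eq (by omega) (by omega) g1 g4
  have := fst_lst_eq (by omega) (by omega) g2 g6
  have := fst_eq_of_count_one (by omega) g3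
  have := fst_eq_of_count_one (by omega) g5
  omega

/-- Derivations preserve the order of occurrences `x y T Y S x Y y`. The letters `x`, `y`, `Y` are
encoded as `x₂⁽¹⁾`, `x₁⁽²⁾`, `y₁`. -/
theorem DerT.pattern_xyTYSxYy (hn : 2 ≤ n) (h : DerT n u v) (hx : u.count x = 2)
    (hy : u.count y = 2) (hT : u.count T = 1) (hY : u.count Y = 2) (hS : u.count S = 1)
    (o1 : fst u x < fst u y) (o2 : fst u y < fst u T) (o3 : fst u T < fst u Y)
    (o4 : fst u Y < fst u S) (o5 : fst u S < lst u x) (o6 : lst u x < lst u Y)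
    (o7 : lst u Y < lst u y) : fst v x < fst v y ∧ fst v y < fst v T ∧ fst v T < fst v Y ∧
      fst v Y < fst v S ∧ fst v S < lst v x ∧ lst v x < lst v Y ∧ lst v Y < lst v y := by
  obtain ⟨H1, H2, h1, h2, hG⟩ := exists_core_factor hn
  have n1 : x ≠ y := ne_of_fst o1
  have n2 : x ≠ T := ne_of_fst (by omega : fst u x < fst u T)
  have n3 : x ≠ Y := ne_of_fst (by omega : fst u x < fst u Y)
  have n4 : x ≠ S := ne_of_fst (by omega : fst u x < fst u S)
  have n5 : y ≠ T := ne_of_fst o2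
  have n6 : y ≠ Y := ne_of_fst (by omega : fst u y < fst u Y)
  have n7 : y ≠ S := ne_of_fst (by omega : fst u y < fst u S)
  have n8 : T ≠ Y := ne_of_fst o3
  have n9 : T ≠ S := ne_of_fst (by omega : fst u T < fst u S)
  have n10 : Y ≠ S := ne_of_fst o4
  have mx := mem_of_count hx
  have my := mem_of_count hy
  have mT := mem_of_count hT
  have mY := mem_of_count hY
  have mS := mem_of_count hS
  have hH1 : H1 ≠ [] := by rintro rfl; simp at h1
  have hH2 : H2 ≠ [] := by rintro rfl; simp at h2
  obtain ⟨hs, hc⟩ := h.sublist (pat := [x, y, T, Y, S, x, Y, y])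
    (χ := fun l => if l = x then [.x 1 1] else if l = y then [.x 0 2] else if l = T then
      H1 else if l = Y then [.y 1] else if l = S then H2 else [])
    (sublist_drop_cons (k := 0) (by omega) (getElem?_fst mx)
      (sublist_drop_cons o1 (getElem?_fst my) (sublist_drop_cons o2 (getElem?_fst mT)
      (sublist_drop_cons o3 (getElem?_fst mY) (sublist_drop_cons o4 (getElem?_fst mS)
      (sublist_drop_cons o5 (getElem?_lst mx) (sublist_drop_cons o6 (getElem?_lst mY)
      (sublist_drop_cons o7 (getElem?_lst my) (List.nil_sublist _)))))))))
    (by simp [List.count_cons, n1, n1.symm, n2, n2.symm, n3, n3.symm, n4, n4.symm, n5, n5.symm,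
      n6, n6.symm, n7, n7.symm, n8, n8.symm, n9, n9.symm, n10, n10.symm, hx, hT, hY, hy, hS])
    (fun e he => by
      simp only [List.mem_cons, List.not_mem_nil, or_false, not_or] at he; simp [he])
    (by simp [n1, n1.symm, n2, n2.symm, n3, n3.symm, n4, n4.symm, n5, n5.symm, n6, n6.symm,
      n7, n7.symm, n8, n8.symm, n9, n9.symm, n10, n10.symm, hH1, hH2])
    (by simp [n1, n1.symm, n2, n2.symm, n3, n3.symm, n4, n4.symm, n5, n5.symm, n6, n6.symm, h1,
      n7, n7.symm, n8, n8.symm, n9, n9.symm, n10, n10.symm, h2])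
    (by
      simp only [sub_cons, sub_nil, if_true, List.append_nil, n1, n1.symm, n2, n2.symm, n3,
        n3.symm, n4, n4.symm, n5, n5.symm, n6, n6.symm, n7, n7.symm, n8, n8.symm, n9, n9.symm,
        n10, n10.symm, if_false]
      exact ProperFac.of_append (p := []) (q := []) (by simpa using hG))
  simp only [List.mem_cons, List.not_mem_nil, or_false, forall_eq_or_imp, forall_eq,
    List.count_cons, List.count_nil, beq_iff_eq, n1, n1.symm, n2, n2.symm, n3, n3.symm, n4,
    n4.symm, n5, n5.symm, n6, n6.symm, n7, n7.symm, n8, n8.symm, n9, n9.symm, n10, n10.symm,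
    if_true, if_false] at hc
  obtain ⟨hvx, hvy, hvT, hvY, hvS, -⟩ := hc
  rw [← sublist_drop_zero] at hs
  obtain ⟨p1, q1, g1, hs⟩ := exists_of_sublist_drop_cons hs
  obtain ⟨p2, q2, g2, hs⟩ := exists_of_sublist_drop_cons hs
  obtain ⟨p3, q3, g3, hs⟩ := exists_of_sublist_drop_cons hs
  obtain ⟨p4, q4, g4, hs⟩ := exists_of_sublist_drop_cons hs
  obtain ⟨p5, q5, g5, hs⟩ := exists_of_sublist_drop_cons hs
  obtain ⟨p6, q6, g6, hs⟩ := exists_of_sublist_drop_cons hs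
  obtain ⟨p7, q7, g7, hs⟩ := exists_of_sublist_drop_cons hs
  obtain ⟨p8, q8, g8, -⟩ := exists_of_sublist_drop_cons hs
  have := fst_lst_eq (by omega) (by omega) g1 g6
  have := fst_lst_eq (by omega) (by omega) g2 g8
  have := fst_lst_eq (by omega) (by omega) g4 g7
  have := fst_eq_of_count_one (by omega) g3
  have := fst_eq_of_count_one (by omega) g5
  omega

/-- Derivations preserve the order of occurrences `x T Y S x Y`. The letters `x`, `Y` are encoded as
`x₂⁽¹⁾`, `y₁`. -/
theorem DerT.pattern_xTYSxY (hn : 2 ≤ n) (h : DerT n u v) (hx : u.count x = 2)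
    (hT : u.count T = 1) (hY : u.count Y = 2) (hS : u.count S = 1)
    (o1 : fst u x < fst u T) (o2 : fst u T < fst u Y) (o3 : fst u Y < fst u S)
    (o4 : fst u S < lst u x) (o5 : lst u x < lst u Y) : lst v x < lst v Y := by
  obtain ⟨H1, H2, h1, h2, hG⟩ := exists_core_factor hn
  have n1 : x ≠ T := ne_of_fst o1
  have n2 : x ≠ Y := ne_of_fst (by omega : fst u x < fst u Y)
  have n3 : x ≠ S := ne_of_fst (by omega : fst u x < fst u S)
  have n4 : T ≠ Y := ne_of_fst o2
  have n5 : T ≠ S := ne_of_fst (by omega : fst u T < fst u S)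
  have n6 : Y ≠ S := ne_of_fst o3
  have mx := mem_of_count hx
  have mT := mem_of_count hT
  have mY := mem_of_count hY
  have mS := mem_of_count hS
  have hH2 : H2 ≠ [] := by rintro rfl; simp at h2
  obtain ⟨hs, hc⟩ := h.sublist (pat := [x, T, Y, S, x, Y])
    (χ := fun l => if l = x then [.x 1 1] else if l = T then .x 0 2 :: H1 else if l = Y then
      [.y 1] else if l = S then H2 else [])
    (sublist_drop_cons (k := 0) (by omega) (getElem?_fst mx)
      (sublist_drop_cons o1 (getElem?_fst mT) (sublist_drop_cons o2 (getElem?_fst mY)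
      (sublist_drop_cons o3 (getElem?_fst mS) (sublist_drop_cons o4 (getElem?_lst mx)
      (sublist_drop_cons o5 (getElem?_lst mY) (List.nil_sublist _)))))))
    (by simp [List.count_cons, n1, n1.symm, n2, n2.symm, n3, n3.symm, n4, n4.symm, n5, n5.symm,
      n6, n6.symm, hx, hT, hY, hS])
    (fun e he => by
      simp only [List.mem_cons, List.not_mem_nil, or_false, not_or] at he; simp [he])
    (by simp [n1, n1.symm, n2, n2.symm, n3, n3.symm, n4, n4.symm, n5, n5.symm, n6, n6.symm, hH2])
    (by simp [n1, n1.symm, n2, n2.symm, n3, n3.symm, n4, n4.symm, n5, n5.symm, n6, n6.symm, h2])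
    (by
      simp only [sub_cons, sub_nil, if_true, List.append_nil, n1, n1.symm, n2, n2.symm, n3,
        n3.symm, n4, n4.symm, n5, n5.symm, n6, n6.symm, if_false]
      exact ProperFac.of_append (p := []) (q := [.x 0 2]) (by simpa using hG))
  simp only [List.mem_cons, List.not_mem_nil, or_false, forall_eq_or_imp, forall_eq,
    List.count_cons, List.count_nil, beq_iff_eq, n1, n1.symm, n2, n2.symm, n3, n3.symm, n4,
    n4.symm, n5, n5.symm, n6, n6.symm, if_true, if_false] at hc
  obtain ⟨hvx, hvT, hvY, hvS, -⟩ := hc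
  rw [← sublist_drop_zero] at hs
  obtain ⟨p1, q1, g1, hs⟩ := exists_of_sublist_drop_cons hs
  obtain ⟨p2, q2, g2, hs⟩ := exists_of_sublist_drop_cons hs
  obtain ⟨p3, q3, g3, hs⟩ := exists_of_sublist_drop_cons hs
  obtain ⟨p4, q4, g4, hs⟩ := exists_of_sublist_drop_cons hs
  obtain ⟨p5, q5, g5, hs⟩ := exists_of_sublist_drop_cons hs
  obtain ⟨p6, q6, g6, -⟩ := exists_of_sublist_drop_cons hs
  have := fst_lst_eq (by omega) (by omega) g1 g5
  have := fst_lst_eq (by omega) (by omega) g3 g6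
  omega

/-- Derivations preserve the order of occurrences `y T Y S Y y`. The letters `y`, `Y` are encoded as
`x₁⁽²⁾`, `y₁`. -/
theorem DerT.pattern_yTYSYy (hn : 2 ≤ n) (h : DerT n u v) (hy : u.count y = 2)
    (hT : u.count T = 1) (hY : u.count Y = 2) (hS : u.count S = 1)
    (o1 : fst u y < fst u T) (o2 : fst u T < fst u Y) (o3 : fst u Y < fst u S)
    (o4 : fst u S < lst u Y) (o5 : lst u Y < lst u y) : lst v Y < lst v y := by
  obtain ⟨H1, H2, h1, h2, hG⟩ := exists_core_factor hn
  have n1 : y ≠ T := ne_of_fst o1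
  have n2 : y ≠ Y := ne_of_fst (by omega : fst u y < fst u Y)
  have n3 : y ≠ S := ne_of_fst (by omega : fst u y < fst u S)
  have n4 : T ≠ Y := ne_of_fst o2
  have n5 : T ≠ S := ne_of_fst (by omega : fst u T < fst u S)
  have n6 : Y ≠ S := ne_of_fst o3
  have my := mem_of_count hy
  have mT := mem_of_count hT
  have mY := mem_of_count hY
  have mS := mem_of_count hS
  have hH1 : H1 ≠ [] := by rintro rfl; simp at h1
  obtain ⟨hs, hc⟩ := h.sublist (pat := [y, T, Y, S, Y, y])
    (χ := fun l => if l = y then [.x 0 2] else if l = T then H1 else if l = Y then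
      [.y 1] else if l = S then H2 ++ [.x 1 1] else [])
    (sublist_drop_cons (k := 0) (by omega) (getElem?_fst my)
      (sublist_drop_cons o1 (getElem?_fst mT) (sublist_drop_cons o2 (getElem?_fst mY)
      (sublist_drop_cons o3 (getElem?_fst mS) (sublist_drop_cons o4 (getElem?_lst mY)
      (sublist_drop_cons o5 (getElem?_lst my) (List.nil_sublist _)))))))
    (by simp [List.count_cons, n1, n1.symm, n2, n2.symm, n3, n3.symm, n4, n4.symm, n5, n5.symm,
      n6, n6.symm, hy, hT, hY, hS])
    (fun e he => by
      simp only [List.mem_cons, List.not_mem_nil, or_false, not_or] at he; simp [he])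
    (by simp [n1, n1.symm, n2, n2.symm, n3, n3.symm, n4, n4.symm, n5, n5.symm, n6, n6.symm, hH1])
    (by simp [n1, n1.symm, n2, n2.symm, n3, n3.symm, n4, n4.symm, n5, n5.symm, n6, n6.symm, h1,
      h2])
    (by
      simp only [sub_cons, sub_nil, if_true, List.append_nil, n1, n1.symm, n2, n2.symm, n3,
        n3.symm, n4, n4.symm, n5, n5.symm, n6, n6.symm, if_false]
      exact ProperFac.of_append (p := [.x 1 1]) (q := []) (by simpa using hG))
  simp only [List.mem_cons, List.not_mem_nil, or_false, forall_eq_or_imp, forall_eq,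
    List.count_cons, List.count_nil, beq_iff_eq, n1, n1.symm, n2, n2.symm, n3, n3.symm, n4,
    n4.symm, n5, n5.symm, n6, n6.symm, if_true, if_false] at hc
  obtain ⟨hvy, hvT, hvY, hvS, -⟩ := hc
  rw [← sublist_drop_zero] at hs
  obtain ⟨p1, q1, g1, hs⟩ := exists_of_sublist_drop_cons hs
  obtain ⟨p2, q2, g2, hs⟩ := exists_of_sublist_drop_cons hs
  obtain ⟨p3, q3, g3, hs⟩ := exists_of_sublist_drop_cons hs
  obtain ⟨p4, q4, g4, hs⟩ := exists_of_sublist_drop_cons hs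
  obtain ⟨p5, q5, g5, hs⟩ := exists_of_sublist_drop_cons hs
  obtain ⟨p6, q6, g6, -⟩ := exists_of_sublist_drop_cons hs
  have := fst_lst_eq (by omega) (by omega) g1 g6
  have := fst_lst_eq (by omega) (by omega) g3 g5
  omega

/-- The order of the last occurrences of two letters is preserved if there are letters `T` and `S`
occurring once, `T` between the two first occurrences, and `S` between the first and the last
occurrences. -/
theorem DerT.lst_lt_of_separated (hn : 2 ≤ n) (h : DerT n u v) (hx : u.count x = 2)
    (hT : u.count T = 1) (hY : u.count Y = 2) (hS : u.count S = 1)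
    (o : (fst u x < fst u T ∧ fst u T < fst u Y) ∨ (fst u Y < fst u T ∧ fst u T < fst u x))
    (o1 : fst u x < fst u S) (o2 : fst u Y < fst u S) (o3 : fst u S < lst u x)
    (o4 : lst u x < lst u Y) : lst v x < lst v Y := by
  rcases o with ⟨o6, o7⟩ | ⟨o6, o7⟩
  · exact h.pattern_xTYSxY hn hx hT hY hS o6 o7 o2 o3 o4
  · exact h.pattern_yTYSYy hn hY hT hx hS o6 o7 o1 o3 o4

end Patterns
/-! ### Letters that do not belong to the copy of `w_ξ` -/

/-- The two sides of a derivable identity, each with a copy of some `w_ξ` as a subword, in which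
the letter `c` of `w_ξ` is played by `X c`. In `v`, this copy contains no foreign letters inside
the block from `a₁` to `bₙ` and inside the block `r`: these blocks start at the positions `i` and
`j` in `pos_right`. -/
structure Reduced (n : ℕ) (u v : List Letter) (X : Letter → Letter) : Prop where
  two_le : 2 ≤ n
  der : DerT n u v
  count_dbl : ∀ c, InW n c → Dbl c → u.count (X c) = 2 ∧ v.count (X c) = 2
  count_lin : ∀ c, InW n c → ¬ Dbl c → u.count (X c) = 1
  pos_left : ∃ (ζ : ℕ → Bool) (P : ℕ → ℕ), (∀ k l, k < l → l < 20 * n + 8 → P k < P l) ∧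
    ∀ c k, Occ n ζ c k → u[P k]? = some (X c)
  pos_right : ∃ (ε : ℕ → Bool) (i j : ℕ), i + 4 * n + 2 ≤ j ∧
    (∀ c k, k < 4 * n + 2 → Occ n ε c (6 * n + k) → v[i + k]? = some (X c)) ∧
    (∀ c k, Occ n ε c (12 * n + 5 + k) → v[j + k]? = some (X c)) ∧
    ∀ c, InW n c → Dbl c → ∃ m < j, v[m]? = some (X c)

namespace Reduced

variable {n : ℕ} {u v : List Letter} {X : Letter → Letter}

/-- The letter `f` is not one of the letters of the copy of `w_ξ` that occur twice. -/
def Foreign (n : ℕ) (X : Letter → Letter) (f : Letter) : Prop :=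
  ∀ c, InW n c → Dbl c → f ≠ X c

theorem foreign_of_count (H : Reduced n u v X) {f : Letter} (hf : u.count f = 1) :
    Foreign n X f := by
  rintro c hc hd rfl
  have := (H.count_dbl c hc hd).1
  omega

theorem inW_of_occ {c : Letter} {ε : ℕ → Bool} {p : ℕ} (h : Occ n ε c p) : InW n c :=
  (inW_iff_occ ε).2 ⟨p, h⟩

theorem inW_a : InW n .a := inW_of_occ (ε := fun _ => false) (p := 7 * n) (by simp [Occ])
theorem inW_b : InW n .b := inW_of_occ (ε := fun _ => false) (p := 9 * n + 1) (by simp [Occ])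
theorem inW_t : InW n .t := inW_of_occ (ε := fun _ => false) (p := 12 * n + 4) (by simp [Occ])
theorem inW_s {k : ℕ} (h : k ≤ n) : InW n (.s k) :=
  inW_of_occ (ε := fun _ => false) (p := 10 * n + 2 + 2 * k) (by simp [Occ, h])
theorem inW_y {k : ℕ} (h : k ≤ n) : InW n (.y k) :=
  inW_of_occ (ε := fun _ => false) (p := 12 * n + 8 * k + 6) (by simp [Occ, h])
theorem inW_aI {k : ℕ} (h1 : 1 ≤ k) (h : k ≤ n) : InW n (.aI k) :=
  inW_of_occ (ε := fun _ => false) (p := 12 * n + 8 * k + 1) (by simp [Occ, h, h1])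
theorem inW_bI {k : ℕ} (h1 : 1 ≤ k) (h : k ≤ n) : InW n (.bI k) :=
  inW_of_occ (ε := fun _ => false) (p := 12 * n + 8 * k + 3) (by simp [Occ, h, h1])

/-- The order of the relevant letters of the copy of `w_ξ` in `u`. -/
theorem left_order (H : Reduced n u v X) :
    fst u (X (.aI 1)) < fst u (X .a) ∧ fst u (X .a) < fst u (X .b) ∧
    fst u (X .b) < fst u (X (.bI n)) ∧ fst u (X (.bI n)) < fst u (X (.s 0)) ∧
    fst u (X (.s 0)) < fst u (X (.y 0)) ∧ fst u (X (.y 0)) < fst u (X (.y n)) ∧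
    fst u (X (.y n)) < fst u (X .t) ∧ fst u (X .t) < lst u (X .b) ∧
    lst u (X .b) < lst u (X (.y 0)) ∧ lst u (X (.y 0)) < lst u (X (.aI 1)) ∧
    lst u (X (.y 0)) < lst u (X (.bI n)) ∧ lst u (X (.aI 1)) < lst u (X (.y n)) ∧
    lst u (X (.bI n)) < lst u (X (.y n)) ∧ lst u (X (.y n)) < lst u (X .a) := by
  have hn := H.two_le
  obtain ⟨ζ, P, hP, hX⟩ := H.pos_left
  have key : ∀ c k l, InW n c → Dbl c → Occ n ζ c k → Occ n ζ c l → k < l →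
      fst u (X c) = P k ∧ lst u (X c) = P l := fun c k l hc hd hk hl hkl =>
    fst_lst_eq (H.count_dbl c hc hd).1.le (hP k l hkl hl.lt) (hX _ _ hk) (hX _ _ hl)
  have key1 : ∀ c k, InW n c → ¬ Dbl c → Occ n ζ c k → fst u (X c) = P k := fun c k hc hd hk =>
    fst_eq_of_count_one (H.count_lin c hc hd) (hX _ _ hk)
  have h1 := key (.aI 1) (6 * n) (12 * n + 9) (inW_aI le_rfl (by omega)) trivial
    (by simp [Occ]; omega) (by simp [Occ]; omega) (by omega)
  have h2 := key .a (7 * n) (20 * n + 7) inW_a trivial (by simp [Occ]) (by simp [Occ]) (by omega)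
  have h3 := key .b (9 * n + 1) (12 * n + 5) inW_b trivial (by simp [Occ]) (by simp [Occ])
    (by omega)
  have h4 := key (.bI n) (10 * n + 1) (20 * n + 3) (inW_bI (by omega) le_rfl) trivial
    (by simp only [Occ]; omega) (by simp only [Occ]; omega) (by omega)
  have h5 := key (.y 0) (10 * n + 3) (12 * n + 6) (inW_y (by omega)) trivial
    (by simp [Occ]) (by simp [Occ]) (by omega)
  have h6 := key (.y n) (12 * n + 3) (20 * n + 6) (inW_y le_rfl) trivial
    (by simp only [Occ]; omega) (by simp only [Occ]; omega) (by omega)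
  have h7 := key1 (.s 0) (10 * n + 2) (inW_s (by omega)) id (by simp [Occ])
  have h8 := key1 .t (12 * n + 4) inW_t id (by simp [Occ])
  rw [h1.1, h1.2, h2.1, h2.2, h3.1, h3.2, h4.1, h4.2, h5.1, h5.2, h6.1, h6.2, h7, h8]
  refine ⟨?_, ?_, ?_, ?_, ?_, ?_, ?_, ?_, ?_, ?_, ?_, ?_, ?_, ?_⟩ <;>
    exact hP _ _ (by omega) (by omega)

/-- The order of the relevant letters of the copy of `w_ξ` in `v`. -/
theorem right_order (H : Reduced n u v X) :
    fst v (X (.aI 1)) < fst v (X .a) ∧ fst v (X .a) < fst v (X .b) ∧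
    fst v (X .b) < fst v (X (.bI n)) ∧ fst v (X (.bI n)) < lst v (X .b) ∧
    lst v (X .b) < lst v (X (.y 0)) ∧ lst v (X (.y 0)) < lst v (X (.aI 1)) ∧
    lst v (X (.y 0)) < lst v (X (.bI n)) ∧ lst v (X (.aI 1)) < lst v (X (.y n)) ∧
    lst v (X (.bI n)) < lst v (X (.y n)) ∧ lst v (X (.y n)) < lst v (X .a) ∧
    ∀ f i, Foreign n X f → v[i]? = some f →
      (i < fst v (X (.aI 1)) ∨ fst v (X (.bI n)) < i) ∧
      (i < lst v (X .b) ∨ lst v (X .a) < i) := by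
  have hn := H.two_le
  obtain ⟨ε, i, j, hij, hA, hR, hm⟩ := H.pos_right
  have key : ∀ c k l, InW n c → Dbl c → k < 4 * n + 2 → Occ n ε c (6 * n + k) →
      Occ n ε c (12 * n + 5 + l) → fst v (X c) = i + k ∧ lst v (X c) = j + l :=
    fun c k l hc hd hk h1 h2 =>
    fst_lst_eq (H.count_dbl c hc hd).2.le (by omega) (hA _ _ hk h1) (hR _ _ h2)
  have h1 := key (.aI 1) 0 4 (inW_aI le_rfl (by omega)) trivial (by omega)
    (by simp [Occ]; omega) (by simp [Occ]; omega)
  have h2 := key .a n (8 * n + 2) inW_a trivial (by omega) (by simp [Occ]; omega)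
    (by simp [Occ]; omega)
  have h3 := key .b (3 * n + 1) 0 inW_b trivial (by omega) (by simp [Occ]; omega) (by simp [Occ])
  have h4 := key (.bI n) (4 * n + 1) (8 * n - 2) (inW_bI (by omega) le_rfl) trivial (by omega)
    (by simp only [Occ]; omega) (by simp only [Occ]; omega)
  have keyR : ∀ c l, InW n c → Dbl c → Occ n ε c (12 * n + 5 + l) → lst v (X c) = j + l := by
    intro c l hc hd h2
    obtain ⟨m, hmj, hm⟩ := hm c hc hd
    exact (fst_lst_eq (H.count_dbl c hc hd).2.le (by omega) hm (hR _ _ h2)).2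
  have h5 := keyR (.y 0) 1 (inW_y (by omega)) trivial (by simp [Occ])
  have h6 := keyR (.y n) (8 * n + 1) (inW_y le_rfl) trivial (by simp only [Occ]; omega)
  rw [h1.1, h1.2, h2.1, h2.2, h3.1, h3.2, h4.1, h4.2, h5, h6]
  refine ⟨?_, ?_, ?_, ?_, ?_, ?_, ?_, ?_, ?_, ?_, fun f m hf hm => ⟨?_, ?_⟩⟩
  any_goals omega
  · by_contra! hcon
    obtain ⟨c, -, hc⟩ := exists_getElem?_wl_occ n ε (6 * n + (m - i)) (by omega)
    have := hA c (m - i) (by omega) hc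
    rw [show i + (m - i) = m by omega, hm] at this
    exact hf c (inW_of_occ hc) (hc.dbl (by omega)) (Option.some.inj this)
  · by_contra! hcon
    obtain ⟨c, -, hc⟩ := exists_getElem?_wl_occ n ε (12 * n + 5 + (m - j)) (by omega)
    have := hR c (m - j) hc
    rw [show j + (m - j) = m by omega, hm] at this
    exact hf c (inW_of_occ hc) (hc.dbl (by omega)) (Option.some.inj this)

theorem derT (H : Reduced n u v X) : DerT n v u := H.der.symm

/-- A letter occurring once does not stand between `a₁` and `bₙ`. -/
theorem count_ne_one_of_left (H : Reduced n u v X) {f : Letter}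
    (h1 : fst u (X (.aI 1)) < fst u f) (h2 : fst u f < fst u (X (.bI n))) : u.count f ≠ 1 := by
  intro hf
  have hn := H.two_le
  have L := H.left_order
  have R := H.right_order
  have cA := H.count_dbl (.aI 1) (inW_aI le_rfl (by omega)) trivial
  have cB := H.count_dbl (.bI n) (inW_bI (by omega) le_rfl) trivial
  obtain ⟨-, hf', o1, o2⟩ := H.der.split_pattern hn cA.1 hf h1 (by omega)
  have z := R.2.2.2.2.2.2.2.2.2.2 f _ (H.foreign_of_count hf)
    (getElem?_fst (mem_of_count hf'))
  obtain ⟨-, -, o3, o4⟩ := H.derT.split_pattern hn cB.2 hf' (by omega) (by omega)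
  omega

/-- A letter occurring once does not stand inside the block `r`. -/
theorem count_ne_one_of_right (H : Reduced n u v X) {f : Letter}
    (h1 : lst u (X .b) < fst u f) (h2 : fst u f < lst u (X .a)) : u.count f ≠ 1 := by
  intro hf
  have hn := H.two_le
  have L := H.left_order
  have R := H.right_order
  have cA := H.count_dbl .a inW_a trivial
  have cB := H.count_dbl .b inW_b trivial
  obtain ⟨-, hf', o1, o2⟩ := H.der.split_pattern hn cA.1 hf (by omega) (by omega)
  have z := R.2.2.2.2.2.2.2.2.2.2 f _ (H.foreign_of_count hf)
    (getElem?_fst (mem_of_count hf'))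
  obtain ⟨-, -, o3, o4⟩ := H.derT.split_pattern hn cB.2 hf' (by omega) (by omega)
  omega

/-- A letter occurring once that stands between the two rigid blocks of `u` also stands between
those of `v`. -/
theorem fst_right_of_separator (H : Reduced n u v X) {τ : Letter} (hτ : u.count τ = 1)
    (h1 : fst u (X (.bI n)) < fst u τ) (h2 : fst u τ < lst u (X .b)) :
    v.count τ = 1 ∧ fst v (X (.bI n)) < fst v τ ∧ fst v τ < lst v (X .b) := by
  have hn := H.two_le
  have L := H.left_order
  have R := H.right_order
  have cA := H.count_dbl .a inW_a trivial
  have cB := H.count_dbl .b inW_b trivial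
  obtain ⟨-, hτ', o1, o2⟩ := H.der.split_pattern hn cA.1 hτ (by omega) (by omega)
  obtain ⟨-, -, o3, o4⟩ := H.der.split_pattern hn cB.1 hτ (by omega) (by omega)
  have z := R.2.2.2.2.2.2.2.2.2.2 τ _ (H.foreign_of_count hτ)
    (getElem?_fst (mem_of_count hτ'))
  exact ⟨hτ', by omega, by omega⟩

/-- If a foreign letter occurring twice has its first occurrence between `a₁` and `bₙ`, then no
letter occurring once separates its two occurrences. -/
theorem not_split_of_left (H : Reduced n u v X) {f τ : Letter} (hF : Foreign n X f)
    (h1 : fst u (X (.aI 1)) < fst u f) (h2 : fst u f < fst u (X (.bI n)))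
    (hf : u.count f = 2) (hτ : u.count τ = 1) (o1 : fst u f < fst u τ)
    (o2 : fst u τ < lst u f) : False := by
  have hn := H.two_le
  have L := H.left_order
  have R := H.right_order
  have Z := R.2.2.2.2.2.2.2.2.2.2
  have cA1 := H.count_dbl (.aI 1) (inW_aI le_rfl (by omega)) trivial
  have cBn := H.count_dbl (.bI n) (inW_bI (by omega) le_rfl) trivial
  have cY0 := H.count_dbl (.y 0) (inW_y (by omega)) trivial
  have cYn := H.count_dbl (.y n) (inW_y le_rfl) trivial
  have cS := H.count_lin .t inW_t id
  have cT := H.count_lin (.s 0) (inW_s (by omega)) id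
  have ne_pos : ∀ {c} {i j : ℕ}, InW n c → Dbl c → u[i]? = some f → u[j]? = some (X c) → i ≠ j := by
    rintro c i j hc hd hi hj rfl
    rw [hi] at hj
    exact hF c hc hd (Option.some.inj hj)
  have gl := getElem?_lst (mem_of_count hf)
  have hτ0 : fst u (X (.bI n)) < fst u τ := by
    by_contra! hle
    refine H.count_ne_one_of_left (f := τ) (by omega) (lt_of_le_of_ne hle fun he => ?_) hτ
    have e1 := getElem?_fst (mem_of_count hτ)
    rw [he, getElem?_fst (mem_of_count cBn.1)] at e1
    have := (Option.some.inj e1)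
    rw [← this] at hτ; omega
  have nt : lst u f ≠ fst u (X .t) := by
    intro he
    have e1 := getElem?_fst (mem_of_count cS)
    rw [← he, gl] at e1
    rw [Option.some.inj e1] at hf; omega
  have sS := H.fst_right_of_separator cS (by omega) (by omega)
  obtain ⟨hf', -⟩ := H.der.split_pattern hn hf hτ o1 o2
  have zf := Z f _ hF (getElem?_fst (mem_of_count hf'))
  have zl := Z f _ hF (getElem?_lst (mem_of_count hf'))
  rcases nt.lt_or_gt with hlt | hgt
  · -- the second occurrence comes before `t`
    have P1 := H.der.pattern_xyτxSy (x := f) (y := X (.bI n)) (τ := τ) (S := X .t) hn hf cBn.1 hτ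
      cS (by omega) (by omega) (by omega) (by omega) (by omega)
    have P2 := H.derT.pattern_xyτxSy (x := f) (y := X (.aI 1)) (τ := τ) (S := X .t) hn hf' cA1.2
      (H.der.count_one hn hτ) sS.1 (by omega) (by omega) (by omega) (by omega) (by omega)
    omega
  · have hT' := H.der.count_one hn cT
    have hlY0 : lst u f ≠ lst u (X (.y 0)) :=
      ne_pos (inW_y (by omega)) trivial gl (getElem?_lst (mem_of_count cY0.1))
    have hlYn : lst u f ≠ lst u (X (.y n)) :=
      ne_pos (inW_y le_rfl) trivial gl (getElem?_lst (mem_of_count cYn.1))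
    rcases hlY0.lt_or_gt with hl0 | hl0
    · -- the second occurrence comes before that of `y₀`
      have P1 := H.der.pattern_xyTYSxYy (x := f) (y := X (.bI n)) (T := X (.s 0)) (Y := X (.y 0))
        (S := X .t) hn hf cBn.1 cT cY0.1 cS (by omega) (by omega) (by omega) (by omega) (by omega)
        (by omega) (by omega)
      have P2 := H.derT.pattern_xyTYSxYy (x := f) (y := X (.aI 1)) (T := X (.s 0)) (Y := X (.y 0))
        (S := X .t) hn hf' cA1.2 hT' cY0.2 sS.1 (by omega) (by omega) (by omega) (by omega)
        (by omega) (by omega) (by omega)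
      omega
    · -- the second occurrence comes after that of `y₀`, hence, in `v`, after the block `r`
      have P0 := H.der.lst_lt_of_separated (x := X (.y 0)) (Y := f) (T := X (.s 0)) (S := X .t) hn
        cY0.1 cT hf cS (Or.inr ⟨by omega, by omega⟩) (by omega) (by omega) (by omega) hl0
      have hn' : lst u (X (.y n)) < lst u f := by
        by_contra! hle
        have P3 := H.der.lst_lt_of_separated (x := f) (Y := X (.y n)) (T := X (.s 0)) (S := X .t)
          hn hf cT cYn.1 cS (Or.inl ⟨by omega, by omega⟩) (by omega) (by omega) (by omega)
          (by omega)
        omega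
      have P1 := H.der.pattern_xyTYSxYy (x := X (.aI 1)) (y := f) (T := X (.s 0)) (Y := X (.y n))
        (S := X .t) hn cA1.1 hf cT cYn.1 cS (by omega) (by omega) (by omega) (by omega) (by omega)
        (by omega) (by omega)
      have P2 := H.derT.pattern_xyTYSxYy (x := X (.bI n)) (y := f) (T := X (.s 0)) (Y := X (.y n))
        (S := X .t) hn cBn.2 hf' hT' cYn.2 sS.1 (by omega) (by omega) (by omega) (by omega)
        (by omega) (by omega) (by omega)
      omega

/-- If a foreign letter occurring twice has its second occurrence inside the block `r`, and its
first occurrence separated from it by a letter occurring once, then its second occurrence is next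
to one of the ends `b`, `a` of this block, and no letter occurring once separates the first
occurrences of it and this end letter. -/
theorem unseparated_of_right (H : Reduced n u v X) {f τ : Letter} (hF : Foreign n X f)
    (h1 : lst u (X .b) < lst u f) (h2 : lst u f < lst u (X .a))
    (hf : u.count f = 2) (hτ : u.count τ = 1) (o1 : fst u f < fst u τ)
    (o2 : fst u τ < lst u f) :
    (lst u f < lst u (X (.y 0)) ∧ ∀ T, u.count T = 1 →
      ¬ (fst u f < fst u T ∧ fst u T < fst u (X .b)) ∧
      ¬ (fst u (X .b) < fst u T ∧ fst u T < fst u f)) ∨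
    (lst u (X (.y n)) < lst u f ∧ ∀ T, u.count T = 1 →
      ¬ (fst u f < fst u T ∧ fst u T < fst u (X .a)) ∧
      ¬ (fst u (X .a) < fst u T ∧ fst u T < fst u f)) := by
  have hn := H.two_le
  have L := H.left_order
  have R := H.right_order
  have Z := R.2.2.2.2.2.2.2.2.2.2
  have ca := H.count_dbl .a inW_a trivial
  have cb := H.count_dbl .b inW_b trivial
  have cY0 := H.count_dbl (.y 0) (inW_y (by omega)) trivial
  have cYn := H.count_dbl (.y n) (inW_y le_rfl) trivial
  have cS := H.count_lin .t inW_t id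
  have cT := H.count_lin (.s 0) (inW_s (by omega)) id
  have ne_pos : ∀ {c} {i j : ℕ}, InW n c → Dbl c → u[i]? = some f → u[j]? = some (X c) → i ≠ j := by
    rintro c i j hc hd hi hj rfl
    rw [hi] at hj
    exact hF c hc hd (Option.some.inj hj)
  have gl := getElem?_lst (mem_of_count hf)
  have gf := getElem?_fst (mem_of_count hf)
  have hτ0 : fst u τ < lst u (X .b) := by
    by_contra! hle
    refine H.count_ne_one_of_right (f := τ) (lt_of_le_of_ne hle fun he => ?_) (by omega) hτ
    have e1 := getElem?_fst (mem_of_count hτ)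
    rw [← he, getElem?_lst (mem_of_count cb.1)] at e1
    have := (Option.some.inj e1)
    rw [← this] at hτ; omega
  have nt : fst u f ≠ fst u (X .t) := by
    intro he
    have e1 := getElem?_fst (mem_of_count cS)
    rw [← he, gf] at e1
    rw [Option.some.inj e1] at hf; omega
  have ns : fst u f ≠ fst u (X (.s 0)) := by
    intro he
    have e1 := getElem?_fst (mem_of_count cT)
    rw [← he, gf] at e1
    rw [Option.some.inj e1] at hf; omega
  -- a letter `S` occurring once, after the first occurrences and before the block `r`
  obtain ⟨S, hS, S1, S2, S3⟩ : ∃ S, u.count S = 1 ∧ fst u (X .t) ≤ fst u S ∧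
      fst u S < lst u (X .b) ∧ fst u f < fst u S := by
    rcases nt.lt_or_gt with h | h
    · exact ⟨X .t, cS, le_rfl, by omega, h⟩
    · exact ⟨τ, hτ, by omega, hτ0, o1⟩
  have sS := H.fst_right_of_separator hS (by omega) (by omega)
  obtain ⟨hf', -, -, f2⟩ := H.der.split_pattern hn hf hS S3 (by omega)
  have zl := Z f _ hF (getElem?_lst (mem_of_count hf'))
  have nb : lst u f ≠ lst u (X .b) := ne_pos inW_b trivial gl (getElem?_lst (mem_of_count cb.1))
  have na : lst u f ≠ lst u (X .a) := ne_pos inW_a trivial gl (getElem?_lst (mem_of_count ca.1))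
  have n0 : lst u f ≠ lst u (X (.y 0)) :=
    ne_pos (inW_y (by omega)) trivial gl (getElem?_lst (mem_of_count cY0.1))
  have nn : lst u f ≠ lst u (X (.y n)) :=
    ne_pos (inW_y le_rfl) trivial gl (getElem?_lst (mem_of_count cYn.1))
  -- being before, or after, a letter of the block from which `f` is separated
  have before : ∀ e, u.count e = 2 → fst u e < fst u S → fst u S < lst u e →
      (∃ T, u.count T = 1 ∧ ((fst u f < fst u T ∧ fst u T < fst u e) ∨
        (fst u e < fst u T ∧ fst u T < fst u f))) → lst u f < lst u e → lst v f < lst v e := by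
    rintro e he e1 e2 ⟨T, hT, o⟩ hlt
    exact H.der.lst_lt_of_separated hn hf hT he hS o (by omega) (by omega) (by omega) hlt
  have after : ∀ e, u.count e = 2 → fst u e < fst u S → fst u S < lst u e →
      (∃ T, u.count T = 1 ∧ ((fst u f < fst u T ∧ fst u T < fst u e) ∨
        (fst u e < fst u T ∧ fst u T < fst u f))) → lst u e < lst u f → lst v e < lst v f := by
    rintro e he e1 e2 ⟨T, hT, o⟩ hlt
    exact H.der.lst_lt_of_separated hn he hT hf hS o.symm (by omega) (by omega) (by omega) hlt
  -- `f` is separated from at least one of `a` and `yₙ`, and from at least one of `b` and `y₀`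
  have hbefore : lst u f < lst u (X (.y n)) → lst v f < lst v (X .b) := by
    intro hlt
    have : lst v f < lst v (X .a) := by
      rcases ns.lt_or_gt with h | h
      · have := before (X (.y n)) cYn.1 (by omega) (by omega)
          ⟨_, cT, Or.inl ⟨h, by omega⟩⟩ hlt
        omega
      · exact before (X .a) ca.1 (by omega) (by omega) ⟨_, cT, Or.inr ⟨by omega, h⟩⟩ h2
    omega
  have hafter : lst u (X (.y 0)) < lst u f → lst v (X .a) < lst v f := by
    intro hlt
    have : lst v (X .b) < lst v f := by
      rcases ns.lt_or_gt with h | h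
      · have := after (X (.y 0)) cY0.1 (by omega) (by omega)
          ⟨_, cT, Or.inl ⟨h, by omega⟩⟩ hlt
        omega
      · exact after (X .b) cb.1 (by omega) (by omega) ⟨_, cT, Or.inr ⟨by omega, h⟩⟩ h1
    omega
  rcases n0.lt_or_gt with h0 | h0
  · refine Or.inl ⟨h0, fun T hT => ?_⟩
    have hb := hbefore (by omega)
    constructor <;> intro hcon
    · have := after (X .b) cb.1 (by omega) (by omega) ⟨T, hT, Or.inl hcon⟩ h1
      omega
    · have := after (X .b) cb.1 (by omega) (by omega) ⟨T, hT, Or.inr hcon⟩ h1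
      omega
  · have ha := hafter h0
    have hlt : lst u (X (.y n)) < lst u f := by
      by_contra! hle
      have := hbefore (by omega)
      omega
    refine Or.inr ⟨hlt, fun T hT => ?_⟩
    constructor <;> intro hcon
    · have := before (X .a) ca.1 (by omega) (by omega) ⟨T, hT, Or.inl hcon⟩ h2
      omega
    · have := before (X .a) ca.1 (by omega) (by omega) ⟨T, hT, Or.inr hcon⟩ h2
      omega

end Reduced
/-! ### Moving foreign letters out of the rigid blocks -/

/-- The letters at the even places of `r` have their first occurrence in `p` or `q`, next to a
letter that occurs only once. -/
theorem Occ.neighbour_of_even {n : ℕ} {η : ℕ → Bool} {c : Letter} {k p : ℕ}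
    (hc : Occ n η c k) (hk : 12 * n + 4 < k) (hk2 : k % 2 = 0) (hp : Occ n η c p)
    (hp' : p < 12 * n + 4) :
    ∃ r e, Occ n η e r ∧ ¬ Dbl e ∧ ((r = p + 1 ∧ r < 6 * n) ∨ (p = r + 1 ∧ 10 * n + 2 ≤ r)) := by
  rcases c with _ | _ | _ | k | k | k | k | k | k | k | k | k | k | ⟨j, k⟩ <;>
  (try fin_cases j) <;>
  simp only [Occ, Fin.mk_zero, Fin.mk_one, Fin.zero_eta, Fin.isValue] at hc hp <;>
  (try (exfalso; omega))
  · exact ⟨p - 1, .s k, by simp only [Occ]; omega, id, by omega⟩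
  · exact ⟨p + 1, .tI k, by simp only [Occ]; omega, id, by omega⟩
  · exact ⟨p + 1, .tP k, by simp only [Occ]; omega, id, by omega⟩
  · exact ⟨p + 1, .tPP k, by simp only [Occ]; omega, id, by omega⟩

theorem Occ.bounds_of_odd {n : ℕ} {η : ℕ → Bool} {c : Letter} {k p : ℕ}
    (hc : Occ n η c k) (hk : 12 * n + 4 < k) (hk2 : k % 2 = 1) (hp : Occ n η c p)
    (hp' : p < 12 * n + 4) : 6 * n ≤ p ∧ p < 10 * n + 2 := by
  have hε : ∀ k, (η k).toNat ≤ 1 := fun k => Bool.toNat_le _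
  rcases c with _ | _ | _ | k | k | k | k | k | k | k | k | k | k | ⟨j, k⟩ <;>
  (try fin_cases j) <;>
  simp only [Occ, Fin.mk_zero, Fin.mk_one, Fin.zero_eta, Fin.isValue] at hc hp <;>
  first
  | omega
  | (have := hε k; omega)

/-- The first occurrences of two consecutive letters of the suffix `r` are separated by a letter
that occurs only once. -/
theorem Occ.exists_separator {n : ℕ} {η : ℕ → Bool} {c d : Letter} {k p q : ℕ}
    (hc : Occ n η c k) (hd : Occ n η d (k + 1)) (hk : 12 * n + 4 < k) (hp : Occ n η c p)
    (hq : Occ n η d q) (hp' : p < 12 * n + 4) (hq' : q < 12 * n + 4) :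
    ∃ r e, Occ n η e r ∧ ¬ Dbl e ∧ ((p < r ∧ r < q) ∨ (q < r ∧ r < p)) := by
  rcases Nat.mod_two_eq_zero_or_one k with h | h
  · obtain ⟨r, e, he, hd', hr⟩ := hc.neighbour_of_even hk h hp hp'
    have := hd.bounds_of_odd (by omega) (by omega) hq hq'
    exact ⟨r, e, he, hd', by omega⟩
  · obtain ⟨r, e, he, hd', hr⟩ := hd.neighbour_of_even (by omega) (by omega) hq hq'
    have := hc.bounds_of_odd hk h hp hp'
    exact ⟨r, e, he, hd', by omega⟩

section Adjacent

variable {n : ℕ} {χ : Letter → List Letter} {G m h : List Letter} {e f : Letter}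

theorem getElem?_append_cons_length (G : List Letter) (e : Letter) (h : List Letter) :
    (G ++ e :: h)[G.length]? = some e := by simp

theorem fst_append_cons (hG : e ∉ G) : fst (G ++ e :: h) e = G.length := by
  simp [fst, List.idxOf_append_of_notMem hG]

theorem exists_eq_append_cons_notMem (he : e ∈ G) : ∃ a b, G = a ++ e :: b ∧ e ∉ a :=
  List.eq_append_cons_of_mem he

theorem length_sub_mono {W a b c d : List Letter} (h1 : W = a ++ e :: b) (h2 : W = c ++ f :: d)
    (hl : a.length < c.length) : (sub χ a).length + (χ e).length ≤ (sub χ c).length := by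
  have hp : List.IsPrefix (a ++ [e]) c := by
    refine List.prefix_of_prefix_length_le (l₃ := W) ⟨b, by simp [h1]⟩ ⟨f :: d, h2.symm⟩ ?_
    simpa using hl
  obtain ⟨r, rfl⟩ := hp
  simp [add_assoc]

/-- If two letters are not erased, the second occurrence of one following that of the other up to
erased letters, then their first occurrences are separated by a letter occurring once. -/
theorem Fac.exists_separator (H : Fac n (sub χ (G ++ e :: (m ++ f :: h)))) (he : e ∈ G)
    (hf : f ∈ G) (he0 : χ e ≠ []) (hf0 : χ f ≠ []) (hm : sub χ m = []) :
    ∃ T, (G ++ e :: (m ++ f :: h)).count T = 1 ∧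
      ((fst (G ++ e :: (m ++ f :: h)) e < fst (G ++ e :: (m ++ f :: h)) T ∧
        fst (G ++ e :: (m ++ f :: h)) T < fst (G ++ e :: (m ++ f :: h)) f) ∨
      (fst (G ++ e :: (m ++ f :: h)) f < fst (G ++ e :: (m ++ f :: h)) T ∧
        fst (G ++ e :: (m ++ f :: h)) T < fst (G ++ e :: (m ++ f :: h)) e)) := by
  obtain ⟨η, g, h', H⟩ := H
  obtain ⟨a1, b1, hG1, ha1⟩ := exists_eq_append_cons_notMem he
  obtain ⟨a2, b2, hG2, ha2⟩ := exists_eq_append_cons_notMem hf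
  set W := G ++ e :: (m ++ f :: h) with hW
  have hW1 : W = a1 ++ e :: (b1 ++ e :: (m ++ f :: h)) := by rw [hW, hG1]; simp
  have hW2 : W = a2 ++ f :: ((b2 ++ e :: m) ++ f :: h) := by rw [hW, hG2]; simp
  obtain ⟨c, hc, -, oc, oc', ltc, ltc'⟩ := match_double H hW1 he0
  obtain ⟨d, hd, -, od, od', ltd, ltd'⟩ := match_double H hW2 hf0
  rw [← hG1] at oc' ltc'
  have e2 : (sub χ (a2 ++ f :: (b2 ++ e :: m))).length = (sub χ G).length + 1 := by
    have : a2 ++ f :: (b2 ++ e :: m) = G ++ e :: m := by rw [hG2]; simp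
    rw [this]; simp [hm, hc]
  rw [e2, ← add_assoc] at od'
  obtain ⟨r, l, ol, hl, hr⟩ := oc'.exists_separator od' ltc' oc od ltc ltd
  have hg : g.length ≤ r := by omega
  have hlen : r - g.length < (sub χ W).length := by
    have e1 : (sub χ G).length ≤ (sub χ W).length := by simp [hW]
    omega
  obtain ⟨a, T, b, j, hWT, hj, hrj⟩ := exists_of_lt_length_sub hlen
  have oT := occ_of_match H hWT (List.getElem?_eq_getElem hj)
  rw [add_assoc, ← hrj, Nat.add_sub_cancel' hg] at oT
  have hT0 : χ T ≠ [] := by rintro h0; simp [h0] at hj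
  have hT2 : ¬ 2 ≤ W.count T := by
    intro h2
    obtain ⟨a', b', d', hW'⟩ := two_le_count_iff.1 h2
    obtain ⟨c', hc', hd', -⟩ := match_double H hW' hT0
    have : (χ T)[j] = c' := by
      have hjj : j = 0 := by rw [hc'] at hj; simpa using hj
      subst hjj
      simp [hc']
    rw [this] at oT
    exact hl (ol.unique oT ▸ hd')
  have hT1 : 1 ≤ W.count T := by rw [hWT]; simp; omega
  refine ⟨T, by omega, ?_⟩
  have f1 : fst W e = a1.length := by rw [hW1]; exact fst_append_cons ha1
  have f2 : fst W f = a2.length := by rw [hW2]; exact fst_append_cons ha2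
  have f3 : fst W T = a.length :=
    fst_eq_of_count_one (by omega) (by rw [hWT]; exact getElem?_append_cons_length _ _ _)
  rw [f1, f2, f3]
  have ne1 : a.length ≠ a1.length := by
    intro h0
    have := (List.append_inj (hWT.symm.trans hW1) h0).2
    rw [List.cons.injEq] at this
    exact hT2 (this.1 ▸ two_le_count_iff.2 ⟨_, _, _, hW1⟩)
  have ne2 : a.length ≠ a2.length := by
    intro h0
    have := (List.append_inj (hWT.symm.trans hW2) h0).2
    rw [List.cons.injEq] at this
    exact hT2 (this.1 ▸ two_le_count_iff.2 ⟨_, _, _, hW2⟩)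
  have l1 : (χ e).length = 1 := by simp [hc]
  have l2 : (χ f).length = 1 := by simp [hd]
  have m1 : a.length < a1.length → r < g.length + (sub χ a1).length := fun h0 => by
    have := length_sub_mono (χ := χ) hWT hW1 h0; omega
  have m2 : a.length < a2.length → r < g.length + (sub χ a2).length := fun h0 => by
    have := length_sub_mono (χ := χ) hWT hW2 h0; omega
  have m3 : a1.length < a.length → g.length + (sub χ a1).length < r := fun h0 => by
    have := length_sub_mono (χ := χ) hW1 hWT h0; omega
  have m4 : a2.length < a.length → g.length + (sub χ a2).length < r := fun h0 => by
    have := length_sub_mono (χ := χ) hW2 hWT h0; omega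
  omega

end Adjacent

section Swap

variable {n : ℕ} {χ : Letter → List Letter} {K : Letter → Bool}

theorem sub_eq_sub_filter {x : List Letter} (h : ∀ e ∈ x, K e = false → χ e = []) :
    sub χ x = sub χ (x.filter K) := by
  induction x with
  | nil => rfl
  | cons e x ih =>
    have ih := ih fun f hf => h f (List.mem_cons_of_mem _ hf)
    cases hK : K e
    · simp [hK, ih, h e List.mem_cons_self hK]
    · simp [hK, ih]

/-- Rearranging a part of a word without changing its subwords formed by two classes of letters
gives an identity of the factor monoid if no substitution with a nonzero value keeps letters of
both classes. -/
theorem eq1_of_dichotomy {g x x' h : List Letter} (h1 : x.filter K = x'.filter K)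
    (h2 : (x.filter fun e => !K e) = x'.filter fun e => !K e)
    (hd : ∀ (χ : Letter → List Letter) (y : List Letter), y = x ∨ y = x' →
      Fac n (sub χ (g ++ y ++ h)) → ∀ e ∈ y, ∀ f ∈ y, K e = true → K f = false →
      χ e = [] ∨ χ f = []) : Eq1 n (g ++ x ++ h) (g ++ x' ++ h) := by
  have mem : ∀ e, e ∈ x ↔ e ∈ x' := by
    intro e
    cases hK : K e
    · have := congrArg (e ∈ ·) h2
      simpa [List.mem_filter, hK] using this
    · have := congrArg (e ∈ ·) h1
      simpa [List.mem_filter, hK] using this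
  intro χ hχ
  have hd' : ∀ e ∈ x, ∀ f ∈ x, K e = true → K f = false → χ e = [] ∨ χ f = [] := by
    rcases hχ with hχ | hχ
    · exact hd χ x (Or.inl rfl) hχ
    · intro e he f hf
      exact hd χ x' (Or.inr rfl) hχ e ((mem e).1 he) f ((mem f).1 hf)
  have key : sub χ x = sub χ x' := by
    by_cases hc : ∀ e ∈ x, K e = true → χ e = []
    · have h3 := sub_eq_sub_filter (χ := χ) (K := fun e => !K e) (x := x) (by simpa using hc)
      have h4 := sub_eq_sub_filter (χ := χ) (K := fun e => !K e) (x := x')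
        (by simpa using fun e he => hc e ((mem e).2 he))
      rw [h3, h4, h2]
    · push Not at hc
      obtain ⟨e, he, hKe, hne⟩ := hc
      have h3 : ∀ f ∈ x, K f = false → χ f = [] := fun f hf hKf =>
        (hd' e he f hf hKe hKf).resolve_left hne
      rw [sub_eq_sub_filter h3, h1,
        ← sub_eq_sub_filter (fun f hf => h3 f ((mem f).2 hf))]
  simp only [sub_append, key]

theorem exists_first_ne_nil {m : List Letter} (h : sub χ m ≠ []) :
    ∃ a f b, m = a ++ f :: b ∧ sub χ a = [] ∧ χ f ≠ [] := by
  induction m with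
  | nil => exact (h rfl).elim
  | cons e m ih =>
    by_cases he : χ e = []
    · obtain ⟨a, f, b, rfl, ha, hf⟩ := ih (by simpa [he] using h)
      exact ⟨e :: a, f, b, rfl, by simp [he, ha], hf⟩
    · exact ⟨[], e, m, rfl, rfl, he⟩

theorem exists_last_ne_nil {m : List Letter} (h : sub χ m ≠ []) :
    ∃ a f b, m = a ++ f :: b ∧ sub χ b = [] ∧ χ f ≠ [] := by
  induction m with
  | nil => exact (h rfl).elim
  | cons e m ih =>
    by_cases hm : sub χ m = []
    · exact ⟨[], e, m, rfl, hm, by simpa [hm] using h⟩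
    · obtain ⟨a, f, b, rfl, ha, hf⟩ := ih hm
      exact ⟨e :: a, f, b, rfl, ha, hf⟩

end Swap
section ListLemmas

variable {u G r a b a' b' : List Letter} {e l : Letter}

theorem fst_append_left (h : e ∈ G) : fst (G ++ r) e = fst G e :=
  List.idxOf_append_of_mem h

theorem append_cons_unique (h : u = a ++ l :: b) (h' : u = a' ++ l :: b') (hc : u.count l = 1) :
    a = a' ∧ b = b' := by
  have hl : a.length = a'.length := eq_of_count_one hc
    (by rw [h]; exact getElem?_append_cons_length _ _ _)
    (by rw [h']; exact getElem?_append_cons_length _ _ _)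
  obtain ⟨h1, h2⟩ := List.append_inj (h.symm.trans h') hl
  exact ⟨h1, (List.cons.inj h2).2⟩

theorem lst_eq_length (hc : u.count e = 2) (h : u = G ++ e :: r) (he : e ∈ G) :
    lst u e = G.length := by
  refine (fst_lst_eq hc.le (fst_lt_length he) ?_ ?_).2
  · rw [h, List.getElem?_append_left (fst_lt_length he)]; exact getElem?_fst he
  · rw [h]; exact getElem?_append_cons_length _ _ _

theorem fst_eq_length (hc : u.count e = 2) (h : u = G ++ e :: r) (he : e ∈ r) :
    fst u e = G.length := by
  refine (fst_lst_eq hc.le (j := G.length + 1 + fst r e) (by omega) ?_ ?_).1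
  · rw [h]; exact getElem?_append_cons_length _ _ _
  · rw [h, List.getElem?_append_right (by omega),
      show G.length + 1 + fst r e - G.length = fst r e + 1 by omega, List.getElem?_cons_succ]
    exact getElem?_fst he

theorem exists_pos_of_mem {x : List Letter} (h : u = G ++ x ++ r) (he : e ∈ x) :
    ∃ i, G.length ≤ i ∧ i < G.length + x.length ∧ u[i]? = some e := by
  have := fst_lt_length he
  refine ⟨G.length + fst x e, by omega, by omega, ?_⟩
  rw [h, List.append_assoc, List.getElem?_append_right (by omega), Nat.add_sub_cancel_left,
    List.getElem?_append_left (by omega)]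
  exact getElem?_fst he

end ListLemmas

/-- The word `u` of a reduced pair, cut at the ends of the two rigid blocks: `s₁` goes from `a₁` to
`bₙ`, and `m₁`, `s₂`, `m₂` are the parts of the block from `b` to `a` cut at `y₀` and `yₙ`.
The letters of the copy of `w_ξ` are marked by `K`. -/
structure Blocks (n : ℕ) (u v : List Letter) (X : Letter → Letter) (K : Letter → Bool)
    (α s₁ β m₁ s₂ m₂ γ : List Letter) : Prop where
  red : Reduced n u v X
  eq : u = α ++ s₁ ++ β ++ (X .b :: (m₁ ++ s₂ ++ m₂) ++ [X .a]) ++ γ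
  foreign : ∀ l, K l = false → Reduced.Foreign n X l
  marked : ∀ c, InW n c → K (X c) = true
  ends₁ : ∃ s, s₁ = X (.aI 1) :: (s ++ [X (.bI n)])
  ends₂ : ∃ s, s₂ = X (.y 0) :: (s ++ [X (.y n)])
  core₁ : ∀ l ∈ s₁, K l = true → l ∉ α ∧ l ∉ γ ∧ ∃ c, InW n c ∧ Dbl c ∧ l = X c
  core₂ : ∀ l ∈ s₂, K l = true → l ∉ γ ∧ ∃ c, InW n c ∧ Dbl c ∧ l = X c
  a_mem : X .a ∈ s₁
  b_mem : X .b ∈ s₁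
  bI_mem : X (.bI n) ∈ s₂
  y_zero_mem : X (.y 0) ∈ β
  y_last_mem : X (.y n) ∈ β
  gap₁ : ∀ l ∈ m₁, K l = false
  gap₂ : ∀ l ∈ m₂, K l = false

namespace Blocks

open Reduced

variable {n : ℕ} {u v : List Letter} {X : Letter → Letter} {K : Letter → Bool}
  {α s₁ β m₁ s₂ m₂ γ : List Letter} {χ : Letter → List Letter} {x y : List Letter} {e f : Letter}

theorem positions (H : Blocks n u v X K α s₁ β m₁ s₂ m₂ γ) :
    fst u (X (.aI 1)) = α.length ∧ fst u (X (.bI n)) + 1 = (α ++ s₁).length ∧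
    lst u (X .b) = (α ++ s₁ ++ β).length ∧
    lst u (X (.y 0)) = (α ++ s₁ ++ β).length + 1 + m₁.length ∧
    lst u (X (.y n)) = (α ++ s₁ ++ β).length + m₁.length + s₂.length ∧
    lst u (X .a) = (α ++ s₁ ++ β).length + 1 + m₁.length + s₂.length + m₂.length := by
  have hn := H.red.two_le
  obtain ⟨s, hs⟩ := H.ends₁
  obtain ⟨r, hr⟩ := H.ends₂
  refine ⟨?_, ?_, ?_, ?_, ?_, ?_⟩
  · rw [H.eq, hs]
    simp only [List.append_assoc, List.cons_append]
    exact fst_append_cons (H.core₁ _ (by rw [hs]; simp)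
      (H.marked _ (inW_aI le_rfl (by omega)))).1
  · have := fst_eq_length (H.red.count_dbl (.bI n) (inW_bI (by omega) le_rfl) trivial).1
      (G := α ++ X (.aI 1) :: s) (r := β ++ (X .b :: (m₁ ++ s₂ ++ m₂) ++ [X .a]) ++ γ)
      (by rw [H.eq, hs]; simp) (by simp [H.bI_mem])
    rw [this, hs]; simp; omega
  · exact lst_eq_length (H.red.count_dbl .b inW_b trivial).1
      (r := (m₁ ++ s₂ ++ m₂) ++ [X .a] ++ γ) (by rw [H.eq]; simp) (by simp [H.b_mem])
  · have := lst_eq_length (H.red.count_dbl (.y 0) (inW_y (by omega)) trivial).1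
      (G := α ++ s₁ ++ β ++ X .b :: m₁) (r := (r ++ [X (.y n)]) ++ m₂ ++ [X .a] ++ γ)
      (by rw [H.eq, hr]; simp) (by simp [H.y_zero_mem])
    rw [this]; simp; omega
  · have := lst_eq_length (H.red.count_dbl (.y n) (inW_y le_rfl) trivial).1
      (G := α ++ s₁ ++ β ++ X .b :: (m₁ ++ X (.y 0) :: r)) (r := m₂ ++ [X .a] ++ γ)
      (by rw [H.eq, hr]; simp) (by simp [H.y_last_mem])
    rw [this, hr]; simp; omega
  · have := lst_eq_length (H.red.count_dbl .a inW_a trivial).1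
      (G := α ++ s₁ ++ β ++ X .b :: (m₁ ++ s₂ ++ m₂)) (r := γ)
      (by rw [H.eq]; simp) (by simp [H.a_mem])
    rw [this]; simp; omega

theorem pos₁ (H : Blocks n u v X K α s₁ β m₁ s₂ m₂ γ) (hf : f ∈ s₁) (hK : K f = false) :
    ∃ i, u[i]? = some f ∧ fst u (X (.aI 1)) < i ∧ i < fst u (X (.bI n)) := by
  have hn := H.red.two_le
  obtain ⟨p1, p2, -⟩ := H.positions
  obtain ⟨i, hi1, hi2, hi⟩ := exists_pos_of_mem (u := u) (G := α)
    (r := β ++ (X .b :: (m₁ ++ s₂ ++ m₂) ++ [X .a]) ++ γ) (by rw [H.eq]; simp) hf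
  have c1 := H.red.count_dbl (.aI 1) (inW_aI le_rfl (by omega)) trivial
  have c2 := H.red.count_dbl (.bI n) (inW_bI (by omega) le_rfl) trivial
  have n1 : i ≠ fst u (X (.aI 1)) := by
    rintro rfl
    rw [getElem?_fst (mem_of_count c1.1)] at hi
    rw [← Option.some.inj hi, H.marked _ (inW_aI le_rfl (by omega))] at hK
    simp at hK
  have n2 : i ≠ fst u (X (.bI n)) := by
    rintro rfl
    rw [getElem?_fst (mem_of_count c2.1)] at hi
    rw [← Option.some.inj hi, H.marked _ (inW_bI (by omega) le_rfl)] at hK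
    simp at hK
  simp only [List.length_append] at p2
  exact ⟨i, hi, by omega, by omega⟩

theorem pos_m₁ (H : Blocks n u v X K α s₁ β m₁ s₂ m₂ γ) (hf : f ∈ m₁) :
    ∃ i, u[i]? = some f ∧ lst u (X .b) < i ∧ i < lst u (X .a) ∧ i < lst u (X (.y 0)) := by
  obtain ⟨-, -, p3, p4, p5, p6⟩ := H.positions
  obtain ⟨i, hi1, hi2, hi⟩ := exists_pos_of_mem (u := u) (G := α ++ s₁ ++ β ++ [X .b])
    (r := s₂ ++ m₂ ++ [X .a] ++ γ) (by rw [H.eq]; simp) hf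
  simp only [List.length_append, List.length_cons, List.length_nil] at hi1 hi2 p3 p4 p5 p6
  exact ⟨i, hi, by omega, by omega, by omega⟩

theorem pos_s₂ (H : Blocks n u v X K α s₁ β m₁ s₂ m₂ γ) (hf : f ∈ s₂) :
    ∃ i, u[i]? = some f ∧ lst u (X .b) < i ∧ i < lst u (X .a) ∧ lst u (X (.y 0)) ≤ i ∧
      i ≤ lst u (X (.y n)) := by
  obtain ⟨-, -, p3, p4, p5, p6⟩ := H.positions
  obtain ⟨i, hi1, hi2, hi⟩ := exists_pos_of_mem (u := u) (G := α ++ s₁ ++ β ++ X .b :: m₁)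
    (r := m₂ ++ [X .a] ++ γ) (by rw [H.eq]; simp) hf
  simp only [List.length_append, List.length_cons, List.length_nil] at hi1 hi2 p3 p4 p5 p6
  exact ⟨i, hi, by omega, by omega, by omega, by omega⟩

theorem pos_m₂ (H : Blocks n u v X K α s₁ β m₁ s₂ m₂ γ) (hf : f ∈ m₂) :
    ∃ i, u[i]? = some f ∧ lst u (X .b) < i ∧ i < lst u (X .a) ∧ lst u (X (.y n)) < i := by
  obtain ⟨-, -, p3, p4, p5, p6⟩ := H.positions
  obtain ⟨i, hi1, hi2, hi⟩ := exists_pos_of_mem (u := u) (G := α ++ s₁ ++ β ++ X .b :: (m₁ ++ s₂))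
    (r := [X .a] ++ γ) (by rw [H.eq]; simp) hf
  simp only [List.length_append, List.length_cons, List.length_nil] at hi1 hi2 p3 p4 p5 p6
  exact ⟨i, hi, by omega, by omega, by omega⟩

theorem pos₂ (H : Blocks n u v X K α s₁ β m₁ s₂ m₂ γ) (hf : f ∈ m₁ ++ s₂ ++ m₂) :
    ∃ i, u[i]? = some f ∧ lst u (X .b) < i ∧ i < lst u (X .a) := by
  simp only [List.mem_append] at hf
  rcases hf with (hf | hf) | hf
  · obtain ⟨i, h1, h2, h3, -⟩ := H.pos_m₁ hf; exact ⟨i, h1, h2, h3⟩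
  · obtain ⟨i, h1, h2, h3, -⟩ := H.pos_s₂ hf; exact ⟨i, h1, h2, h3⟩
  · obtain ⟨i, h1, h2, h3, -⟩ := H.pos_m₂ hf; exact ⟨i, h1, h2, h3⟩

theorem count_ne_one₁ (H : Blocks n u v X K α s₁ β m₁ s₂ m₂ γ) (hf : f ∈ s₁) :
    u.count f ≠ 1 := by
  intro hc
  cases hK : K f
  · obtain ⟨i, hi, h1, h2⟩ := H.pos₁ hf hK
    obtain rfl := fst_eq_of_count_one hc hi
    exact H.red.count_ne_one_of_left h1 h2 hc
  · obtain ⟨-, -, c, hc', hd, rfl⟩ := H.core₁ f hf hK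
    have := H.red.count_dbl c hc' hd
    omega

theorem count_ne_one₂ (H : Blocks n u v X K α s₁ β m₁ s₂ m₂ γ)
    (hf : f ∈ X .b :: (m₁ ++ s₂ ++ m₂) ++ [X .a]) : u.count f ≠ 1 := by
  intro hc
  rw [List.cons_append, List.mem_cons, List.mem_append, List.mem_singleton] at hf
  rcases hf with rfl | hf | rfl
  · have := H.red.count_dbl .b inW_b trivial; omega
  · obtain ⟨i, hi, h1, h2⟩ := H.pos₂ hf
    obtain rfl := fst_eq_of_count_one hc hi
    exact H.red.count_ne_one_of_right h1 h2 hc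
  · have := H.red.count_dbl .a inW_a trivial; omega

theorem perm (H : Blocks n u v X K α s₁ β m₁ s₂ m₂ γ) (hx : x.Perm s₁)
    (hy : y.Perm (X .b :: (m₁ ++ s₂ ++ m₂) ++ [X .a])) :
    (α ++ x ++ β ++ y ++ γ).Perm u := by
  rw [H.eq]
  exact ((((List.Perm.append_left α hx).append_right β).append hy).append_right γ)

/-- The letter whose image contains `t`, for a substitution that does not erase all letters
occurring twice or more, stands outside the two rigid blocks. -/
theorem split_cases (H : Blocks n u v X K α s₁ β m₁ s₂ m₂ γ) (hx : x.Perm s₁)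
    (hy : y.Perm (X .b :: (m₁ ++ s₂ ++ m₂) ++ [X .a]))
    (hF : Fac n (sub χ (α ++ x ++ β ++ y ++ γ))) (he : 2 ≤ u.count e) (hne : χ e ≠ []) :
    ∃ l, u.count l = 1 ∧ ((∃ α₁ α₂, α = α₁ ++ l :: α₂ ∧ ∀ f, 2 ≤ u.count f → χ f ≠ [] →
        α₁.count f = 1 ∧ (α₂ ++ x ++ β ++ y ++ γ).count f = 1) ∨
      (∃ β₁ β₂, β = β₁ ++ l :: β₂ ∧ ∀ f, 2 ≤ u.count f → χ f ≠ [] →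
        (α ++ x ++ β₁).count f = 1 ∧ (β₂ ++ y ++ γ).count f = 1) ∨
      (∃ γ₁ γ₂, γ = γ₁ ++ l :: γ₂ ∧ ∀ f, 2 ≤ u.count f → χ f ≠ [] →
        (α ++ x ++ β ++ y ++ γ₁).count f = 1 ∧ γ₂.count f = 1)) := by
  have hp := H.perm hx hy
  rcases hF.split with h0 | ⟨c, l, d, hW, hl, hall⟩
  · exact (hne (h0 e (by rw [hp.count_eq]; exact he))).elim
  simp only [hp.count_eq] at hall
  have hl' : u.count l = 1 := by rw [← hp.count_eq]; exact hl
  have hmem : l ∈ α ++ x ++ β ++ y ++ γ := by rw [hW]; simp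
  refine ⟨l, hl', ?_⟩
  simp only [List.mem_append] at hmem
  rcases hmem with (((hm | hm) | hm) | hm) | hm
  · obtain ⟨α₁, α₂, rfl⟩ := List.append_of_mem hm
    obtain ⟨rfl, rfl⟩ := append_cons_unique (a' := α₁) (b' := α₂ ++ x ++ β ++ y ++ γ) 
      hW (by simp) hl
    exact Or.inl ⟨_, _, rfl, hall⟩
  · exact (H.count_ne_one₁ (hx.mem_iff.1 hm) hl').elim
  · obtain ⟨β₁, β₂, rfl⟩ := List.append_of_mem hm
    obtain ⟨rfl, rfl⟩ := append_cons_unique (a' := α ++ x ++ β₁) (b' := β₂ ++ y ++ γ) 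
      hW (by simp) hl
    exact Or.inr (Or.inl ⟨_, _, rfl, hall⟩)
  · exact (H.count_ne_one₂ (hy.mem_iff.1 hm) hl').elim
  · obtain ⟨γ₁, γ₂, rfl⟩ := List.append_of_mem hm
    obtain ⟨rfl, rfl⟩ := append_cons_unique (a' := α ++ x ++ β ++ y ++ γ₁) (b' := γ₂) 
      hW (by simp) hl
    exact Or.inr (Or.inr ⟨_, _, rfl, hall⟩)

/-- In the first block, the letters of the copy of `w_ξ` and the foreign letters do not survive
together. -/
theorem dichotomy₁ (H : Blocks n u v X K α s₁ β m₁ s₂ m₂ γ) (hx : x.Perm s₁)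
    (hy : y.Perm (X .b :: (m₁ ++ s₂ ++ m₂) ++ [X .a]))
    (hF : Fac n (sub χ (α ++ x ++ β ++ y ++ γ))) (he : e ∈ x) (hf : f ∈ x) (hKe : K e = true)
    (hKf : K f = false) : χ e = [] ∨ χ f = [] := by
  by_contra! hcon
  obtain ⟨he0, hf0⟩ := hcon
  have he' := hx.mem_iff.1 he
  have hf' := hx.mem_iff.1 hf
  obtain ⟨heα, heγ, c, hc, hd, hec⟩ := H.core₁ e he' hKe
  have hce : 2 ≤ u.count e := by rw [hec]; exact (H.red.count_dbl c hc hd).1.ge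
  have hcf : 2 ≤ u.count f := by
    have h1 := H.count_ne_one₁ hf'
    have h2 : 0 < u.count f := List.count_pos_iff.2 (by rw [H.eq]; simp [hf'])
    omega
  obtain ⟨l, hl, h | h | h⟩ := H.split_cases hx hy hF hce he0
  · obtain ⟨α₁, α₂, rfl, hall⟩ := h
    exact heα (List.mem_append_left _ (mem_of_count (hall e hce he0).1))
  · obtain ⟨β₁, β₂, rfl, hall⟩ := h
    obtain ⟨h1, h2⟩ := hall f hcf hf0
    obtain ⟨i, hi, i1, i2⟩ := H.pos₁ hf' hKf
    have hu : u = (α ++ s₁ ++ β₁) ++ l :: (β₂ ++ (X .b :: (m₁ ++ s₂ ++ m₂) ++ [X .a]) ++ γ) := by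
      rw [H.eq]; simp
    have e1 : (α ++ s₁ ++ β₁).count f = 1 := by
      rw [← h1]; exact (((hx.symm.append_left α).append_right β₁).count_eq f)
    have e2 : (β₂ ++ (X .b :: (m₁ ++ s₂ ++ m₂) ++ [X .a]) ++ γ).count f = 1 := by
      rw [← h2]; exact (((hy.symm.append_left β₂).append_right γ).count_eq f)
    have hfl : f ≠ l := by rintro rfl; omega
    have hc2 : u.count f = 2 := by
      rw [hu, List.count_append, List.count_cons_of_ne hfl.symm, e1, e2]
    have hfl : fst u l = (α ++ s₁ ++ β₁).length :=
      fst_eq_of_count_one hl (by rw [hu]; exact getElem?_append_cons_length _ _ _)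
    obtain ⟨j, hj1, -, hj⟩ := exists_pos_of_mem (u := u) (G := α ++ s₁ ++ β₁ ++ [l]) (r := [])
      (by rw [hu]; simp) (mem_of_count e2)
    obtain ⟨-, p2, -⟩ := H.positions
    simp only [List.length_append, List.length_singleton] at hj1 hfl p2
    obtain ⟨g1, g2⟩ := fst_lst_eq hc2.le (i := i) (j := j) (by omega) hi hj
    exact H.red.not_split_of_left (H.foreign f hKf) (by omega) (by omega) hc2 hl (by omega)
      (by omega)
  · obtain ⟨γ₁, γ₂, rfl, hall⟩ := h
    exact heγ (List.mem_append_right _ (List.mem_cons_of_mem _ (mem_of_count (hall e hce he0).2)))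

/-- In the second block, a foreign letter that survives together with a letter of the copy of
`w_ξ` stands next to one end of the block, and the first occurrences of it and of the end letter
are not separated by a letter occurring once. -/
theorem dichotomy₂ (H : Blocks n u v X K α s₁ β m₁ s₂ m₂ γ) (hx : x.Perm s₁)
    (hy : y.Perm (X .b :: (m₁ ++ s₂ ++ m₂) ++ [X .a]))
    (hF : Fac n (sub χ (α ++ x ++ β ++ y ++ γ))) (he : e ∈ y) (hf : f ∈ y) (hKe : K e = true)
    (hKf : K f = false) (he0 : χ e ≠ []) (hf0 : χ f ≠ []) :
    f ∈ α ++ s₁ ++ β ∧ f ∉ s₂ ∧ (f ∈ m₁ → ∀ T, u.count T = 1 →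
      ¬ (fst u f < fst u T ∧ fst u T < fst u (X .b)) ∧
      ¬ (fst u (X .b) < fst u T ∧ fst u T < fst u f)) ∧
    (f ∈ m₂ → ∀ T, u.count T = 1 →
      ¬ (fst u f < fst u T ∧ fst u T < fst u (X .a)) ∧
      ¬ (fst u (X .a) < fst u T ∧ fst u T < fst u f)) := by
  have he' := hy.mem_iff.1 he
  have hf' := hy.mem_iff.1 hf
  obtain ⟨heγ, hce⟩ : e ∉ γ ∧ 2 ≤ u.count e := by
    simp only [List.cons_append, List.mem_cons, List.mem_append, List.not_mem_nil, or_false] at he'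
    rcases he' with rfl | ((he' | he') | he') | rfl
    · exact ⟨(H.core₁ _ H.b_mem hKe).2.1, (H.red.count_dbl .b inW_b trivial).1.ge⟩
    · rw [H.gap₁ e he'] at hKe; simp at hKe
    · obtain ⟨heγ, c, hc, hd, rfl⟩ := H.core₂ e he' hKe
      exact ⟨heγ, (H.red.count_dbl c hc hd).1.ge⟩
    · rw [H.gap₂ e he'] at hKe; simp at hKe
    · exact ⟨(H.core₁ _ H.a_mem hKe).2.1, (H.red.count_dbl .a inW_a trivial).1.ge⟩
  have hcf : 2 ≤ u.count f := by
    have h1 := H.count_ne_one₂ hf'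
    have h2 : 0 < u.count f := List.count_pos_iff.2 (by
      rw [H.eq]; exact List.mem_append_left _ (List.mem_append_right _ hf'))
    omega
  have hfm : f ∈ m₁ ++ s₂ ++ m₂ := by
    rw [List.cons_append, List.mem_cons, List.mem_append, List.mem_singleton] at hf'
    rcases hf' with rfl | hf' | rfl
    · rw [H.marked _ inW_b] at hKf; simp at hKf
    · exact hf'
    · rw [H.marked _ inW_a] at hKf; simp at hKf
  obtain ⟨j, hj, j1, j2⟩ := H.pos₂ hfm
  obtain ⟨-, -, p3, -⟩ := H.positions
  -- the letter `l` containing `t` in its image, and an occurrence of `f` before it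
  obtain ⟨l, hl, A, hA, hfA, hA', hc2⟩ : ∃ l, u.count l = 1 ∧ ∃ A, (∃ B, u = A ++ l :: B) ∧ f ∈ A ∧
      (∃ r, α ++ s₁ ++ β = A ++ l :: r) ∧ u.count f = 2 := by
    obtain ⟨l, hl, h | h | h⟩ := H.split_cases hx hy hF hce he0
    · obtain ⟨α₁, α₂, rfl, hall⟩ := h
      obtain ⟨h1, h2⟩ := hall f hcf hf0
      refine ⟨l, hl, α₁, ⟨_, by rw [H.eq]; simp; rfl⟩, mem_of_count h1,
        ⟨α₂ ++ s₁ ++ β, by simp⟩, ?_⟩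
      have hfl : f ≠ l := by rintro rfl; omega
      rw [← (H.perm hx hy).count_eq, show α₁ ++ l :: α₂ ++ x ++ β ++ y ++ γ =
        α₁ ++ l :: (α₂ ++ x ++ β ++ y ++ γ) by simp, List.count_append,
        List.count_cons_of_ne hfl.symm, h1, h2]
    · obtain ⟨β₁, β₂, rfl, hall⟩ := h
      obtain ⟨h1, h2⟩ := hall f hcf hf0
      refine ⟨l, hl, α ++ s₁ ++ β₁, ⟨_, by rw [H.eq]; simp; rfl⟩, ?_, ⟨β₂, by simp⟩, ?_⟩
      · have := mem_of_count h1
        simp only [List.mem_append, hx.mem_iff] at this ⊢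
        exact this
      · have hfl : f ≠ l := by rintro rfl; omega
        rw [← (H.perm hx hy).count_eq, show α ++ x ++ (β₁ ++ l :: β₂) ++ y ++ γ =
          (α ++ x ++ β₁) ++ l :: (β₂ ++ y ++ γ) by simp, List.count_append,
          List.count_cons_of_ne hfl.symm, h1, h2]
    · obtain ⟨γ₁, γ₂, rfl, hall⟩ := h
      exact (heγ (List.mem_append_right _
        (List.mem_cons_of_mem _ (mem_of_count (hall e hce he0).2)))).elim
  obtain ⟨B, hu⟩ := hA
  obtain ⟨r, hr⟩ := hA'
  refine ⟨by rw [hr]; simp [hfA], ?_⟩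
  have hfl : fst u l = A.length :=
    fst_eq_of_count_one hl (by rw [hu]; exact getElem?_append_cons_length _ _ _)
  have hfi := fst_lt_length hfA
  have hi : u[fst A f]? = some f := by
    rw [hu, List.getElem?_append_left hfi]; exact getElem?_fst hfA
  have hAl : A.length < lst u (X .b) := by rw [p3, hr]; simp
  have lst_eq : ∀ j, u[j]? = some f → lst u (X .b) < j → lst u f = j := fun j hj h =>
    (fst_lst_eq hc2.le (i := fst A f) (by omega) hi hj).2
  have hff := (fst_lst_eq hc2.le (i := fst A f) (j := j) (by omega) hi hj).1
  have hjl := lst_eq j hj j1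
  have L := H.red.left_order
  have key := H.red.unseparated_of_right (H.foreign f hKf) (τ := l) (by omega) (by omega) hc2 hl
    (by omega) (by omega)
  refine ⟨fun hs => ?_, fun hm => ?_, fun hm => ?_⟩
  · obtain ⟨k, hk, k1, k2, k3, k4⟩ := H.pos_s₂ hs
    have := lst_eq k hk k1
    omega
  · obtain ⟨k, hk, k1, k2, k3⟩ := H.pos_m₁ hm
    have := lst_eq k hk k1
    rcases key with ⟨-, h⟩ | ⟨h, -⟩
    · exact h
    · omega
  · obtain ⟨k, hk, k1, k2, k3⟩ := H.pos_m₂ hm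
    have := lst_eq k hk k1
    rcases key with ⟨h, -⟩ | ⟨-, h⟩
    · omega
    · exact h

/-- Two surviving letters whose second occurrences follow each other up to erased letters have
their first occurrences separated by a letter occurring once. -/
theorem exists_separator (H : Blocks n u v X K α s₁ β m₁ s₂ m₂ γ) {D m h : List Letter}
    (hp : (α ++ s₁ ++ β ++ D ++ e :: (m ++ f :: h)).Perm u)
    (hF : Fac n (sub χ (α ++ s₁ ++ β ++ D ++ e :: (m ++ f :: h)))) (he : e ∈ α ++ s₁ ++ β)
    (hf : f ∈ α ++ s₁ ++ β) (he0 : χ e ≠ []) (hf0 : χ f ≠ []) (hm : sub χ m = []) :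
    ∃ T, u.count T = 1 ∧ ((fst u e < fst u T ∧ fst u T < fst u f) ∨
      (fst u f < fst u T ∧ fst u T < fst u e)) := by
  obtain ⟨T, hT, ho⟩ := hF.exists_separator (List.mem_append_left _ he)
    (List.mem_append_left _ hf) he0 hf0 hm
  set G := α ++ s₁ ++ β with hG
  have hu : u = G ++ ((X .b :: (m₁ ++ s₂ ++ m₂) ++ [X .a]) ++ γ) := by rw [H.eq]; simp [hG]
  have hW : G ++ D ++ e :: (m ++ f :: h) = G ++ (D ++ e :: (m ++ f :: h)) := by simp
  rw [hp.count_eq] at hT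
  rw [hW, fst_append_left he, fst_append_left hf] at ho
  have hTu : T ∈ G := by
    have h1 := fst_lt_length he
    have h2 := fst_lt_length hf
    by_contra hcon
    have h3 : fst (G ++ (D ++ e :: (m ++ f :: h))) T =
        (D ++ e :: (m ++ f :: h)).idxOf T + G.length := by
      rw [fst, List.idxOf_append_of_notMem hcon, add_comm]
    omega
  rw [fst_append_left hTu, ← fst_append_left (r := (X .b :: (m₁ ++ s₂ ++ m₂) ++ [X .a]) ++ γ) hTu,
    ← fst_append_left (r := (X .b :: (m₁ ++ s₂ ++ m₂) ++ [X .a]) ++ γ) he,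
    ← fst_append_left (r := (X .b :: (m₁ ++ s₂ ++ m₂) ++ [X .a]) ++ γ) hf, ← hu] at ho
  exact ⟨T, hT, ho⟩

theorem filter_gap {m : List Letter} (h : ∀ l ∈ m, K l = false) :
    m.filter K = [] ∧ (m.filter fun l => !K l) = m := by
  constructor
  · rw [List.filter_eq_nil_iff]; intro l hl; simp [h l hl]
  · rw [List.filter_eq_self]; intro l hl; simp [h l hl]

/-- The foreign letters between `b` and `y₀` can be moved in front of `b`. -/
theorem eq1_first_end (H : Blocks n u v X K α s₁ β m₁ s₂ m₂ γ) :
    Eq1 n u (α ++ s₁ ++ β ++ (m₁ ++ [X .b]) ++ (s₂ ++ m₂ ++ [X .a] ++ γ)) := by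
  obtain ⟨f1, f2⟩ := filter_gap H.gap₁
  have hKb := H.marked _ (inW_b (n := n))
  have hu : u = α ++ s₁ ++ β ++ (X .b :: m₁) ++ (s₂ ++ m₂ ++ [X .a] ++ γ) := by
    rw [H.eq]; simp
  have main := eq1_of_dichotomy (n := n) (K := K) (g := α ++ s₁ ++ β) (x := X .b :: m₁)
    (x' := m₁ ++ [X .b]) (h := s₂ ++ m₂ ++ [X .a] ++ γ)
    (by simp [List.filter_append, f1, hKb]) (by simp [List.filter_append, f2, hKb]) ?_
  · exact hu ▸ main
  intro χ y hy hF e he f hf hKe hKf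
  have hyp : y.Perm (X .b :: m₁) := by
    rcases hy with rfl | rfl
    · exact .refl _
    · exact List.perm_append_singleton _ _
  have hm : ∀ l ∈ y, K l = false → l ∈ m₁ := by
    intro l hl hKl
    have := hyp.mem_iff.1 hl
    rw [List.mem_cons] at this
    refine this.resolve_left ?_
    rintro rfl; rw [hKb] at hKl; simp at hKl
  have heb : e = X .b := by
    have := hyp.mem_iff.1 he
    rw [List.mem_cons] at this
    refine this.resolve_right fun h => ?_
    rw [H.gap₁ e h] at hKe; simp at hKe
  by_contra! hcon
  obtain ⟨he0, hf0⟩ := hcon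
  have hF' : Fac n (sub χ (α ++ s₁ ++ β ++ (y ++ s₂ ++ m₂ ++ [X .a]) ++ γ)) := by
    simpa [List.append_assoc] using hF
  have hyP : (y ++ s₂ ++ m₂ ++ [X .a]).Perm (X .b :: (m₁ ++ s₂ ++ m₂) ++ [X .a]) := by
    have := ((hyp.append_right s₂).append_right m₂).append_right [X .a]
    simpa using this
  have key : ∀ f' ∈ m₁, χ f' ≠ [] → f' ∈ α ++ s₁ ++ β ∧ ∀ T, u.count T = 1 →
      ¬ (fst u f' < fst u T ∧ fst u T < fst u (X .b)) ∧
      ¬ (fst u (X .b) < fst u T ∧ fst u T < fst u f') := by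
    intro f' hf' hne
    obtain ⟨h1, -, h2, -⟩ := H.dichotomy₂ (.refl _) hyP hF' (e := e) (f := f')
      (by simp [he]) (by
        have := hyp.mem_iff.2 (List.mem_cons_of_mem _ hf'); simp [this]) hKe (H.gap₁ f' hf') he0 hne
    exact ⟨h1, h2 hf'⟩
  have hsub : sub χ m₁ ≠ [] := fun h0 => hf0 (sub_eq_nil.1 h0 f (hm f hf hKf))
  have hbG : X .b ∈ α ++ s₁ ++ β := by simp [H.b_mem]
  subst heb
  rcases hy with rfl | rfl
  · obtain ⟨a, f', b, hab, ha, hf'⟩ := exists_first_ne_nil hsub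
    obtain ⟨h1, h2⟩ := key f' (by rw [hab]; simp) hf'
    have hW : α ++ s₁ ++ β ++ (X .b :: m₁) ++ (s₂ ++ m₂ ++ [X .a] ++ γ) =
      α ++ s₁ ++ β ++ [] ++ X .b :: (a ++ f' :: (b ++ (s₂ ++ m₂ ++ [X .a] ++ γ))) := by
      rw [hab]; simp
    obtain ⟨T, hT, h⟩ := H.exists_separator (hW ▸ (hu ▸ .refl _)) (hW ▸ hF) hbG h1 he0 hf' ha
    have := h2 T hT
    tauto
  · obtain ⟨a, f', b, hab, hb, hf'⟩ := exists_last_ne_nil hsub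
    obtain ⟨h1, h2⟩ := key f' (by rw [hab]; simp) hf'
    have hW : α ++ s₁ ++ β ++ (m₁ ++ [X .b]) ++ (s₂ ++ m₂ ++ [X .a] ++ γ) =
      α ++ s₁ ++ β ++ a ++ f' :: (b ++ X .b :: (s₂ ++ m₂ ++ [X .a] ++ γ)) := by
      rw [hab]; simp
    have hP : (α ++ s₁ ++ β ++ (m₁ ++ [X .b]) ++ (s₂ ++ m₂ ++ [X .a] ++ γ)).Perm u := by
      rw [hu]
      exact ((List.perm_append_singleton (X .b) m₁).append_left (α ++ s₁ ++ β)).append_right _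
    obtain ⟨T, hT, h⟩ := H.exists_separator (hW ▸ hP) (hW ▸ hF) h1 hbG hf' he0 hb
    have := h2 T hT
    tauto

/-- The foreign letters between `yₙ` and `a` can be moved behind `a`. -/
theorem eq1_last_end (H : Blocks n u v X K α s₁ β m₁ s₂ m₂ γ) :
    Eq1 n (α ++ s₁ ++ β ++ (m₁ ++ [X .b]) ++ (s₂ ++ m₂ ++ [X .a] ++ γ))
      (α ++ s₁ ++ β ++ (m₁ ++ [X .b]) ++ (s₂ ++ [X .a]) ++ (m₂ ++ γ)) := by
  obtain ⟨f1, f2⟩ := filter_gap H.gap₂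
  have hKa := H.marked _ (inW_a (n := n))
  have main := eq1_of_dichotomy (n := n) (K := K) (g := α ++ s₁ ++ β ++ (m₁ ++ [X .b]) ++ s₂)
    (x := m₂ ++ [X .a]) (x' := X .a :: m₂) (h := γ)
    (by simp [List.filter_append, f1, hKa]) (by simp [List.filter_append, f2, hKa]) ?_
  · simpa using main
  intro χ y hy hF e he f hf hKe hKf
  have hyp : y.Perm (m₂ ++ [X .a]) := by
    rcases hy with rfl | rfl
    · exact .refl _
    · exact (List.perm_append_singleton _ _).symm
  have hm : ∀ l ∈ y, K l = false → l ∈ m₂ := by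
    intro l hl hKl
    have := hyp.mem_iff.1 hl
    rw [List.mem_append, List.mem_singleton] at this
    refine this.resolve_right ?_
    rintro rfl; rw [hKa] at hKl; simp at hKl
  have hea : e = X .a := by
    have := hyp.mem_iff.1 he
    rw [List.mem_append, List.mem_singleton] at this
    refine this.resolve_left fun h => ?_
    rw [H.gap₂ e h] at hKe; simp at hKe
  by_contra! hcon
  obtain ⟨he0, hf0⟩ := hcon
  have hF' : Fac n (sub χ (α ++ s₁ ++ β ++ ((m₁ ++ [X .b]) ++ s₂ ++ y) ++ γ)) := by
    simpa [List.append_assoc] using hF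
  have hyP : ((m₁ ++ [X .b]) ++ s₂ ++ y).Perm (X .b :: (m₁ ++ s₂ ++ m₂) ++ [X .a]) := by
    have := ((List.perm_append_singleton (X .b) m₁).append_right s₂).append hyp
    simpa using this
  have key : ∀ f' ∈ m₂, χ f' ≠ [] → f' ∈ α ++ s₁ ++ β ∧ ∀ T, u.count T = 1 →
      ¬ (fst u f' < fst u T ∧ fst u T < fst u (X .a)) ∧
      ¬ (fst u (X .a) < fst u T ∧ fst u T < fst u f') := by
    intro f' hf' hne
    obtain ⟨h1, -, -, h2⟩ := H.dichotomy₂ (.refl _) hyP hF' (e := e) (f := f')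
      (by simp [he]) (by
        have := hyp.mem_iff.2 (List.mem_append_left _ hf'); simp [this]) hKe (H.gap₂ f' hf') he0 hne
    exact ⟨h1, h2 hf'⟩
  have hsub : sub χ m₂ ≠ [] := fun h0 => hf0 (sub_eq_nil.1 h0 f (hm f hf hKf))
  have haG : X .a ∈ α ++ s₁ ++ β := by simp [H.a_mem]
  have hP : (α ++ s₁ ++ β ++ ((m₁ ++ [X .b]) ++ s₂ ++ y) ++ γ).Perm u :=
    H.perm (.refl _) hyP
  subst hea
  rcases hy with rfl | rfl
  · obtain ⟨a, f', b, hab, hb, hf'⟩ := exists_last_ne_nil hsub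
    obtain ⟨h1, h2⟩ := key f' (by rw [hab]; simp) hf'
    have hW : α ++ s₁ ++ β ++ ((m₁ ++ [X .b]) ++ s₂ ++ (m₂ ++ [X .a])) ++ γ =
      α ++ s₁ ++ β ++ ((m₁ ++ [X .b]) ++ s₂ ++ a) ++ f' :: (b ++ X .a :: γ) := by
      rw [hab]; simp
    obtain ⟨T, hT, h⟩ := H.exists_separator (hW ▸ hP) (hW ▸ hF') h1 haG hf' he0 hb
    have := h2 T hT
    tauto
  · obtain ⟨a, f', b, hab, ha, hf'⟩ := exists_first_ne_nil hsub
    obtain ⟨h1, h2⟩ := key f' (by rw [hab]; simp) hf'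
    have hW : α ++ s₁ ++ β ++ ((m₁ ++ [X .b]) ++ s₂ ++ (X .a :: m₂)) ++ γ =
      α ++ s₁ ++ β ++ ((m₁ ++ [X .b]) ++ s₂) ++ X .a :: (a ++ f' :: (b ++ γ)) := by
      rw [hab]; simp
    obtain ⟨T, hT, h⟩ := H.exists_separator (hW ▸ hP) (hW ▸ hF') haG h1 he0 hf' ha
    have := h2 T hT
    tauto

/-- The foreign letters can be moved out of the two rigid blocks. -/
theorem eq1_rearranged (H : Blocks n u v X K α s₁ β m₁ s₂ m₂ γ) :
    Eq1 n u (α ++ (s₁.filter K ++ s₁.filter fun l => !K l) ++ β ++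
      (m₁ ++ [X .b] ++ (s₂.filter K ++ X .a :: s₂.filter fun l => !K l) ++ m₂) ++ γ) := by
  have hKa := H.marked _ (inW_a (n := n))
  refine (H.eq1_first_end.trans H.eq1_last_end).trans (Eq1.trans
    (v := α ++ s₁ ++ β ++ (m₁ ++ [X .b] ++ (s₂.filter K ++ X .a :: s₂.filter fun l => !K l) ++ m₂)
      ++ γ) ?_ ?_)
  · have hP : (s₂.filter K ++ X .a :: s₂.filter fun l => !K l).Perm (s₂ ++ [X .a]) := by
      refine List.perm_middle.trans (.trans ?_ (List.perm_append_singleton _ _).symm)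
      exact (List.filter_append_perm K s₂).cons _
    have main := eq1_of_dichotomy (n := n) (K := K) (g := α ++ s₁ ++ β ++ (m₁ ++ [X .b]))
      (x := s₂ ++ [X .a]) (x' := s₂.filter K ++ X .a :: s₂.filter fun l => !K l) (h := m₂ ++ γ)
      (by simp [List.filter_append, hKa]) (by simp [List.filter_append, hKa]) ?_
    · simpa using main
    intro χ y hy hF e he f hf hKe hKf
    have hyp : y.Perm (s₂ ++ [X .a]) := by
      rcases hy with rfl | rfl
      · exact .refl _
      · exact hP
    by_contra! hcon
    obtain ⟨he0, hf0⟩ := hcon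
    have hF' : Fac n (sub χ (α ++ s₁ ++ β ++ ((m₁ ++ [X .b]) ++ y ++ m₂) ++ γ)) := by
      simpa [List.append_assoc] using hF
    have hyP : ((m₁ ++ [X .b]) ++ y ++ m₂).Perm (X .b :: (m₁ ++ s₂ ++ m₂) ++ [X .a]) := by
      have h1 := ((List.perm_append_singleton (X .b) m₁).append hyp).append_right m₂
      refine h1.trans ?_
      have h2 : (([X .a] ++ m₂).Perm (m₂ ++ [X .a])) := List.perm_append_comm
      simpa using (h2.append_left (X .b :: (m₁ ++ s₂)))
    have := (H.dichotomy₂ (.refl _) hyP hF' (by simp [he]) (by simp [hf]) hKe hKf he0 hf0).2.1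
    have hf' := hyp.mem_iff.1 hf
    rw [List.mem_append, List.mem_singleton] at hf'
    rcases hf' with hf' | rfl
    · exact this hf'
    · rw [hKa] at hKf; simp at hKf
  · set y := m₁ ++ [X .b] ++ (s₂.filter K ++ X .a :: s₂.filter fun l => !K l) ++ m₂ with hy
    have hyP : y.Perm (X .b :: (m₁ ++ s₂ ++ m₂) ++ [X .a]) := by
      have hP : (s₂.filter K ++ X .a :: s₂.filter fun l => !K l).Perm (s₂ ++ [X .a]) := by
        refine List.perm_middle.trans (.trans ?_ (List.perm_append_singleton _ _).symm)
        exact (List.filter_append_perm K s₂).cons _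
      have h1 := ((List.perm_append_singleton (X .b) m₁).append hP).append_right m₂
      refine h1.trans ?_
      have h2 : (([X .a] ++ m₂).Perm (m₂ ++ [X .a])) := List.perm_append_comm
      simpa using (h2.append_left (X .b :: (m₁ ++ s₂)))
    have main := eq1_of_dichotomy (n := n) (K := K) (g := α)
      (x := s₁) (x' := s₁.filter K ++ s₁.filter fun l => !K l) (h := β ++ y ++ γ)
      (by simp [List.filter_append]) (by simp [List.filter_append]) ?_
    · simpa using main
    intro χ x hx hF e he f hf hKe hKf
    have hxP : x.Perm s₁ := by
      rcases hx with rfl | rfl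
      · exact .refl _
      · exact List.filter_append_perm K s₁
    exact H.dichotomy₁ hxP hyP (by simpa [List.append_assoc] using hF) he hf hKe hKf

end Blocks
/-! ### Reading off a substitution from a subword -/

theorem getElem?_listP {n : ℕ} (ε : ℕ → Bool) {k : ℕ} (hk : k < 6 * n) :
    (listP n)[k]? = (wl n ε)[k]? := by
  rw [wl, List.getElem?_append_left (by rw [length_listP]; exact hk)]

theorem getElem?_listA {n : ℕ} (ε : ℕ → Bool) {k : ℕ} (hk : k < 4 * n + 2) :
    (listA n ε)[k]? = (wl n ε)[6 * n + k]? := by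
  rw [wl, List.getElem?_append_right (by rw [length_listP]; omega), length_listP,
    Nat.add_sub_cancel_left, List.getElem?_append_left (by rw [length_listA]; exact hk)]

theorem getElem?_listQ {n : ℕ} (ε : ℕ → Bool) {k : ℕ} (hk : k < 2 * n + 3) :
    (listQ n)[k]? = (wl n ε)[10 * n + 2 + k]? := by
  rw [wl, List.getElem?_append_right (by rw [length_listP]; omega), length_listP,
    List.getElem?_append_right (by rw [length_listA]; omega), length_listA,
    List.getElem?_append_left (by rw [length_listQ]; omega)]
  congr 1; omega

theorem getElem?_listR {n : ℕ} (ε : ℕ → Bool) {k : ℕ} :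
    (listR n)[k]? = (wl n ε)[12 * n + 5 + k]? := by
  rw [wl, List.getElem?_append_right (by rw [length_listP]; omega), length_listP,
    List.getElem?_append_right (by rw [length_listA]; omega), length_listA,
    List.getElem?_append_right (by rw [length_listQ]; omega), length_listQ]
  congr 1; omega

theorem exists_occ_of_mem_listP {n : ℕ} (ε : ℕ → Bool) {c : Letter} (h : c ∈ listP n) :
    ∃ k < 6 * n, Occ n ε c k := by
  obtain ⟨k, hk⟩ := List.mem_iff_getElem?.1 h
  have hlt := (List.getElem?_eq_some_iff.1 hk).1
  rw [length_listP] at hlt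
  rw [getElem?_listP ε hlt, getElem?_wl] at hk
  exact ⟨k, hlt, hk⟩

theorem exists_occ_of_mem_listA {n : ℕ} {ε : ℕ → Bool} {c : Letter} (h : c ∈ listA n ε) :
    ∃ k, 6 * n ≤ k ∧ k < 10 * n + 2 ∧ Occ n ε c k := by
  obtain ⟨k, hk⟩ := List.mem_iff_getElem?.1 h
  have hlt := (List.getElem?_eq_some_iff.1 hk).1
  rw [length_listA] at hlt
  rw [getElem?_listA ε hlt, getElem?_wl] at hk
  exact ⟨6 * n + k, by omega, by omega, hk⟩

theorem exists_occ_of_mem_listQ {n : ℕ} (ε : ℕ → Bool) {c : Letter} (h : c ∈ listQ n) :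
    ∃ k, 10 * n + 2 ≤ k ∧ k < 12 * n + 5 ∧ Occ n ε c k := by
  obtain ⟨k, hk⟩ := List.mem_iff_getElem?.1 h
  have hlt := (List.getElem?_eq_some_iff.1 hk).1
  rw [length_listQ] at hlt
  rw [getElem?_listQ ε hlt, getElem?_wl] at hk
  exact ⟨10 * n + 2 + k, by omega, by omega, hk⟩

theorem exists_occ_of_mem_listR {n : ℕ} (ε : ℕ → Bool) {c : Letter} (h : c ∈ listR n) :
    ∃ k, 12 * n + 5 ≤ k ∧ Occ n ε c k := by
  obtain ⟨k, hk⟩ := List.mem_iff_getElem?.1 h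
  rw [getElem?_listR ε, getElem?_wl] at hk
  exact ⟨12 * n + 5 + k, by omega, hk⟩

theorem nodup_take_wl (n : ℕ) (ε : ℕ → Bool) : ((wl n ε).take (12 * n + 5)).Nodup := by
  rw [List.nodup_iff_getElem?_ne_getElem?]
  intro i j hij hj heq
  rw [List.length_take, length_wl] at hj
  rw [List.getElem?_take_of_lt (by omega), List.getElem?_take_of_lt (by omega)] at heq
  obtain ⟨c, hc, oc⟩ := exists_getElem?_wl_occ n ε i (by omega)
  rw [hc] at heq
  have := oc.eq_of_lt (getElem?_wl.1 heq.symm) (by omega) (by omega)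
  omega

theorem nodup_drop_wl (n : ℕ) (ε : ℕ → Bool) : ((wl n ε).drop (12 * n + 5)).Nodup := by
  rw [List.nodup_iff_getElem?_ne_getElem?]
  intro i j hij hj heq
  rw [List.length_drop, length_wl] at hj
  rw [List.getElem?_drop, List.getElem?_drop] at heq
  obtain ⟨c, hc, oc⟩ := exists_getElem?_wl_occ n ε (12 * n + 5 + i) (by omega)
  rw [hc] at heq
  have := oc.eq_of_gt (getElem?_wl.1 heq.symm) (by omega) (by omega)
  omega

theorem take_wl (n : ℕ) (ε : ℕ → Bool) :
    (wl n ε).take (12 * n + 5) = listP n ++ (listA n ε ++ listQ n) := by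
  rw [wl, ← List.append_assoc (listA n ε), ← List.append_assoc (listP n), List.take_left']
  simp only [List.length_append, length_listP, length_listA, length_listQ]
  omega

theorem nodup_listP (n : ℕ) : (listP n).Nodup := by
  have := nodup_take_wl n fun _ => false
  rw [take_wl] at this
  exact this.sublist (List.sublist_append_left _ _)

theorem nodup_listQ (n : ℕ) : (listQ n).Nodup := by
  have := nodup_take_wl n fun _ => false
  rw [take_wl, ← List.append_assoc] at this
  exact this.sublist (List.sublist_append_right _ _)

theorem count_wl_dbl {n : ℕ} {c : Letter} (ε : ℕ → Bool) (hc : InW n c) (hd : Dbl c) :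
    (wl n ε).count c = 2 := by
  obtain ⟨k, hk⟩ := (inW_iff_occ ε).1 hc
  obtain ⟨p, q, hpq, hp, hq, -⟩ := hk.exists_pair hd
  have h1 := two_le_count hpq (getElem?_wl.2 hp) (getElem?_wl.2 hq)
  have h2 := List.nodup_iff_count_le_one.1 (nodup_take_wl n ε) c
  have h3 := List.nodup_iff_count_le_one.1 (nodup_drop_wl n ε) c
  have h4 := List.count_append (a := c) (l₁ := (wl n ε).take (12 * n + 5))
    (l₂ := (wl n ε).drop (12 * n + 5))
  rw [List.take_append_drop] at h4
  omega

theorem count_wl_lin {n : ℕ} {c : Letter} (ε : ℕ → Bool) (hc : InW n c) (hd : ¬ Dbl c) :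
    (wl n ε).count c = 1 := by
  have h1 : 0 < (wl n ε).count c := List.count_pos_iff.2 (mem_wl.2 hc)
  have h2 : ¬ 2 ≤ (wl n ε).count c := by
    intro h2
    have hl := fst_lt_lst h2
    have hm : c ∈ wl n ε := mem_wl.2 hc
    exact hd ((getElem?_wl.1 (getElem?_fst hm)).bounds (getElem?_wl.1 (getElem?_lst hm)) hl).2.2
  omega

/-- Every letter occurring twice in `w_ξ` is followed by a letter occurring once. -/
def Spaced : List Letter → Prop
  | [] => True
  | c :: l => (Dbl c → ∃ d r, l = d :: r ∧ ¬ Dbl d) ∧ Spaced l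

theorem Spaced.append {a b : List Letter} (ha : Spaced a) (hb : Spaced b) : Spaced (a ++ b) := by
  induction a with
  | nil => exact hb
  | cons c a ih =>
    refine ⟨fun hc => ?_, ih ha.2⟩
    obtain ⟨d, r, rfl, hd⟩ := ha.1 hc
    exact ⟨d, r ++ b, rfl, hd⟩

theorem spaced_flatMap (L : List ℕ) {f : ℕ → List Letter} (hf : ∀ i, Spaced (f i)) :
    Spaced (L.flatMap f) := by
  induction L with
  | nil => trivial
  | cons i L ih => exact (hf i).append ih

theorem spaced_pair {c d : Letter} (hd : ¬ Dbl d) : Spaced [c, d] :=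
  ⟨fun _ => ⟨_, _, rfl, hd⟩, fun h => (hd h).elim, trivial⟩

theorem spaced_listP (n : ℕ) : Spaced (listP n) :=
  (spaced_flatMap _ fun _ => spaced_pair id).append
    ((spaced_flatMap _ fun _ => spaced_pair id).append
      (spaced_flatMap _ fun _ => spaced_pair id))

theorem spaced_listQ (n : ℕ) : Spaced (listQ n) ∧ ∃ d r, listQ n = d :: r ∧ ¬ Dbl d := by
  have : ∀ L : List ℕ, Spaced ((L.flatMap fun i => [.s i, .y i]) ++ [.t]) ∧
      ∃ d r, (L.flatMap fun i => [.s i, .y i]) ++ [Letter.t] = d :: r ∧ ¬ Dbl d := by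
    intro L
    induction L with
    | nil => exact ⟨⟨fun h => h.elim, trivial⟩, _, _, rfl, id⟩
    | cons i L ih =>
      exact ⟨⟨fun h => h.elim, fun _ => ih.2, ih.1⟩, _, _, rfl, id⟩
  exact this _

section Extract

variable {K : Letter → Bool} {X : Letter → Letter} {χ : Letter → List Letter}

theorem sub_update {φ : Letter → List Letter} {c : Letter} {a w : List Letter} (hc : c ∉ w) :
    sub (Function.update φ c a) w = sub φ w :=
  sub_congr fun e he => Function.update_of_ne (fun h : e = c => hc (h ▸ he)) _ _

/-- A word in which the marked letters form a copy of a spaced word `w₀` is, up to a prefix of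
unmarked letters, the image of `w₀` under a substitution that sends each letter occurring twice to
a single letter: the unmarked letters are attached to the images of the other letters. -/
theorem exists_form_of_filter {w₀ : List Letter} (hs : Spaced w₀) (hd : w₀.Nodup)
    {v₀ : List Letter} (hv : v₀.filter K = w₀.map X) (hK : ∀ l, K l = false → χ l = [])
    (hX : ∀ c ∈ w₀, χ (X c) = [c]) :
    ∃ (r : List Letter) (φ : Letter → List Letter), v₀ = r ++ sub φ w₀ ∧ sub χ r = [] ∧
      (∀ c, Dbl c → φ c = [X c]) ∧ ∀ c ∈ w₀, sub χ (φ c) = [c] := by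
  induction w₀ generalizing v₀ with
  | nil =>
    refine ⟨v₀, fun c => [X c], by simp, sub_eq_nil.2 fun e he => hK e ?_, fun _ _ => rfl, by simp⟩
    have := List.filter_eq_nil_iff.1 hv e he
    simpa using this
  | cons c w₁ ih =>
    rw [List.map_cons, List.filter_eq_cons_iff] at hv
    obtain ⟨r, v₁, rfl, hr, hc, hv₁⟩ := hv
    obtain ⟨hcw, hd₁⟩ := List.nodup_cons.1 hd
    obtain ⟨r₁, φ, rfl, hr₁, hφ, hφ'⟩ := ih hs.2 hd₁ hv₁ fun e he =>
      hX e (List.mem_cons_of_mem _ he)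
    have hr0 : sub χ r = [] := sub_eq_nil.2 fun e he => hK e (by simpa using hr e he)
    have hXc := hX c List.mem_cons_self
    by_cases hD : Dbl c
    · obtain ⟨d, w₂, rfl, hd'⟩ := hs.1 hD
      have hne : c ≠ d := by rintro rfl; exact hd' hD
      have hdw : d ∉ w₂ := (List.nodup_cons.1 hd₁).1
      refine ⟨r, Function.update φ d (r₁ ++ φ d), ?_, hr0, fun e he => ?_, fun e he => ?_⟩
      · rw [sub_cons (e := c), sub_cons (u := w₂), sub_cons (u := w₂), Function.update_of_ne hne,
          Function.update_self, hφ c hD, sub_update hdw]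
        simp
      · rw [Function.update_of_ne (by rintro rfl; exact hd' he)]
        exact hφ e he
      · rcases List.mem_cons.1 he with rfl | he
        · rw [Function.update_of_ne hne, hφ _ hD]; simpa using hXc
        · by_cases hed : e = d
          · subst hed
            rw [Function.update_self, sub_append, hr₁, hφ' e he]; rfl
          · rw [Function.update_of_ne hed]; exact hφ' e he
    · refine ⟨r, Function.update φ c (X c :: r₁), ?_, hr0, fun e he => ?_, fun e he => ?_⟩
      · rw [sub_cons, Function.update_self, sub_update hcw]
        simp
      · rw [Function.update_of_ne (by rintro rfl; exact hD he)]
        exact hφ e he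
      · rcases List.mem_cons.1 he with rfl | he
        · rw [Function.update_self, sub_cons, hXc, hr₁]; rfl
        · rw [Function.update_of_ne fun h : e = c => hcw (h ▸ he)]; exact hφ' e he

theorem exists_form_of_filter' {w₀ : List Letter} (hs : Spaced w₀) (hd : w₀.Nodup)
    (hh : ∃ d r, w₀ = d :: r ∧ ¬ Dbl d)
    {v₀ : List Letter} (hv : v₀.filter K = w₀.map X) (hK : ∀ l, K l = false → χ l = [])
    (hX : ∀ c ∈ w₀, χ (X c) = [c]) :
    ∃ φ : Letter → List Letter, v₀ = sub φ w₀ ∧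
      (∀ c, Dbl c → φ c = [X c]) ∧ ∀ c ∈ w₀, sub χ (φ c) = [c] := by
  obtain ⟨r, φ, rfl, hr, hφ, hφ'⟩ := exists_form_of_filter hs hd hv hK hX
  obtain ⟨d, w₁, rfl, hd'⟩ := hh
  have hdw := (List.nodup_cons.1 hd).1
  refine ⟨Function.update φ d (r ++ φ d), ?_, fun e he => ?_, fun e he => ?_⟩
  · rw [sub_cons, sub_cons, Function.update_self, sub_update hdw]
    simp
  · rw [Function.update_of_ne (by rintro rfl; exact hd' he)]
    exact hφ e he
  · by_cases hed : e = d
    · subst hed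
      rw [Function.update_self, sub_append, hr, hφ' e he]; rfl
    · rw [Function.update_of_ne hed]; exact hφ' e he

theorem filter_eq_map_sub {u : List Letter} (hK : ∀ l, K l = false ↔ χ l = [])
    (hu : ∀ l ∈ u, χ l = [] ∨ ∃ c, χ l = [c] ∧ l = X c) : u.filter K = (sub χ u).map X := by
  induction u with
  | nil => rfl
  | cons l u ih =>
    have ih := ih fun e he => hu e (List.mem_cons_of_mem _ he)
    rcases hu l List.mem_cons_self with h | ⟨c, h, rfl⟩
    · simp [(hK l).2 h, h, ih]
    · have : K (X c) = true := by
        rw [← Bool.not_eq_false, hK, h]; simp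
      simp [this, h, ih]

theorem count_eq_count_sub {u : List Letter} {c : Letter} (hc : χ (X c) = [c])
    (hu : ∀ l ∈ u, χ l = [] ∨ ∃ c, χ l = [c] ∧ l = X c) : u.count (X c) = (sub χ u).count c := by
  induction u with
  | nil => rfl
  | cons l u ih =>
    have ih := ih fun e he => hu e (List.mem_cons_of_mem _ he)
    rcases hu l List.mem_cons_self with h | ⟨d, h, rfl⟩
    · have : l ≠ X c := by rintro rfl; simp [hc] at h
      simp [h, ih, List.count_cons, this]
    · by_cases hdc : d = c
      · subst hdc; simp [h, ih, List.count_cons, add_comm]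
      · have : X d ≠ X c := by
          intro h'; rw [h', hc] at h; exact hdc (by simpa using h.symm)
        simp [h, ih, List.count_cons, this, hdc]

end Extract
/-! ### Words derivable from a word with a rigid substitution -/

section TwinFree

variable {n : ℕ} {u v p q : List Letter} {X : Letter → Letter} {χ φ : Letter → List Letter}
  {ε : ℕ → Bool}

theorem eq_of_sub_eq_singleton {l : List Letter} {c e f : Letter} (h : sub χ l = [c])
    (he : e ∈ l) (hf : f ∈ l) (he' : χ e = [c]) (hf' : χ f = [c]) : e = f := by
  obtain ⟨a, b, rfl⟩ := List.append_of_mem he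
  simp only [sub_append, sub_cons, he'] at h
  have h1 := congrArg List.length h
  simp only [List.length_append, List.length_singleton] at h1
  have ha : sub χ a = [] := List.length_eq_zero_iff.1 (by omega)
  have hb : sub χ b = [] := List.length_eq_zero_iff.1 (by omega)
  rw [List.mem_append, List.mem_cons] at hf
  rcases hf with hf | hf | hf
  · rw [sub_eq_nil.1 ha f hf] at hf'; simp at hf'
  · exact hf.symm
  · rw [sub_eq_nil.1 hb f hf] at hf'; simp at hf'

/-- A letter of `pφ(w_ξ)q` is erased by a rigid `χ` unless it is the letter `X c` chosen in
`φ(c)`. -/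
theorem Rigid.erased_or (hr : Rigid n χ φ p q) (hX : ∀ c, InW n c → X c ∈ φ c ∧ χ (X c) = [c])
    {l : Letter} (hl : l ∈ p ++ sub φ (wl n ε) ++ q) :
    χ l = [] ∨ ∃ c, InW n c ∧ χ l = [c] ∧ l = X c := by
  simp only [List.mem_append] at hl
  rcases hl with (hl | hl) | hl
  · exact Or.inl (sub_eq_nil.1 hr.1 l hl)
  · obtain ⟨c, hc, hl⟩ := List.mem_flatMap.1 hl
    have hc' := mem_wl.1 hc
    rcases eq_nil_or_of_sub_eq_singleton (hr.2.2 c hc') hl with h | h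
    · exact Or.inl h
    · exact Or.inr ⟨c, hc', h, eq_of_sub_eq_singleton (hr.2.2 c hc') hl (hX c hc').1 h (hX c hc').2⟩
  · exact Or.inl (sub_eq_nil.1 hr.2.1 l hl)

theorem sub_pure_eq_map (w : List Letter) : sub (fun c => [X c]) w = w.map X := by
  induction w <;> simp_all

theorem exists_ends {l : List Letter} {e f : Letter} (h0 : l[0]? = some e)
    (h1 : l[l.length - 1]? = some f) (hl : 2 ≤ l.length) : ∃ s, l = e :: (s ++ [f]) := by
  cases l with
  | nil => simp at hl
  | cons c l =>
    obtain rfl : c = e := by simpa using h0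
    obtain ⟨s, d, rfl⟩ := (List.eq_nil_or_concat l).resolve_left (by rintro rfl; simp at hl)
    refine ⟨s, ?_⟩
    simp only [List.concat_eq_append, List.length_cons, List.length_append, List.length_nil,
      Nat.add_sub_cancel, zero_add, List.getElem?_cons_succ, List.getElem?_concat_length] at h1
    rw [Option.some.inj h1, List.concat_eq_append]

theorem exists_listA_eq {n : ℕ} (hn : 1 ≤ n) (ε : ℕ → Bool) :
    ∃ s, listA n ε = .aI 1 :: (s ++ [.bI n]) := by
  refine exists_ends ?_ ?_ (by rw [length_listA]; omega)
  · rw [getElem?_listA ε (by omega), getElem?_wl]; simp [Occ]; omega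
  · rw [length_listA, getElem?_listA ε (by omega), getElem?_wl]; simp only [Occ]; omega

theorem exists_listR_eq {n : ℕ} (hn : 1 ≤ n) :
    ∃ s, listR n = .b :: .y 0 :: (s ++ [.y n]) ++ [.a] := by
  obtain ⟨s, hs⟩ : ∃ s, listR n = .b :: (s ++ [.a]) := by
    refine exists_ends ?_ ?_ (by rw [length_listR]; omega)
    · rw [getElem?_listR fun _ => false, getElem?_wl]; simp [Occ]
    · rw [length_listR, getElem?_listR fun _ => false, getElem?_wl]; simp only [Occ]; omega
  have hl := congrArg List.length hs
  rw [length_listR] at hl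
  simp only [List.length_cons, List.length_append, List.length_nil] at hl
  have hget : ∀ k, k < s.length → s[k]? = (wl n fun _ => false)[12 * n + 6 + k]? := by
    intro k hk
    have : (listR n)[k + 1]? = s[k]? := by
      rw [hs, List.getElem?_cons_succ, List.getElem?_append_left hk]
    rw [← this, getElem?_listR fun _ => false]
    congr 1; omega
  obtain ⟨r, hr⟩ : ∃ r, s = .y 0 :: (r ++ [.y n]) := by
    refine exists_ends ?_ ?_ (by omega)
    · rw [hget 0 (by omega), getElem?_wl]; simp [Occ]
    · rw [hget _ (by omega), getElem?_wl]; simp only [Occ]; omega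
  exact ⟨r, by rw [hs, hr]; simp⟩

theorem sub_listA_eq (ε : ℕ → Bool) (hφ : ∀ c, InW n c → Dbl c → φ c = [X c]) :
    sub φ (listA n ε) = (listA n ε).map X := by
  have : sub φ (listA n ε) = sub (fun c => [X c]) (listA n ε) :=
    sub_congr fun c hc => by
      obtain ⟨k, k1, k2, hk⟩ := exists_occ_of_mem_listA hc
      exact hφ c (Reduced.inW_of_occ hk) (hk.dbl (Or.inl ⟨k1, k2⟩))
  rw [this, sub_pure_eq_map]

theorem sub_listR_eq (hφ : ∀ c, InW n c → Dbl c → φ c = [X c]) :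
    sub φ (listR n) = (listR n).map X := by
  have : sub φ (listR n) = sub (fun c => [X c]) (listR n) :=
    sub_congr fun c hc => by
      obtain ⟨k, k1, hk⟩ := exists_occ_of_mem_listR (fun _ => false) hc
      exact hφ c (Reduced.inW_of_occ hk) (hk.dbl (Or.inr k1))
  rw [this, sub_pure_eq_map]

/-- If the letters of `w_ξ` that occur twice are sent to single letters by `φ`, then a word
derivable from `pφ(w_ξ)q` forms with it a reduced pair, the word being the left side. -/
theorem reduced_of_twinFree (hn : 2 ≤ n) (h : DerT n u (p ++ sub φ (wl n ε) ++ q))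
    (hr : Rigid n χ φ p q) (hφ : ∀ c, InW n c → Dbl c → φ c = [X c])
    (hc : ∀ c, InW n c → Dbl c → (p ++ sub φ (wl n ε) ++ q).count (X c) = 2)
    (hX : ∀ c, InW n c → X c ∈ φ c ∧ χ (X c) = [c]) {ζ : ℕ → Bool} (hζ : sub χ u = wl n ζ)
    {K : Letter → Bool} (hf : u.filter K = (wl n ζ).map X) :
    Reduced n u (p ++ sub φ (wl n ε) ++ q) X := by
  have hu : ∀ l ∈ u, χ l = [] ∨ ∃ c, χ l = [c] ∧ l = X c := fun l hl => by
    rcases hr.erased_or hX (h.symm.mem hl) with h | ⟨c, -, h⟩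
    · exact Or.inl h
    · exact Or.inr ⟨c, h⟩
  refine ⟨hn, h, fun c hW hd => ⟨?_, hc c hW hd⟩, fun c hW hd => ?_, ?_, ?_⟩
  · rw [count_eq_count_sub (hX c hW).2 hu, hζ, count_wl_dbl _ hW hd]
  · rw [count_eq_count_sub (hX c hW).2 hu, hζ, count_wl_lin _ hW hd]
  · have hs : List.Sublist ((wl n ζ).map X) u := hf ▸ List.filter_sublist
    obtain ⟨P, hP⟩ := List.sublist_iff_exists_orderEmbedding_getElem?_eq.1 hs
    refine ⟨ζ, P, fun k l hkl _ => P.lt_iff_lt.2 hkl, fun c k hk => ?_⟩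
    rw [← hP, List.getElem?_map, getElem?_wl.2 hk]; rfl
  · have subA := sub_listA_eq ε hφ
    have subR := sub_listR_eq hφ
    have hv : p ++ sub φ (wl n ε) ++ q = (p ++ sub φ (listP n)) ++ ((listA n ε).map X ++
        (sub φ (listQ n) ++ ((listR n).map X ++ q))) := by
      rw [← subA, ← subR, wl]; simp
    have hlen : ((listA n ε).map X).length = 4 * n + 2 := by simp [length_listA]
    refine ⟨ε, (p ++ sub φ (listP n)).length,
      (p ++ sub φ (listP n)).length + (4 * n + 2 + (sub φ (listQ n)).length), by omega,
      fun c k hk hk' => ?_, fun c k hk => ?_, fun c hW hd => ?_⟩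
    · rw [hv, List.getElem?_append_right (by omega), Nat.add_sub_cancel_left,
        List.getElem?_append_left (by omega), List.getElem?_map, getElem?_listA ε hk,
        getElem?_wl.2 hk']
      rfl
    · have hk2 := getElem?_wl.2 hk
      rw [← getElem?_listR] at hk2
      have hlt : k < ((listR n).map X).length := by
        rw [List.length_map]; exact (List.getElem?_eq_some_iff.1 hk2).1
      rw [hv, List.getElem?_append_right (by omega), List.getElem?_append_right (by omega),
        List.getElem?_append_right (by omega), List.getElem?_append_left (by omega),
        List.getElem?_map, show (p ++ sub φ (listP n)).length + (4 * n + 2 +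
          (sub φ (listQ n)).length) + k - (p ++ sub φ (listP n)).length -
          ((listA n ε).map X).length - (sub φ (listQ n)).length = k by omega, hk2]
      rfl
    · obtain ⟨k, hk⟩ := (inW_iff_occ ε).1 hW
      obtain ⟨k1, k2, hlt, h1, h2, -⟩ := hk.exists_pair hd
      have hb := h1.bounds h2 hlt
      have hmem : c ∈ listP n ++ (listA n ε ++ listQ n) := by
        rw [← take_wl, List.mem_take_iff_getElem]
        obtain ⟨hk1, hk1'⟩ := List.getElem?_eq_some_iff.1 (getElem?_wl.2 h1)
        exact ⟨k1, by omega, hk1'⟩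
      have hXm : X c ∈ p ++ sub φ (listP n) ++ ((listA n ε).map X ++ sub φ (listQ n)) := by
        rw [← subA]
        have : X c ∈ sub φ (listP n ++ (listA n ε ++ listQ n)) :=
          List.mem_flatMap.2 ⟨c, hmem, (hX c hW).1⟩
        simp only [sub_append, List.mem_append] at this ⊢
        tauto
      refine ⟨fst (p ++ sub φ (listP n) ++ ((listA n ε).map X ++ sub φ (listQ n))) (X c), ?_, ?_⟩
      rotate_left
      · rw [hv, show (p ++ sub φ (listP n)) ++ ((listA n ε).map X ++
          (sub φ (listQ n) ++ ((listR n).map X ++ q))) = (p ++ sub φ (listP n) ++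
          ((listA n ε).map X ++ sub φ (listQ n))) ++ ((listR n).map X ++ q) by simp,
          List.getElem?_append_left (fst_lt_length hXm)]
        exact getElem?_fst hXm
      · have := fst_lt_length hXm
        simp only [List.length_append, hlen] at this ⊢
        omega

/-- A word derivable from a word `pφ(w_ξ)q`, where `φ` sends the letters occurring twice to single
letters, is equal in the factor monoid to a word of the same form. -/
theorem form_of_twinFree (hn : 2 ≤ n) (h : DerT n u (p ++ sub φ (wl n ε) ++ q))
    (hr : Rigid n χ φ p q) (hφ : ∀ c, InW n c → Dbl c → φ c = [X c])
    (hc : ∀ c, InW n c → Dbl c → (p ++ sub φ (wl n ε) ++ q).count (X c) = 2)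
    (hX : ∀ c, InW n c → X c ∈ φ c ∧ χ (X c) = [c]) :
    ∃ (p' q' : List Letter) (φ' : Letter → List Letter) (ζ : ℕ → Bool),
      Eq1 n u (p' ++ sub φ' (wl n ζ) ++ q') ∧ Rigid n χ φ' p' q' := by
  have hu : ∀ l ∈ u, χ l = [] ∨ ∃ c, χ l = [c] ∧ l = X c := fun l hl => by
    rcases hr.erased_or hX (h.symm.mem hl) with h | ⟨c, -, h⟩
    · exact Or.inl h
    · exact Or.inr ⟨c, h⟩
  obtain ⟨ζ, hζ⟩ : ∃ ζ, sub χ u = wl n ζ := by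
    rcases h.symm.value (χ := χ) (by rw [hr.sub_eq]; exact fac_wl _ _) with h' | ⟨-, ζ, -, h'⟩
    · exact ⟨ε, by rw [h', hr.sub_eq]⟩
    · exact ⟨ζ, h'⟩
  classical
  set K : Letter → Bool := fun l => decide (χ l ≠ []) with hKdef
  have hK : ∀ l, K l = false ↔ χ l = [] := fun l => by simp [K]
  have hKX : ∀ c, InW n c → K (X c) = true := fun c hW => by
    rw [← Bool.not_eq_false, hK, (hX c hW).2]; simp
  have hinj : ∀ c d, InW n c → InW n d → X c = X d → c = d := fun c d h1 h2 h12 => by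
    have := (hX c h1).2
    rw [h12, (hX d h2).2] at this
    simpa using this.symm
  have hf : u.filter K = (wl n ζ).map X := by rw [filter_eq_map_sub hK hu, hζ]
  have red := reduced_of_twinFree hn h hr hφ hc hX hζ hf
  obtain ⟨A, hA⟩ := exists_listA_eq (n := n) (by omega) ζ
  obtain ⟨B, hB⟩ := exists_listR_eq (n := n) (by omega)
  have hfilter := hf
  rw [wl, hA, hB] at hf
  simp only [List.map_append, List.map_cons, List.map_nil, List.cons_append,
    List.append_assoc, List.nil_append] at hf
  obtain ⟨α₀, u₁, rfl, hα₀, hf⟩ := List.filter_eq_append_iff.1 hf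
  obtain ⟨g₁, u₂, rfl, hg₁, -, hf⟩ := List.filter_eq_cons_iff.1 hf
  obtain ⟨A', u₃, rfl, hA', hf⟩ := List.filter_eq_append_iff.1 hf
  obtain ⟨g₃, u₄, rfl, hg₃, -, hf⟩ := List.filter_eq_cons_iff.1 hf
  obtain ⟨β₀, u₅, rfl, hβ₀, hf⟩ := List.filter_eq_append_iff.1 hf
  obtain ⟨g₅, u₆, rfl, hg₅, -, hf⟩ := List.filter_eq_cons_iff.1 hf
  obtain ⟨m₁, u₇, rfl, hm₁, -, hf⟩ := List.filter_eq_cons_iff.1 hf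
  obtain ⟨B', u₈, rfl, hB', hf⟩ := List.filter_eq_append_iff.1 hf
  obtain ⟨g₈, u₉, rfl, hg₈, -, hf⟩ := List.filter_eq_cons_iff.1 hf
  obtain ⟨m₂, γ, rfl, hm₂, -, hγ⟩ := List.filter_eq_cons_iff.1 hf
  have nil_of : ∀ {g : List Letter}, (∀ l ∈ g, ¬ K l = true) → g.filter K = [] :=
    fun h => List.filter_eq_nil_iff.2 h
  have hW1 : InW n (.aI 1) := Reduced.inW_aI le_rfl (by omega)
  have hW2 : InW n (.bI n) := Reduced.inW_bI (by omega) le_rfl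
  have hW3 : InW n (.y 0) := Reduced.inW_y (by omega)
  have hW4 : InW n (.y n) := Reduced.inW_y le_rfl
  have hα : (α₀ ++ g₁).filter K = (listP n).map X := by simp [hα₀, nil_of hg₁]
  have hs₁ : (X (.aI 1) :: (A' ++ g₃ ++ [X (.bI n)])).filter K = (listA n ζ).map X := by
    simp [hA, hA', nil_of hg₃, hKX _ hW1, hKX _ hW2]
  have hβ : (β₀ ++ g₅).filter K = (listQ n).map X := by simp [hβ₀, nil_of hg₅]
  have hs₂ : X .b :: (X (.y 0) :: (B' ++ g₈ ++ [X (.y n)])).filter K ++ [X .a] =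
      (listR n).map X := by
    simp [hB, hB', nil_of hg₈, hKX _ hW3, hKX _ hW4]
  generalize hα' : α₀ ++ g₁ = α at hα
  generalize hs₁' : X (.aI 1) :: (A' ++ g₃ ++ [X (.bI n)]) = s₁ at hs₁
  generalize hβ' : β₀ ++ g₅ = β at hβ
  generalize hs₂' : X (.y 0) :: (B' ++ g₈ ++ [X (.y n)]) = s₂ at hs₂
  have mem_s₁ : ∀ l ∈ s₁, K l = true → ∃ c ∈ listA n ζ, X c = l := fun l hl hKl => by
    rw [← List.mem_map, ← hs₁, List.mem_filter]; exact ⟨hl, hKl⟩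
  have mem_s₁' : ∀ c ∈ listA n ζ, X c ∈ s₁ := fun c hc => by
    have := List.mem_map_of_mem (f := X) hc
    rw [← hs₁] at this; exact List.mem_of_mem_filter this
  have mem_β : ∀ c ∈ listQ n, X c ∈ β := fun c hc => by
    have := List.mem_map_of_mem (f := X) hc
    rw [← hβ] at this; exact List.mem_of_mem_filter this
  have mem_s₂ : ∀ l ∈ s₂, K l = true → ∃ c ∈ listR n, X c = l := fun l hl hKl => by
    rw [← List.mem_map, ← hs₂]; simp [List.mem_filter, hl, hKl]
  have hγ' : ∀ l ∈ γ, K l = false := fun l hl => by simpa using List.filter_eq_nil_iff.1 hγ l hl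
  have hm₁' : ∀ l ∈ m₁, K l = false := fun l hl => by simpa using hm₁ l hl
  have hm₂' : ∀ l ∈ m₂, K l = false := fun l hl => by simpa using hm₂ l hl
  have not_γ : ∀ l, K l = true → l ∉ γ := fun l hl hl' => by rw [hγ' l hl'] at hl; simp at hl
  have dblA : ∀ c ∈ listA n ζ, InW n c ∧ Dbl c := fun c hc => by
    obtain ⟨k, k1, k2, hk⟩ := exists_occ_of_mem_listA hc
    exact ⟨Reduced.inW_of_occ hk, hk.dbl (Or.inl ⟨k1, k2⟩)⟩
  have dblR : ∀ c ∈ listR n, InW n c ∧ Dbl c := fun c hc => by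
    obtain ⟨k, k1, hk⟩ := exists_occ_of_mem_listR (fun _ => false) hc
    exact ⟨Reduced.inW_of_occ hk, hk.dbl (Or.inr k1)⟩
  have disjPA : ∀ c ∈ listP n, c ∉ listA n ζ := fun c hP hA => by
    obtain ⟨k, k1, hk⟩ := exists_occ_of_mem_listP ζ hP
    obtain ⟨j, j1, j2, hj⟩ := exists_occ_of_mem_listA hA
    have := hk.eq_of_lt hj (by omega) (by omega); omega
  have disjPQ : ∀ c ∈ listP n, c ∉ listQ n := fun c hP hQ => by
    obtain ⟨k, k1, hk⟩ := exists_occ_of_mem_listP ζ hP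
    obtain ⟨j, j1, j2, hj⟩ := exists_occ_of_mem_listQ ζ hQ
    have := hk.eq_of_lt hj (by omega) (by omega); omega
  have inWP : ∀ c ∈ listP n, InW n c := fun c hP => by
    obtain ⟨k, k1, hk⟩ := exists_occ_of_mem_listP ζ hP; exact Reduced.inW_of_occ hk
  have inWQ : ∀ c ∈ listQ n, InW n c := fun c hQ => by
    obtain ⟨k, k1, k2, hk⟩ := exists_occ_of_mem_listQ ζ hQ; exact Reduced.inW_of_occ hk
  have H : Blocks n _ _ X K α s₁ β m₁ s₂ m₂ γ :=
    { red := red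
      eq := by rw [← hα', ← hs₁', ← hβ', ← hs₂']; simp
      foreign := fun l hl c hW hd hlc => by
        have := hKX c hW
        rw [← hlc, hl] at this; simp at this
      marked := hKX
      ends₁ := ⟨_, hs₁'.symm⟩
      ends₂ := ⟨_, hs₂'.symm⟩
      core₁ := fun l hl hKl => by
        obtain ⟨c, hc, rfl⟩ := mem_s₁ l hl hKl
        refine ⟨fun hlα => ?_, not_γ _ hKl, c, (dblA c hc).1, (dblA c hc).2, rfl⟩
        have : X c ∈ (listP n).map X := by rw [← hα, List.mem_filter]; exact ⟨hlα, hKl⟩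
        obtain ⟨d, hd, hdc⟩ := List.mem_map.1 this
        obtain rfl := hinj _ _ (inWP d hd) (dblA c hc).1 hdc
        exact disjPA _ hd hc
      core₂ := fun l hl hKl => by
        obtain ⟨c, hc, rfl⟩ := mem_s₂ l hl hKl
        exact ⟨not_γ _ hKl, c, (dblR c hc).1, (dblR c hc).2, rfl⟩
      a_mem := mem_s₁' _ (by simp [listA])
      b_mem := mem_s₁' _ (by simp [listA])
      bI_mem := by
        have h1 : Letter.bI n ∈ listR n := by
          obtain ⟨k, hk⟩ := (inW_iff_occ ζ).1 hW2
          obtain ⟨p, q, hpq, hp, hq, -⟩ := hk.exists_pair trivial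
          have hb := hp.bounds hq hpq
          refine List.mem_iff_getElem?.2 ⟨q - (12 * n + 5), ?_⟩
          rw [getElem?_listR ζ, getElem?_wl, show 12 * n + 5 + (q - (12 * n + 5)) = q by omega]
          exact hq
        have h2 := List.mem_map_of_mem (f := X) h1
        rw [← hs₂, List.cons_append, List.mem_cons, List.mem_append, List.mem_singleton] at h2
        rcases h2 with h2 | h2 | h2
        · exact absurd (hinj _ _ hW2 Reduced.inW_b h2) (by simp)
        · exact List.mem_of_mem_filter h2
        · exact absurd (hinj _ _ hW2 Reduced.inW_a h2) (by simp)
      y_zero_mem := mem_β _ (by simp [listQ])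
      y_last_mem := mem_β _ (by simp [listQ])
      gap₁ := hm₁'
      gap₂ := hm₂' }
  obtain ⟨r, φ₁, hφ₁, hr₁, hd₁, hc₁⟩ := exists_form_of_filter (χ := χ) (spaced_listP n)
    (nodup_listP n) hα (fun l hl => (hK l).1 hl) (fun c hc => (hX c (inWP c hc)).2)
  have hmid : ((s₁.filter fun l => !K l) ++ β ++ m₁).filter K = (listQ n).map X := by
    have : (s₁.filter fun l => !K l).filter K = [] := by
      rw [List.filter_filter]; simp
    simp [this, hβ, nil_of hm₁]
  obtain ⟨φ₂, hφ₂, hd₂, hc₂⟩ := exists_form_of_filter' (χ := χ) (spaced_listQ n).1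
    (nodup_listQ n) (spaced_listQ n).2 hmid (fun l hl => (hK l).1 hl)
    (fun c hc => (hX c (inWQ c hc)).2)
  set φ' : Letter → List Letter := fun c =>
    if Dbl c then [X c] else if c ∈ listP n then φ₁ c else φ₂ c with hφ'
  have hdbl : ∀ c, Dbl c → φ' c = [X c] := fun c hd => by simp [φ', hd]
  have hP : sub φ' (listP n) = sub φ₁ (listP n) := sub_congr fun c hc => by
    by_cases hd : Dbl c
    · rw [hdbl c hd, hd₁ c hd]
    · simp [φ', hd, hc]
  have hQ : sub φ' (listQ n) = sub φ₂ (listQ n) := sub_congr fun c hc => by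
    by_cases hd : Dbl c
    · rw [hdbl c hd, hd₂ c hd]
    · have : c ∉ listP n := fun h' => disjPQ c h' hc
      simp [φ', hd, this]
  refine ⟨r, (s₂.filter fun l => !K l) ++ m₂ ++ γ, φ', ζ, ?_, hr₁, ?_, fun c hW => ?_⟩
  · have := H.eq1_rearranged
    convert this using 1
    rw [wl, sub_append, sub_append, sub_append, hP, hQ, sub_listA_eq ζ fun c _ => hdbl c,
      sub_listR_eq fun c _ => hdbl c, ← hφ₂, ← hs₁, ← hs₂, hφ₁]
    simp
  · refine sub_eq_nil.2 fun l hl => (hK l).1 ?_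
    simp only [List.mem_append, List.mem_filter, Bool.not_eq_true'] at hl
    rcases hl with (hl | hl) | hl
    · exact hl.2
    · exact hm₂' l hl
    · exact hγ' l hl
  · by_cases hd : Dbl c
    · rw [hdbl c hd]; simpa using (hX c hW).2
    · have hm := (mem_wl (ε := ζ)).2 hW
      simp only [wl, List.mem_append] at hm
      rcases hm with hm | hm | hm | hm
      · simp only [φ', hd, hm, if_true, if_false]; exact hc₁ c hm
      · exact (hd (dblA c hm).2).elim
      · have : c ∉ listP n := fun h' => disjPQ c h' hm
        simp only [φ', hd, this, if_false]; exact hc₂ c hm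
      · exact (hd (dblR c hm).2).elim

end TwinFree
section NormalForm

variable {n : ℕ} {u p q : List Letter} {χ φ : Letter → List Letter} {ε : ℕ → Bool}

theorem Fac.eq_nil_of_count (H : Fac n (sub χ u)) {e : Letter} (he : 3 ≤ u.count e) :
    χ e = [] := by
  rcases H.split with h | ⟨a, l, b, rfl, hl, h⟩
  · exact h e (by omega)
  · by_contra hne
    obtain ⟨h1, h2⟩ := h e (by omega) hne
    by_cases hel : e = l
    · subst hel; omega
    · rw [List.count_append, List.count_cons_of_ne (Ne.symm hel)] at he
      omega

theorem count_sub_congr {φ' : Letter → List Letter} {e : Letter}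
    (h : ∀ c, (φ c).count e = (φ' c).count e) (w : List Letter) :
    (sub φ w).count e = (sub φ' w).count e := by
  induction w with
  | nil => rfl
  | cons c w ih => simp [h, ih]

/-- Letters occurring three times or more do not contribute to nonzero values, so that they may be
removed from the images of the letters of `w_ξ` that occur twice. -/
theorem Rigid.exists_count_eq_two (hr : Rigid n χ φ p q) (ε : ℕ → Bool) :
    ∃ (φ' : Letter → List Letter) (q' : List Letter),
      Eq1 n (p ++ sub φ (wl n ε) ++ q) (p ++ sub φ' (wl n ε) ++ q') ∧ Rigid n χ φ' p q' ∧
      ∀ c, InW n c → Dbl c → ∀ e ∈ φ' c, (p ++ sub φ' (wl n ε) ++ q').count e = 2 := by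
  classical
  set f := p ++ sub φ (wl n ε) ++ q with hf
  set J := f.filter fun e => decide (3 ≤ f.count e) with hJ
  set φ' : Letter → List Letter := fun c =>
    if InW n c ∧ Dbl c then (φ c).filter fun e => decide (f.count e = 2) else φ c with hφ'
  have two : ∀ c, InW n c → Dbl c → ∀ e ∈ φ c, 2 ≤ f.count e := by
    intro c hW hd e he
    have h2 := count_wl_dbl ε hW hd
    obtain ⟨a, b, d, hw⟩ := two_le_count_iff.1 h2.ge
    have he1 : 0 < (φ c).count e := List.count_pos_iff.2 he
    simp only [hf, hw, sub_append, sub_cons, List.count_append]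
    omega
  have erased : ∀ ψ : Letter → List Letter, (∀ e, 3 ≤ f.count e → ψ e = []) →
      (∀ c, sub ψ (φ' c) = sub ψ (φ c) ∨ ¬ InW n c) ∧ sub ψ J = [] := by
    intro ψ hψ
    refine ⟨fun c => ?_, sub_eq_nil.2 fun e he => hψ e ?_⟩
    · by_cases hc : InW n c ∧ Dbl c
      · left
        simp only [φ', hc, and_self, if_true]
        refine (sub_eq_sub_filter fun e he hK => hψ e ?_).symm
        have := two c hc.1 hc.2 e he
        have : f.count e ≠ 2 := by simpa using hK
        omega
      · left; simp only [φ', hc, if_false]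
    · simpa using (List.mem_filter.1 he).2
  have sub_eq : ∀ ψ : Letter → List Letter, (∀ e, 3 ≤ f.count e → ψ e = []) →
      sub ψ (p ++ sub φ' (wl n ε) ++ (q ++ J)) = sub ψ f := by
    intro ψ hψ
    obtain ⟨h1, h2⟩ := erased ψ hψ
    simp only [hf, sub_append, h2, List.append_nil, sub_sub]
    rw [sub_congr fun c hc => (h1 c).resolve_right fun h => h (mem_wl.1 hc)]
  refine ⟨φ', q ++ J, fun ψ hψ => ?_, ?_, fun c hW hd e he => ?_⟩
  · refine (sub_eq ψ fun e he => ?_).symm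
    rcases hψ with hψ | hψ
    · exact hψ.eq_nil_of_count he
    · refine hψ.eq_nil_of_count ?_
      have : J.count e = f.count e := List.count_filter (by simpa using he)
      simp only [List.count_append, this]
      omega
  · have h0 : ∀ e, 3 ≤ f.count e → χ e = [] := fun e he =>
      Fac.eq_nil_of_count (n := n) (by rw [hr.sub_eq]; exact fac_wl n ε) he
    obtain ⟨h1, h2⟩ := erased χ h0
    exact ⟨hr.1, by rw [sub_append, hr.2.1, h2]; rfl, fun c hc =>
      ((h1 c).resolve_right fun h => h hc).trans (hr.2.2 c hc)⟩
  · simp only [φ', hW, hd, and_self, if_true, List.mem_filter, decide_eq_true_eq] at he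
    rw [← he.2, hf]
    have hJ0 : J.count e = 0 := by
      refine List.count_eq_zero.2 fun h => ?_
      have := (List.mem_filter.1 h).2
      simp [he.2] at this
    have := count_sub_congr (φ := φ') (φ' := φ) (e := e) (fun c => by
      by_cases hc : InW n c ∧ Dbl c
      · simp only [φ', hc, and_self, if_true]
        exact List.count_filter (by simpa using he.2)
      · simp only [φ', hc, if_false]) (wl n ε)
    simp only [List.count_append, this, hJ0]
    omega

/-- A letter that occurs twice in `pφ(w_ξ)q` and is in the image of a letter `c` occurring twice in
`w_ξ` occurs once in `φ(c)` and nowhere else in `p`, `q` and the images of letters. -/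
theorem eq_of_count_eq_two {c d e : Letter} (hW : InW n c) (hd : Dbl c) (he : e ∈ φ c)
    (hc : (p ++ sub φ (wl n ε) ++ q).count e = 2) :
    (φ c).count e = 1 ∧ e ∉ p ∧ e ∉ q ∧ (InW n d → e ∈ φ d → d = c) := by
  have h2 := count_wl_dbl ε hW hd
  have hp : (wl n ε).Perm (c :: c :: ((wl n ε).erase c).erase c) := by
    have m1 : c ∈ wl n ε := mem_wl.2 hW
    have m2 : c ∈ (wl n ε).erase c := List.count_pos_iff.1 (by rw [List.count_erase_self]; omega)
    exact (List.perm_cons_erase m1).trans ((List.perm_cons_erase m2).cons c)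
  have hs : (sub φ (wl n ε)).count e = (φ c).count e + ((φ c).count e +
      (sub φ (((wl n ε).erase c).erase c)).count e) := by
    have : (sub φ (wl n ε)).Perm (sub φ (c :: c :: ((wl n ε).erase c).erase c)) :=
      hp.flatMap_right φ
    rw [this.count_eq]; simp
  have he1 : 0 < (φ c).count e := List.count_pos_iff.2 he
  simp only [List.count_append] at hc
  refine ⟨by omega, List.count_eq_zero.1 (by omega), List.count_eq_zero.1 (by omega),
    fun hWd hed => ?_⟩
  by_contra hdc
  have hm : d ∈ ((wl n ε).erase c).erase c :=
    (List.mem_erase_of_ne hdc).2 ((List.mem_erase_of_ne hdc).2 (mem_wl.2 hWd))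
  have : e ∈ sub φ (((wl n ε).erase c).erase c) := List.mem_flatMap.2 ⟨d, hm, hed⟩
  have := List.count_pos_iff.2 this
  omega

/-- If a substitution is rigid for a word `pφ(w_ξ)q`, then every word derivable from it is equal
in the factor monoid to a word of this kind for which the substitution is rigid. -/
theorem DerT.exists_form (hn : 2 ≤ n) (h : DerT n u (p ++ sub φ (wl n ε) ++ q))
    (hr : Rigid n χ φ p q) :
    ∃ (p' q' : List Letter) (φ' : Letter → List Letter) (ζ : ℕ → Bool),
      Eq1 n u (p' ++ sub φ' (wl n ζ) ++ q') ∧ Rigid n χ φ' p' q' := by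
  classical
  obtain ⟨φ₁, q₁, heq, hr₁, h2⟩ := hr.exists_count_eq_two ε
  replace h := Der.trans h (Der.of_eq1 heq)
  clear heq hr
  revert h hr₁ h2
  generalize φ₁ = φ, q₁ = q
  intro hr h2 h
  set f := p ++ sub φ (wl n ε) ++ q with hf
  have hX' : ∀ c, ∃ e, InW n c → e ∈ φ c ∧ χ e = [c] := fun c => by
    by_cases hc : InW n c
    · obtain ⟨e, h1, h2⟩ := exists_mem_of_sub_eq_singleton (hr.2.2 c hc)
      exact ⟨e, fun _ => ⟨h1, h2⟩⟩
    · exact ⟨c, fun h => (hc h).elim⟩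
  choose X hX using hX'
  have uniq : ∀ c d e, InW n c → Dbl c → InW n d → e ∈ φ c → e ∈ φ d → d = c :=
    fun c d e hc hd hWd he hed => (eq_of_count_eq_two hc hd he (h2 c hc hd e he)).2.2.2 hWd hed
  -- `T e` says that `e` is a superfluous letter of the image of a letter occurring twice.
  set T : Letter → Prop := fun e => ∃ c, InW n c ∧ Dbl c ∧ e ∈ φ c ∧ e ≠ X c with hT
  set ρ : Letter → List Letter := fun e => if T e then [] else [e] with hρ
  set σ : Letter → List Letter := fun e =>
    if h : ∃ c, InW n c ∧ Dbl c ∧ e = X c then φ h.choose else [e] with hσ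
  have σX : ∀ c, InW n c → Dbl c → σ (X c) = φ c := fun c hW hd => by
    have hex : ∃ d, InW n d ∧ Dbl d ∧ X c = X d := ⟨c, hW, hd, rfl⟩
    have key : ∀ d, InW n d → X c = X d → X c ∈ φ d := fun d h1 h2 => by
      rw [h2]; exact (hX d h1).1
    have hs := hex.choose_spec
    have : hex.choose = c :=
      uniq c _ (X c) hW hd hs.1 (hX c hW).1 (key _ hs.1 hs.2.2)
    simp only [σ, dif_pos hex, this]
  have TX : ∀ c, InW n c → ¬ T (X c) := by
    rintro c hW ⟨d, hWd, hdd, hm, hne⟩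
    exact hne (by rw [uniq d c _ hWd hdd hW hm (hX c hW).1])
  have Tχ : ∀ e, T e → χ e = [] := by
    rintro e ⟨c, hW, hd, he, hne⟩
    refine (eq_nil_or_of_sub_eq_singleton (hr.2.2 c hW) he).resolve_right fun h' => hne ?_
    exact eq_of_sub_eq_singleton (hr.2.2 c hW) he (hX c hW).1 h' (hX c hW).2
  have χρ : ∀ l, sub χ (sub ρ l) = sub χ l := fun l => by
    rw [sub_sub]
    refine sub_congr fun e _ => ?_
    by_cases hTe : T e
    · simp [ρ, hTe, Tχ e hTe]
    · simp [ρ, hTe]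
  have χσ : ∀ l, sub χ (sub σ l) = sub χ l := fun l => by
    rw [sub_sub]
    refine sub_congr fun e _ => ?_
    by_cases hex : ∃ c, InW n c ∧ Dbl c ∧ e = X c
    · obtain ⟨c, hW, hd, rfl⟩ := hex
      rw [σX c hW hd, hr.2.2 c hW, (hX c hW).2]
    · simp [σ, hex]
  have ρφ : ∀ c, InW n c → Dbl c → sub ρ (φ c) = [X c] := fun c hW hd => by
    obtain ⟨a, b, hab⟩ := List.append_of_mem (hX c hW).1
    have hc1 := (eq_of_count_eq_two (d := c) hW hd (hX c hW).1 (h2 c hW hd _ (hX c hW).1)).1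
    rw [hab, List.count_append, List.count_cons_self] at hc1
    have ha : ∀ e ∈ a, ρ e = [] := fun e he => if_pos ⟨c, hW, hd, by simp [hab, he], by
      rintro rfl; exact List.count_eq_zero.1 (by omega : a.count (X c) = 0) he⟩
    have hb : ∀ e ∈ b, ρ e = [] := fun e he => if_pos ⟨c, hW, hd, by simp [hab, he], by
      rintro rfl; exact List.count_eq_zero.1 (by omega : b.count (X c) = 0) he⟩
    have hx : ρ (X c) = [X c] := if_neg (TX c hW)
    rw [hab, sub_append, sub_cons, sub_eq_nil.2 ha, sub_eq_nil.2 hb, hx]; rfl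
  set τ : Letter → List Letter := fun l => sub σ (ρ l) with hτ
  have τfix : ∀ e, (∀ c, InW n c → Dbl c → e ∉ φ c) → τ e = [e] := fun e he => by
    have h1 : ¬ T e := fun ⟨c, hW, hd, hm, _⟩ => he c hW hd hm
    have h2 : ¬ ∃ c, InW n c ∧ Dbl c ∧ e = X c := fun ⟨c, hW, hd, hec⟩ =>
      he c hW hd (hec ▸ (hX c hW).1)
    simp [τ, ρ, σ, h1, h2]
  have τφ : ∀ c, InW n c → Dbl c → sub τ (φ c) = φ c := fun c hW hd => by
    rw [hτ, ← sub_sub, ρφ c hW hd, sub_cons, σX c hW hd]; simp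
  have outside : ∀ e, (e ∈ p ∨ e ∈ q ∨ ∃ d, InW n d ∧ ¬ Dbl d ∧ e ∈ φ d) →
      ∀ c, InW n c → Dbl c → e ∉ φ c := by
    intro e he c hW hd hec
    have hu := fun d => eq_of_count_eq_two (d := d) hW hd hec (h2 c hW hd e hec)
    rcases he with he | he | ⟨d, hWd, hdd, hed⟩
    · exact (hu c).2.1 he
    · exact (hu c).2.2.1 he
    · exact hdd ((hu d).2.2.2 hWd hed ▸ hd)
  -- Two substitutions that agree on the letters outside the images of the letters occurring twice,
  -- and on these images, have the same value on `f`.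
  have sub_f : ∀ ψ ψ' : Letter → List Letter,
      (∀ e, (∀ c, InW n c → Dbl c → e ∉ φ c) → ψ e = ψ' e) →
      (∀ c, InW n c → Dbl c → sub ψ (φ c) = sub ψ' (φ c)) → sub ψ f = sub ψ' f := by
    intro ψ ψ' h1 h2
    simp only [hf, sub_append, sub_sub]
    congr 1
    · congr 1
      · exact sub_congr fun e he => h1 e (outside e (Or.inl he))
      · refine sub_congr fun c hc => ?_
        have hW := mem_wl.1 hc
        by_cases hd : Dbl c
        · exact h2 c hW hd
        · exact sub_congr fun e he => h1 e (outside e (Or.inr (Or.inr ⟨c, hW, hd, he⟩)))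
    · exact sub_congr fun e he => h1 e (outside e (Or.inr (Or.inl he)))
  have τf : sub τ f = f := by
    refine (sub_f τ (fun l => [l]) τfix fun c hW hd => ?_).trans (sub_singleton f)
    rw [τφ c hW hd, sub_singleton]
  -- The words `u` and `τ(u)` have the same value: along a derivation from `f`, a substitution and
  -- its composition with `τ` are compared through their hybrid.
  have hτu : DerT n (sub τ u) f := by
    have := h.sub τ
    rwa [τf] at this
  have hEq : Eq1 n u (sub τ u) := by
    intro ψ hψ
    have hF : Fac n (sub ψ f) := hψ.elim (fun hψ => DerT.fac h hψ) fun hψ => DerT.fac hτu hψ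
    rw [sub_sub]
    set ψ' : Letter → List Letter := fun l => sub ψ (τ l) with hψ'
    have ψfix : ∀ e, (∀ c, InW n c → Dbl c → e ∉ φ c) → ψ' e = ψ e := fun e he => by
      simp [ψ', τfix e he]
    have short : ∀ c, InW n c → Dbl c → ∃ d, sub ψ (φ c) = [] ∨ sub ψ (φ c) = [d] := by
      intro c hW hd
      have hF' : Fac n (sub (fun l => sub ψ (φ l)) (wl n ε)) := by
        refine Fac.of_append (sub ψ p) (sub ψ q) ?_
        simpa [hf, sub_sub] using hF
      have := hF'.length_le_one (count_wl_dbl ε hW hd).ge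
      match hl : sub ψ (φ c), this with
      | [], _ => exact ⟨c, Or.inl rfl⟩
      | [d], _ => exact ⟨d, Or.inr rfl⟩
    have values : ∀ c, InW n c → Dbl c → ∃ d, (sub ψ (φ c) = [] ∨ sub ψ (φ c) = [d]) ∧
        ∀ l ∈ φ c, (ψ l = [] ∨ (ψ l = [d] ∧ sub ψ (φ c) = [d])) ∧
          (ψ' l = [] ∨ (ψ' l = [d] ∧ sub ψ (φ c) = [d])) := by
      intro c hW hd
      obtain ⟨d, hd'⟩ := short c hW hd
      refine ⟨d, hd', fun l hl => ⟨?_, ?_⟩⟩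
      · rcases hd' with h0 | h1
        · exact Or.inl (sub_eq_nil.1 h0 l hl)
        · exact (eq_nil_or_of_sub_eq_singleton h1 hl).imp_right fun h => ⟨h, h1⟩
      · by_cases hlX : l = X c
        · subst hlX
          have : ψ' (X c) = sub ψ (φ c) := by
            simp only [ψ', τ, ρ, TX c hW, if_false, sub_cons, σX c hW hd, sub_nil, List.append_nil]
          rw [this]
          exact hd'.imp_right fun h => ⟨h, h⟩
        · left
          have : T l := ⟨c, hW, hd, hl, hlX⟩
          simp [ψ', τ, ρ, this]
    refine DerT.eq_of_hybrid hn (DerT.symm h) hF (fun l hl => ?_) ?_ ?_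
    · by_cases hex : ∃ c, InW n c ∧ Dbl c ∧ l ∈ φ c
      · obtain ⟨c, hW, hd, hl⟩ := hex
        obtain ⟨d, -, hd'⟩ := values c hW hd
        exact Or.inr ⟨d, (hd' l hl).1.imp_right And.left, (hd' l hl).2.imp_right And.left⟩
      · exact Or.inl (ψfix l fun c hW hd hl => hex ⟨c, hW, hd, hl⟩).symm
    · refine sub_f _ _ (fun e he => ?_) fun c hW hd => ?_
      · rw [hybrid, ψfix e he, ite_self]
      · obtain ⟨d, hd', hl⟩ := values c hW hd
        have hx0 : ¬ IsX 1 [] := by simp [IsX]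
        by_cases hx : IsX 1 [d]
        · refine sub_congr fun l hlc => ?_
          obtain ⟨h1, h2⟩ := hl l hlc
          rw [hybrid]
          rcases h1 with h1 | ⟨h1, -⟩ <;> rcases h2 with h2 | ⟨h2, -⟩ <;> simp [h1, h2, hx, hx0]
        · have : sub ψ' (φ c) = sub ψ (φ c) := by rw [hψ', ← sub_sub, τφ c hW hd]
          rw [← this]
          refine sub_congr fun l hlc => ?_
          obtain ⟨h1, h2⟩ := hl l hlc
          rw [hybrid]
          rcases h1 with h1 | ⟨h1, -⟩ <;> rcases h2 with h2 | ⟨h2, -⟩ <;> simp [h1, h2, hx, hx0]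
    · rw [hψ', ← sub_sub, τf]
  have hρu : DerT n (sub ρ u) (sub ρ p ++ sub (fun c => sub ρ (φ c)) (wl n ε) ++ sub ρ q) := by
    have := h.sub ρ
    simpa [hf, sub_sub] using this
  have hρr : Rigid n χ (fun c => sub ρ (φ c)) (sub ρ p) (sub ρ q) :=
    ⟨by rw [χρ, hr.1], by rw [χρ, hr.2.1], fun c hc => by rw [χρ, hr.2.2 c hc]⟩
  have ρX : ∀ c, InW n c → ρ (X c) = [X c] := fun c hW => if_neg (TX c hW)
  obtain ⟨p', q', φ', ζ, hE, hr'⟩ := form_of_twinFree (X := X) hn hρu hρr ρφ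
    (fun c hW hd => by
      rw [← sub_sub, ← sub_append, ← sub_append]
      refine Eq.trans ?_ (h2 c hW hd (X c) (hX c hW).1)
      rw [← hf]
      conv_rhs => rw [← sub_singleton f]
      refine count_sub_congr (fun e => ?_) f
      by_cases hTe : T e
      · have : e ≠ X c := by rintro rfl; exact TX c hW hTe
        simp [ρ, hTe, this]
      · simp [ρ, hTe])
    (fun c hW => ⟨List.mem_flatMap.2 ⟨X c, (hX c hW).1, by rw [ρX c hW]; simp⟩, (hX c hW).2⟩)
  refine ⟨sub σ p', sub σ q', fun c => sub σ (φ' c), ζ, hEq.trans ?_, ?_⟩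
  · have := hE.sub σ
    simpa [hτ, sub_sub] using this
  · exact ⟨by rw [χσ, hr'.1], by rw [χσ, hr'.2.1], fun c hc => by rw [χσ, hr'.2.2 c hc]⟩

end NormalForm
/-! ### Derivations from a prescribed relation -/

section Derivations

variable {n : ℕ} {R : List Letter → List Letter → Prop} {u v : List Letter}

/-- The words `pφ(w_ξ)q` met along a derivation account for all changes of values. -/
theorem DerT.exists_forms (h : DerT n u v) :
    ∃ L : List (List Letter × (Letter → List Letter) × List Letter × (ℕ → Bool)),
      (∀ f ∈ L, DerT n u (f.1 ++ sub f.2.1 (wl n f.2.2.2) ++ f.2.2.1)) ∧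
      ∀ χ : Letter → List Letter, Fac n (sub χ u) → sub χ u ≠ sub χ v →
        ∃ f ∈ L, Rigid n χ f.2.1 f.1 f.2.2.1 := by
  induction h with
  | refl => exact ⟨[], by simp, fun χ _ h => (h rfl).elim⟩
  | @tail b c hb hc ih =>
    obtain ⟨L, hL, hL'⟩ := ih
    rcases hc with hc | ⟨p, q, φ, ε, η, -, rfl, rfl⟩
    · refine ⟨L, hL, fun χ hF hne => hL' χ hF ?_⟩
      rwa [hc χ (Or.inl (DerT.fac hb hF))]
    · refine ⟨(p, φ, q, ε) :: L, ?_, fun χ hF hne => ?_⟩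
      · simp only [List.mem_cons, forall_eq_or_imp]; exact ⟨hb, hL⟩
      · by_cases he : sub χ u = sub χ (p ++ sub φ (wl n ε) ++ q)
        · rcases (he ▸ hF).rigid_or_collapse with hr | hcol
          · exact ⟨_, List.mem_cons_self, hr⟩
          · exact (hne (by rw [he, hcol η])).elim
        · obtain ⟨f, hf, hr⟩ := hL' χ hF he
          exact ⟨f, List.mem_cons_of_mem _ hf, hr⟩

/-- If `u ≈ v` is derivable from all identities `w_ξ ≈ w_η`, then it is derivable from those that
are among its consequences by substitution. The words `pφ(w_ξ)q` that account for the changes of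
values are treated one at a time: all rigid substitutions for such a word have the same values on
`u` and the same on `v`, and a single step from `w_ξ` to `w_η` brings these together. -/
theorem DerT.der (hn : 2 ≤ n) (hR : ∀ a, R a a) (h : DerT n u v)
    (H : ∀ (χ : Letter → List Letter) (ξ η : ℕ → Bool), sub χ u = wl n ξ → sub χ v = wl n η →
      R (wl n ξ) (wl n η)) : Der n R u v := by
  obtain ⟨L, hL, hL'⟩ := h.exists_forms
  induction L generalizing u with
  | nil =>
    refine Der.of_eq1 fun χ hχ => ?_
    by_contra hne
    obtain ⟨f, hf, -⟩ := hL' χ (hχ.elim id (h.symm.fac ·)) hne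
    simp at hf
  | cons f L ih =>
    have hLu := fun g hg => hL g (List.mem_cons_of_mem _ hg)
    by_cases hex : ∃ χ, Fac n (sub χ u) ∧ sub χ u ≠ sub χ v ∧ Rigid n χ f.2.1 f.1 f.2.2.1
    · obtain ⟨χ₀, hF, hne, hr⟩ := hex
      have hf := hL f List.mem_cons_self
      obtain ⟨η, hη⟩ : ∃ η, sub χ₀ v = wl n η := by
        rcases h.value hF with h' | ⟨-, η, -, h'⟩
        · exact (hne h'.symm).elim
        · exact ⟨η, h'⟩
      obtain ⟨p, q, φ, ζ, hE, hr'⟩ := hf.exists_form hn hr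
      have hζ : sub χ₀ u = wl n ζ := by rw [hE χ₀ (Or.inl hF), hr'.sub_eq]
      have hu1 : Der n R u (p ++ sub φ (wl n η) ++ q) :=
        (Der.of_eq1 hE).trans (Der.of_form (H χ₀ ζ η hζ hη) p φ q)
      have h1v : DerT n (p ++ sub φ (wl n η) ++ q) v := (hu1.toT.symm).trans h
      have hform : DerT n (p ++ sub φ (wl n ζ) ++ q) v :=
        Der.trans (Der.of_eq1 hE.symm) h
      -- Rigid substitutions have the value `w_η` on both sides; the other ones do not notice the
      -- change from `u` to the new word.
      have key : ∀ χ, Fac n (sub χ (p ++ sub φ (wl n η) ++ q)) →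
          sub χ (p ++ sub φ (wl n η) ++ q) = sub χ v ∨
          sub χ (p ++ sub φ (wl n η) ++ q) = sub χ u := by
        intro χ hχ
        rcases hχ.rigid_or_collapse with hrig | hcol
        · left
          rw [hrig.sub_eq, hform.rigid_value_eq hn hrig hr', hη]
        · right
          rw [hE χ (Or.inl (hu1.toT.symm.fac hχ)), hcol ζ]
      refine hu1.trans (ih h1v (fun χ ξ η' h1 h2 => ?_) (fun g hg => ?_) fun χ hχ hne' => ?_)
      · rcases key χ (h1 ▸ fac_wl n ξ) with h' | h'
        · rw [← h1, ← h2, h']; exact hR _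
        · exact H χ ξ η' (h' ▸ h1) h2
      · exact hu1.toT.symm.trans (hLu g hg)
      · have h' := (key χ hχ).resolve_left hne'
        obtain ⟨g, hg, hrg⟩ := hL' χ (h' ▸ hχ) (h' ▸ hne')
        rcases List.mem_cons.1 hg with rfl | hg
        · refine (hne' ?_).elim
          have e1 := (show DerT n _ _ from hf.symm.trans hu1.toT).rigid_value_eq hn hrg hr
          have e2 := (show DerT n _ _ from hf.symm.trans h).rigid_value_eq hn hrg hr
          rw [e1, e2, hη, hr'.sub_eq]
        · exact ⟨g, hg, hrg⟩
    · refine ih h H hLu fun χ hF hne => ?_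
      obtain ⟨g, hg, hr⟩ := hL' χ hF hne
      rcases List.mem_cons.1 hg with rfl | hg
      · exact (hex ⟨χ, hF, hne, hr⟩).elim
      · exact ⟨g, hg, hr⟩

end Derivations
/-! ### The factor monoid of `W_n` -/

section Bridge

open FreeMonoid

theorem toList_wordProd {n : ℕ} {f : Fin n → Word} {g : ℕ → List Letter}
    (h : ∀ i : Fin n, toList (f i) = g i) :
    toList (wordProd n f) = (List.range n).flatMap g := by
  rw [wordProd, toList_prod, List.map_ofFn, List.flatMap_def]
  congr 1
  refine List.ext_getElem (by simp) fun i h1 h2 => ?_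
  simp [h]

/-- The encoding of an element of `S₂ⁿ` by Boolean values: the index `i` between `1` and `n` has the
value `true` iff the `i`-th permutation is the transposition. -/
def code {n : ℕ} (ξ : Fin n → Equiv.Perm (Fin 2)) (i : ℕ) : Bool :=
  if h : i - 1 < n then decide (ξ ⟨i - 1, h⟩ 0 = 1) else false

theorem toList_wordW {n : ℕ} (ξ : Fin n → Equiv.Perm (Fin 2)) :
    toList (wordW ξ) = wl n (code ξ) := by
  have hx : ∀ i : Fin n, toList ((Letter.x (ξ i 0) (i + 1)).w * (Letter.x (ξ i 1) (i + 1)).w) =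
      (fun k => xPair (code ξ (k + 1)) (k + 1)) i := by
    intro i
    have hc : code ξ (i + 1) = decide (ξ i 0 = 1) := by simp [code]
    have hne : ξ i 0 ≠ ξ i 1 := (ξ i).injective.ne (by decide)
    rw [toList_mul, toList_of, toList_of]
    simp only [hc]
    generalize ξ i 0 = j at hne
    generalize ξ i 1 = k at hne
    fin_cases j <;> fin_cases k <;> simp_all [xPair]
  have h0 : toList (wordProd n fun i : Fin n => (Letter.z (i + 1)).w * (Letter.tI (i + 1)).w) =
      (List.range n).flatMap fun i => [.z (i + 1), .tI (i + 1)] := toList_wordProd fun i => rfl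
  have h1 : toList (wordProd n fun i : Fin n => (Letter.zP (i + 1)).w * (Letter.tP (i + 1)).w) =
      (List.range n).flatMap fun i => [.zP (i + 1), .tP (i + 1)] := toList_wordProd fun i => rfl
  have h2 : toList (wordProd n fun i : Fin n => (Letter.zPP (i + 1)).w * (Letter.tPP (i + 1)).w) =
      (List.range n).flatMap fun i => [.zPP (i + 1), .tPP (i + 1)] := toList_wordProd fun i => rfl
  have h3 : toList (wordProd n fun i : Fin n => (Letter.aI (i + 1)).w) =
      (List.range n).flatMap fun i => [.aI (i + 1)] := toList_wordProd fun i => rfl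
  have h4 : toList (wordProd n fun i : Fin n => (Letter.bI (i + 1)).w) =
      (List.range n).flatMap fun i => [.bI (i + 1)] := toList_wordProd fun i => rfl
  have h5 : toList (wordProd (n + 1) fun i : Fin (n + 1) => (Letter.s i).w * (Letter.y i).w) =
      (List.range (n + 1)).flatMap fun i => [.s i, .y i] := toList_wordProd fun i => rfl
  have h6 : toList (wordProd n fun i : Fin n =>
      (Letter.x 0 (i + 1)).w * (Letter.z (i + 1)).w * (Letter.aI (i + 1)).w *
      (Letter.zP (i + 1)).w * (Letter.bI (i + 1)).w * (Letter.zPP (i + 1)).w *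
      (Letter.x 1 (i + 1)).w * (Letter.y (i + 1)).w) =
      (List.range n).flatMap fun i =>
      [.x 0 (i + 1), .z (i + 1), .aI (i + 1), .zP (i + 1), .bI (i + 1), .zPP (i + 1),
        .x 1 (i + 1), .y (i + 1)] := toList_wordProd fun i => rfl
  have h7 : toList (wordProd n fun i : Fin n =>
      (Letter.x (ξ i 0) (i + 1)).w * (Letter.x (ξ i 1) (i + 1)).w) =
      (List.range n).flatMap fun i => xPair (code ξ (i + 1)) (i + 1) := toList_wordProd hx
  simp only [wordW, wordP, wordQ, wordR, toList_mul, toList_of, wl, listP, listA, listQ, listR,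
    List.singleton_append, List.append_assoc, List.cons_append, List.nil_append] at *
  rw [h0, h1, h2, h3, h4, h5, h6, h7]

theorem exists_code (n : ℕ) (ε : ℕ → Bool) :
    ∃ ξ : Fin n → Equiv.Perm (Fin 2), wl n (code ξ) = wl n ε := by
  refine ⟨fun i => if ε (i + 1) then Equiv.swap 0 1 else 1, wl_congr fun i h1 h2 => ?_⟩
  have h : i - 1 < n := by omega
  have hi : i - 1 + 1 = i := by omega
  simp only [code, h, dif_pos, hi]
  cases ε i <;> simp

theorem mem_wordSet {n : ℕ} {w : Word} : w ∈ wordSet n ↔ ∃ ε, toList w = wl n ε := by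
  constructor
  · rintro ⟨ξ, rfl⟩
    exact ⟨_, toList_wordW ξ⟩
  · rintro ⟨ε, h⟩
    obtain ⟨ξ, hξ⟩ := exists_code n ε
    exact ⟨ξ, toList.injective (by rw [h, ← hξ, ← toList_wordW])⟩

theorem isFactorOfSet_iff {n : ℕ} {u : Word} : IsFactorOfSet (wordSet n) u ↔ Fac n (toList u) := by
  constructor
  · rintro (rfl | ⟨w, hw, p, q, h⟩)
    · exact fac_nil n
    · obtain ⟨ε, hε⟩ := mem_wordSet.1 hw
      exact ⟨ε, toList p, toList q, by rw [← hε, h]; rfl⟩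
  · rintro ⟨ε, g, h, H⟩
    exact Or.inr ⟨ofList (wl n ε), mem_wordSet.2 ⟨ε, rfl⟩, ofList g, ofList h, by
      rw [H]; rfl⟩

theorem toList_lift (χ : Letter → Word) (u : Word) :
    toList (lift χ u) = sub (fun l => toList (χ l)) (toList u) := by
  rw [lift_apply, toList_prod, List.map_map]; rfl

variable {n : ℕ}

open Classical in
/-- The homomorphism from words to the factor monoid of `W` that annihilates the words that are
not factors of words in `W`. -/
noncomputable def factorHom (W : Set Word) : Word →* FactorMonoid W where
  toFun u := if h : IsFactorOfSet W u then .factor u h else .zero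
  map_one' := dif_pos (Or.inl rfl)
  map_mul' u v := by
    change _ = FactorMonoid.mul _ _
    by_cases h : IsFactorOfSet W (u * v)
    · simp [h, h.left, h.right, FactorMonoid.mul]
    · by_cases hu : IsFactorOfSet W u <;> by_cases hv : IsFactorOfSet W v <;>
        simp [h, hu, hv, FactorMonoid.mul]

theorem factorHom_of_factor {W : Set Word} {u : Word} (h : IsFactorOfSet W u) :
    factorHom W u = .factor u h := dif_pos h

theorem factorHom_of_not_factor {W : Set Word} {u : Word} (h : ¬ IsFactorOfSet W u) :
    factorHom W u = .zero := dif_neg h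

theorem factorHom_surjective : Function.Surjective (factorHom (wordSet n)) := by
  rintro (_ | ⟨u, hu⟩)
  · refine ⟨ofList (List.replicate (20 * n + 9) .a), dif_neg fun h => ?_⟩
    have := length_le_of_fac (isFactorOfSet_iff.1 h)
    simp at this
  · exact ⟨u, factorHom_of_factor hu⟩

theorem factorHom_eq_iff {u v : Word} : factorHom (wordSet n) u = factorHom (wordSet n) v ↔
    (Fac n (toList u) ∨ Fac n (toList v) → u = v) := by
  simp only [← isFactorOfSet_iff]
  by_cases hu : IsFactorOfSet (wordSet n) u <;> by_cases hv : IsFactorOfSet (wordSet n) v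
  · simp [factorHom_of_factor hu, factorHom_of_factor hv, hu]
  · simp only [factorHom_of_factor hu, factorHom_of_not_factor hv, hu, true_or, forall_const,
      reduceCtorEq, false_iff]
    rintro rfl; exact hv hu
  · simp only [factorHom_of_not_factor hu, factorHom_of_factor hv, hv, or_true, forall_const,
      reduceCtorEq, false_iff]
    rintro rfl; exact hu hv
  · simp [factorHom_of_not_factor hu, factorHom_of_not_factor hv, hu, hv]

/-- The relation `Eq1` is the equational theory of the factor monoid. -/
theorem satisfies_factorMonoid_iff {e : Identity} :
    Satisfies (FactorMonoid (wordSet n)) e ↔ Eq1 n (toList e.1) (toList e.2) := by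
  constructor
  · intro h χ hχ
    have h1 := h fun l => factorHom (wordSet n) (ofList (χ l))
    have h2 : ∀ w, lift (fun l => factorHom (wordSet n) (ofList (χ l))) w =
        factorHom (wordSet n) (lift (fun l => ofList (χ l)) w) :=
      fun w => (hom_map_lift (factorHom (wordSet n)) (fun l => ofList (χ l)) w).symm
    rw [h2, h2, factorHom_eq_iff, toList_lift, toList_lift] at h1
    have h3 := congrArg toList (h1 hχ)
    rwa [toList_lift, toList_lift] at h3
  · intro h φ
    choose χ hχ using fun l => factorHom_surjective (φ l)
    obtain rfl : (factorHom (wordSet n)) ∘ χ = φ := funext hχ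
    rw [← hom_map_lift, ← hom_map_lift, factorHom_eq_iff]
    intro hF
    apply toList.injective
    rw [toList_lift, toList_lift] at hF ⊢
    exact h _ hF

end Bridge

/-! ### Varieties and identities -/

section Varieties

universe v v₁ v₂

open FreeMonoid

theorem satisfies_of_injective {M : Type v₁} {N : Type v₂} [Monoid M] [Monoid N] (f : M →* N)
    (hf : Function.Injective f) {e : Identity} (h : Satisfies N e) : Satisfies M e := fun φ =>
  hf (by rw [hom_map_lift, hom_map_lift]; exact h _)

theorem satisfies_ulift_iff {M : Type v₁} [Monoid M] {e : Identity} :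
    Satisfies (ULift.{v₂} M) e ↔ Satisfies M e :=
  ⟨satisfies_of_injective (MulEquiv.ulift.symm : M ≃* ULift.{v₂} M).toMonoidHom
      MulEquiv.ulift.symm.injective,
    satisfies_of_injective (MulEquiv.ulift : ULift.{v₂} M ≃* M).toMonoidHom
      MulEquiv.ulift.injective⟩

variable {V : MonoidVariety.{v}}

/-- A monoid `Q` belongs to a variety if it is a quotient of a monoid `A` by a congruence that
contains the kernel of a homomorphism from `A` to a monoid in the variety. -/
theorem mem_of_factor {A : Type v₁} {P Q : Type v} [Monoid A] [Monoid P] [Monoid Q]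
    (hP : V.Mem P) (f : A →* P) (g : A →* Q) (hg : Function.Surjective g)
    (h : ∀ a b, f a = f b → g a = g b) : V.Mem Q := by
  choose s hs using fun x : MonoidHom.mrange f => x.2
  have key : ∀ a (ha : f a ∈ MonoidHom.mrange f), g (s ⟨f a, ha⟩) = g a := fun a ha =>
    h _ _ (hs ⟨f a, ha⟩)
  refine V.mem_of_surjective (M := MonoidHom.mrange f) (N := Q)
    { toFun := fun x => g (s x)
      map_one' := by
        rw [← map_one g]; exact h _ _ ((hs 1).trans (map_one f).symm)
      map_mul' := fun x y => by
        rw [← map_mul]; refine h _ _ ((hs _).trans ?_)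
        rw [map_mul, hs, hs]; rfl } (fun q => ?_) (V.mem_submonoid _ hP)
  obtain ⟨a, rfl⟩ := hg q
  exact ⟨⟨f a, a, rfl⟩, key a _⟩

/-- A variety is determined by its identities (Birkhoff). -/
theorem mem_of_satisfies {M : Type v} [Monoid M]
    (h : ∀ e : Identity, (∀ (N : Type v) [Monoid N], V.Mem N → Satisfies N e) → Satisfies M e) :
    V.Mem M := by
  classical
  refine mem_of_factor (A := FreeMonoid M)
    (V.mem_pi (fun c : {c : Con (FreeMonoid M) // V.Mem c.Quotient} => c.1.Quotient)
      fun c => c.2)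
    (MonoidHom.pi fun c => c.1.mk') (lift id) (fun m => ⟨of m, rfl⟩) fun a b hab => ?_
  -- The elements of `M` that occur in `a` or `b` are replaced by variables.
  set L := toList a ++ toList b with hL
  let ν : M → Letter := fun m => .s (L.idxOf m)
  let κ : Letter → M := fun l => match l with
    | .s i => (L[i]?).getD 1
    | _ => 1
  have hκ : ∀ m ∈ L, κ (ν m) = m := fun m hm => by
    change (L[L.idxOf m]?).getD 1 = m
    rw [List.getElem?_idxOf hm]; rfl
  have hlift : ∀ w : FreeMonoid M, (∀ m ∈ toList w, m ∈ L) →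
      lift κ (map ν w) = lift id w := fun w hw => by
    rw [lift_apply, lift_apply, toList_map, List.map_map]
    congr 1
    exact List.map_congr_left fun m hm => hκ m (hw m hm)
  have key := h (map ν a, map ν b) fun N _ hN φ => by
    set ψ : FreeMonoid M →* N := (lift φ).comp (map ν) with hψ
    have hV : V.Mem (Con.ker ψ).Quotient :=
      V.mem_of_surjective (Con.quotientKerEquivRange ψ).symm.toMonoidHom
        (Con.quotientKerEquivRange ψ).symm.surjective (V.mem_submonoid _ hN)
    have hq := congrFun hab ⟨Con.ker ψ, hV⟩
    exact (Con.eq _).1 hq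
  have := key κ
  rwa [hlift a fun m hm => List.mem_append_left _ hm,
    hlift b fun m hm => List.mem_append_right _ hm] at this

theorem satisfies_of_mem_factorVariety {W : Set Word} {M : Type v} [Monoid M]
    (hM : (factorVariety.{v} W).Mem M) {e : Identity} (h : Satisfies (FactorMonoid W) e) :
    Satisfies M e := by
  have hF : (factorVariety.{v} W).Mem (ULift.{v} (FactorMonoid W)) := fun V hV => hV
  exact (hM ((factorVariety.{v} W).definedBy {e}) ⟨hF, by
    rintro e rfl; exact satisfies_ulift_iff.2 h⟩).2 e rfl

variable {n : ℕ}

/-- An equivalence relation on `W_n`, extended by equality to a relation between all lists. -/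
def listRel (π : Setoid (wordSet n)) (u v : List Letter) : Prop :=
  u = v ∨ ∃ (hu : ofList u ∈ wordSet n) (hv : ofList v ∈ wordSet n), π ⟨_, hu⟩ ⟨_, hv⟩

theorem listRel_equivalence (π : Setoid (wordSet n)) : Equivalence (listRel π) where
  refl _ := Or.inl rfl
  symm := by
    rintro u v (rfl | ⟨hu, hv, h⟩)
    · exact Or.inl rfl
    · exact Or.inr ⟨hv, hu, π.symm h⟩
  trans := by
    rintro u v w (rfl | ⟨hu, hv, h⟩) (rfl | ⟨hv', hw, h'⟩)
    · exact Or.inl rfl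
    · exact Or.inr ⟨hv', hw, h'⟩
    · exact Or.inr ⟨hu, hv, h⟩
    · exact Or.inr ⟨hu, hw, π.trans h h'⟩

/-- Soundness of derivations. -/
theorem satisfies_of_der {π : Setoid (wordSet n)} {M : Type v} [Monoid M]
    (hM : ((factorVariety.{v} (wordSet n)).definedBy (identitiesOf π)).Mem M) {u v : Word}
    (h : Der n (listRel π) (toList u) (toList v)) : Satisfies M (u, v) := by
  suffices H : ∀ u v, Der n (listRel π) u v → Satisfies M (ofList u, ofList v) from H _ _ h
  intro u v h
  induction h with
  | refl => exact fun φ => rfl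
  | @tail b c _ hc ih =>
    intro φ
    refine (ih φ).trans ?_
    rcases hc with hc | ⟨p, q, ψ, ε, η, hR, rfl, rfl⟩
    · exact satisfies_of_mem_factorVariety hM.1
        (satisfies_factorMonoid_iff (e := (ofList b, ofList c)).2 hc) φ
    · have hw : Satisfies M (ofList (wl n ε), ofList (wl n η)) := by
        rcases hR with hR | ⟨h1, h2, h3⟩
        · rw [hR]; exact fun φ => rfl
        · exact hM.2 _ ⟨⟨_, h1⟩, ⟨_, h2⟩, h3, rfl⟩
      have hs : ∀ w, lift φ (ofList (sub ψ w)) =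
          lift (fun l => lift φ (ofList (ψ l))) (ofList w) := fun w => by
        have h1 : ofList (sub ψ w) = lift (fun l => ofList (ψ l)) (ofList w) :=
          toList.injective (toList_lift _ _).symm
        rw [h1, hom_map_lift]; rfl
      change lift φ (ofList (p ++ sub ψ (wl n ε) ++ q)) = lift φ (ofList (p ++ sub ψ (wl n η) ++ q))
      simp only [ofList_append, map_mul, hs]
      rw [show lift _ (ofList (wl n ε)) = lift _ (ofList (wl n η)) from hw _]

/-- Derivability as a congruence on words. -/
def derCon (n : ℕ) (π : Setoid (wordSet n)) : Con Word where
  r u v := Der n (listRel π) (toList u) (toList v)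
  iseqv := ⟨fun _ => .refl, fun h => h.symm fun _ _ h => (listRel_equivalence π).symm h,
    fun h h' => h.trans h'⟩
  mul' {a b c d} h h' := by
    have h1 := h.context [] (toList c)
    have h2 := h'.context (toList b) []
    simp only [List.nil_append, List.append_nil] at h1 h2
    exact h1.trans h2

/-- The quotient of the free monoid by derivability belongs to the variety defined by `Id(π)`: it is
a quotient of the relatively free monoid of `𝕄(W_n)`, which embeds in a power of the factor
monoid. -/
theorem derCon_mem (π : Setoid (wordSet n)) :
    ((factorVariety.{v} (wordSet n)).definedBy (identitiesOf π)).Mem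
      (ULift.{v} (derCon n π).Quotient) := by
  refine ⟨?_, fun e he => satisfies_ulift_iff.2 fun φ => ?_⟩
  · refine mem_of_factor (A := Word)
      ((factorVariety.{v} (wordSet n)).mem_pi
        (fun _ : ULift.{v} (Letter → FactorMonoid (wordSet n)) =>
          ULift.{v} (FactorMonoid (wordSet n))) fun _ _ hV => hV)
      (MonoidHom.pi fun φ => MulEquiv.ulift.symm.toMonoidHom.comp (lift φ.down))
      (MulEquiv.ulift.symm.toMonoidHom.comp (derCon n π).mk')
      (MulEquiv.ulift.symm.surjective.comp (derCon n π).mk'_surjective) fun a b hab => ?_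
    refine congrArg ULift.up ((Con.eq _).2 (Der.of_eq1 ?_))
    refine satisfies_factorMonoid_iff (e := (a, b)).1 fun φ => ?_
    exact congrArg ULift.down (congrFun hab ⟨φ⟩)
  · obtain ⟨u, v, hπ, rfl⟩ := he
    choose χ hχ using fun l => (derCon n π).mk'_surjective (φ l)
    obtain rfl : (derCon n π).mk' ∘ χ = φ := funext hχ
    rw [← hom_map_lift, ← hom_map_lift]
    refine (Con.eq _).2 ?_
    change Der n _ _ _
    obtain ⟨ε, hε⟩ := mem_wordSet.1 u.2
    obtain ⟨η, hη⟩ := mem_wordSet.1 v.2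
    have hR : listRel π (wl n ε) (wl n η) := by
      rw [← hε, ← hη]; exact Or.inr ⟨u.2, v.2, hπ⟩
    have := Der.of_form hR [] (fun l => toList (χ l)) []
    simp only [List.nil_append, List.append_nil] at this
    rwa [toList_lift, toList_lift, hε, hη]

/-- The identities of the variety defined by `Id(π)` are those derivable from it. -/
theorem der_of_satisfies {π : Setoid (wordSet n)} {u v : Word}
    (h : ∀ (M : Type v) [Monoid M],
      ((factorVariety.{v} (wordSet n)).definedBy (identitiesOf π)).Mem M → Satisfies M (u, v)) :
    Der n (listRel π) (toList u) (toList v) := by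
  have h1 := satisfies_ulift_iff.1 (h _ (derCon_mem π)) fun l => (derCon n π).mk' (of l)
  have h2 : ∀ w : Word, lift (fun l => (derCon n π).mk' (of l)) w =
      (derCon n π).mk' w := fun w => by
    have := hom_map_lift (derCon n π).mk' of w
    rw [show lift of w = w from DFunLike.congr_fun (lift_restrict (MonoidHom.id Word)) w] at this
    exact this.symm
  rw [h2, h2] at h1
  exact (Con.eq _).1 h1

end Varieties
/-! ### The interval of subvarieties -/

section Interval

open FreeMonoid

variable {n : ℕ}

theorem identitiesOf_mono {W : Set Word} {π π' : Setoid W} (h : π ≤ π') :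
    identitiesOf π ⊆ identitiesOf π' := by
  rintro e ⟨x, y, hxy, rfl⟩
  exact ⟨x, y, h hxy, rfl⟩

/-- The equivalence relation `π` can be recovered from the variety defined by `Id(π)`, since a
derivation from a word `w_ξ` leads only to words related to it by `π`. -/
theorem definedBy_le_iff {π π' : Setoid (wordSet n)} :
    (factorVariety.{u} (wordSet n)).definedBy (identitiesOf π') ≤
      (factorVariety.{u} (wordSet n)).definedBy (identitiesOf π) ↔ π ≤ π' := by
  refine ⟨fun h x y hxy => ?_, fun h M _ hM =>
    ⟨hM.1, fun e he => hM.2 e (identitiesOf_mono h he)⟩⟩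
  have hd : Der n (listRel π') (toList (x : Word)) (toList (y : Word)) :=
    der_of_satisfies.{u} fun M _ hM => (h M hM).2 _ ⟨x, y, hxy, rfl⟩
  obtain ⟨ε, hε⟩ := mem_wordSet.1 x.2
  have hv := hd.value (listRel_equivalence π') (χ := fun l => [l]) (by
    rw [sub_singleton, hε]; exact fac_wl n ε)
  simp only [sub_singleton] at hv
  have hR : listRel π' (toList (x : Word)) (toList (y : Word)) := by
    rcases hv with hv | ⟨ζ, η, h1, h2, h3⟩
    · exact Or.inl hv.symm
    · rwa [h1, h2]
  rcases hR with hR | ⟨_, _, hR⟩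
  · rw [Subtype.ext (toList.injective hR)]
  · exact hR

/-- Every variety in the interval is defined within `𝕄(W_n)` by the identities between words in
`W_n` that it satisfies. -/
theorem exists_eq_definedBy (hn : 2 ≤ n) {V : MonoidVariety.{u}}
    (h₁ : (factorVariety.{u} (wordSet n)).definedBy (identitiesOf (⊤ : Setoid (wordSet n))) ≤ V)
    (h₂ : V ≤ factorVariety.{u} (wordSet n)) :
    ∃ π : Setoid (wordSet n), (factorVariety.{u} (wordSet n)).definedBy (identitiesOf π) = V := by
  let π : Setoid (wordSet n) :=
    { r := fun x y => ∀ (M : Type u) [Monoid M], V.Mem M → Satisfies M ((x : Word), (y : Word))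
      iseqv := ⟨fun _ _ _ _ _ => rfl, fun {x y} h M [Monoid M] hM φ => (h M hM φ).symm,
        fun {x y z} h h' M [Monoid M] hM φ => (h M hM φ).trans (h' M hM φ)⟩ }
  refine ⟨π, le_antisymm ?_ ?_⟩
  · intro M _ hM
    refine mem_of_satisfies fun e he => satisfies_of_der hM (u := e.1) (v := e.2) ?_
    have hd : DerT n (toList e.1) (toList e.2) :=
      (der_of_satisfies.{u} fun N _ hN => he N (h₁ N hN)).toT
    refine hd.der hn (fun a => Or.inl rfl) fun χ ξ η hξ hη => Or.inr ?_
    refine ⟨mem_wordSet.2 ⟨ξ, rfl⟩, mem_wordSet.2 ⟨η, rfl⟩, fun N _ hN φ => ?_⟩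
    have hlift : ∀ w : Word, ofList (sub χ (toList w)) = lift (fun l => ofList (χ l)) w :=
      fun w => toList.injective (toList_lift _ _).symm
    change lift φ (ofList (wl n ξ)) = lift φ (ofList (wl n η))
    rw [← hξ, ← hη, hlift, hlift, hom_map_lift, hom_map_lift]
    exact he N hN _
  · intro M _ hM
    refine ⟨h₂ M hM, ?_⟩
    rintro e ⟨x, y, hxy, rfl⟩
    exact hxy M hM

end Interval

end FactorLattice

theorem proposition4p1 (n : ℕ) (hn : 2 ≤ n) :
    ∃ Φ : (Setoid (wordSet n))ᵒᵈ ≃o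
        Set.Icc ((factorVariety.{u} (wordSet n)).subvarietyOf
            (identitiesOf (⊤ : Setoid (wordSet n))))
          (⟨factorVariety.{u} (wordSet n), Set.self_mem_Iic⟩ :
            (factorVariety.{u} (wordSet n)).Subvarieties),
      ∀ π : Setoid (wordSet n),
        (Φ (OrderDual.toDual π) : (factorVariety.{u} (wordSet n)).Subvarieties) =
          (factorVariety.{u} (wordSet n)).subvarietyOf (identitiesOf π) := by
  let f : (Setoid (wordSet n))ᵒᵈ ↪o
      Set.Icc ((factorVariety.{u} (wordSet n)).subvarietyOf
          (identitiesOf (⊤ : Setoid (wordSet n))))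
        (⟨factorVariety.{u} (wordSet n), Set.self_mem_Iic⟩ :
          (factorVariety.{u} (wordSet n)).Subvarieties) :=
    OrderEmbedding.ofMapLEIff
      (fun π => ⟨(factorVariety.{u} (wordSet n)).subvarietyOf
        (identitiesOf (OrderDual.ofDual π)), FactorLattice.definedBy_le_iff.2 le_top,
        MonoidVariety.definedBy_le _ _⟩)
      fun π π' => FactorLattice.definedBy_le_iff (π := OrderDual.ofDual π')
        (π' := OrderDual.ofDual π)
  refine ⟨RelIso.ofSurjective f fun V => ?_, fun π => rfl⟩
  obtain ⟨π, hπ⟩ := FactorLattice.exists_eq_definedBy hn V.2.1 V.2.2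
  exact ⟨OrderDual.toDual π, Subtype.ext (Subtype.ext hπ)⟩
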